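/- Let $K$ be an algebraically closed field of arbitrary characteristic. For $0\neq f\in K[[x,y]]$ without constant term, let $C:\{f=0\}$ be the algebroid curve defined by $f$ (the ideal generated by $f$), let $m(C)=\operatorname{ord} f$ be its multiplicity, and for $D:\{g=0\}$ put $(C,D)_0=\dim_K K[[x,y]]/(f,g)$. The curve $C$ is reduced if $f$ has no multiple factors, singular if $m(C)\ge 2$, and a branch if $f$ is irreducible; a branch is smooth if its multiplicity is $1$; the branches of $C$ are the curves given by the pairwise non-associated irreducible factors of $f$. For branches $C,D$ put $d(C,D)=\frac{(C,D)_0}{m(C)m(D)}$; for reduced curves $C$, $D$ with branches $C_i$, $D_j$ put $d(C,D)=\inf_{i,j}d(C_i,D_j)$. The contact exponent of $C$ is $d(C)=\sup_W d(C,W)$, where $W$ runs over all smooth branches. For a reduced curve $C:\{f=0\}$ let $r(C)$ be the number of its branches and let $c(C)=\dim_K\overline{\mathcal O}_C/\mathcal C$, where $\mathcal O_C=K[[x,y]]/(f)$, $\overline{\mathcal O}_C$ is the integral closure of $\mathcal O_C$ in its total ring of fractions, and $\mathcal C$ is the conductor of $\overline{\mathcal O}_C$ in $\mathcal O_C$.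 The Milnor number of $C$ is $\mu(C)=c(C)-r(C)+1$. For a branch $C:\{f=0\}$ let $\Gamma(C)=\{(f,g)_0 : g\in K[[x,y]],\ f\nmid g\}$, and let $v_0,\dots,v_g$ be its minimal system of generators: $v_0=\min(\Gamma(C)\setminus\{0\})$, $v_k=\min(\Gamma(C)\setminus(\mathbb N v_0+\dots+\mathbb N v_{k-1}))$ for $1\le k\le g$, and $\Gamma(C)=\mathbb N v_0+\dots+\mathbb N v_g$. With $e_k=\gcd(v_0,\dots,v_k)$, the Zariski pairs of $C$ are $\left(\frac{v_k}{e_k},\frac{e_{k-1}}{e_k}\right)$, $1\le k\le g$. Proposition. Let $C$ be a singular reduced curve with branches $C_1,\dots,C_r$. Then $r(C)$, $c(C)$ and $d(C)$ are finite, and $$\mu(C)\ \ge\ (d(C)\,m(C)-1)(m(C)-1).$$ Equality holds if and only if the following two conditions are satisfied: $(e_1)$ $d(C_i,C_j)=d(C)$ for all $i\ne j$; $(e_2)$ if the branch $C_i$ is singular, then $C_i$ has exactly one Zariski pair and $d(C_i)=d(C)$. -/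

import Mathlib

open scoped ENNReal

noncomputable section

namespace PlaneCurve

/-- The ring `K[[x,y]]` of formal power series in two variables. -/
abbrev PS (K : Type*) [Field K] : Type _ := MvPowerSeries (Fin 2) K

variable {K : Type*} [Field K]

/- A non-zero `f : PS K` without constant term stands for the algebroid curve `{f = 0}`, that is,
for the ideal generated by `f`. All the invariants below depend only on this ideal. -/

/-- The multiplicity `m(C)` of the curve `C : {f = 0}`: the order of the power series `f`. -/
def mult (f : PS K) : ℕ := (MvPowerSeries.order f).toNat

/-- `f` is an equation of a reduced algebroid curve: a non-zero power series without constant term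
and without multiple factors. -/
def IsReducedCurve (f : PS K) : Prop :=
  f ≠ 0 ∧ MvPowerSeries.constantCoeff f = 0 ∧ Squarefree f

/-- The branch `{p = 0}` is an irreducible component of the curve `{f = 0}`.
Two such `p`, `q` define the same branch if and only if they are associated. -/
def IsBranchOf (p f : PS K) : Prop := Irreducible p ∧ p ∣ f

/-- The set of irreducible components of the curve `{f = 0}`, as a set of ideals. -/
def branches (f : PS K) : Set (Ideal (PS K)) :=
  {I | ∃ p, IsBranchOf p f ∧ I = Ideal.span {p}}

/-- The number of branches `r(C)`. -/
def numBranches (f : PS K) : ℕ := (branches f).ncard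

/-- A smooth branch: an irreducible curve of multiplicity one. -/
def IsSmoothBranch (w : PS K) : Prop := Irreducible w ∧ mult w = 1

/-- The intersection number `(f,g)₀ = dim_K K[[x,y]]/(f,g)`, possibly infinite. -/
def interNum (f g : PS K) : ℕ∞ :=
  Cardinal.toENat (Module.rank K (PS K ⧸ (Ideal.span {f, g} : Ideal (PS K))))

/-- The order of contact `d(C,D) = (C,D)₀ / (m(C) m(D))` of two branches. -/
def branchContact (p q : PS K) : ℝ≥0∞ :=
  (interNum p q : ℝ≥0∞) / ((mult p : ℝ≥0∞) * (mult q : ℝ≥0∞))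

/-- The order of contact of two reduced curves: the infimum of the orders of contact of their
irreducible components. -/
def contact (f g : PS K) : ℝ≥0∞ :=
  ⨅ (p : PS K) (_ : IsBranchOf p f) (q : PS K) (_ : IsBranchOf q g), branchContact p q

/-- The contact exponent `d(C)`: the supremum of `d(C,W)` over all smooth branches `W`. -/
def contactExp (f : PS K) : ℝ≥0∞ :=
  ⨆ (w : PS K) (_ : IsSmoothBranch w), contact f w

/-- The local ring `O_C = K[[x,y]]/(f)`. -/
abbrev LocRing (f : PS K) : Type _ := PS K ⧸ (Ideal.span {f} : Ideal (PS K))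

/-- The integral closure of `O_C` in its total ring of fractions. -/
abbrev Normalization (f : PS K) : Subalgebra (LocRing f) (FractionRing (LocRing f)) :=
  integralClosure (LocRing f) (FractionRing (LocRing f))

/-- The conductor of a ring extension `B` of `A`: the ideal of all `x` in `B` such that `x B` is
contained in (the image of) `A`. -/
def conductorIdeal (A B : Type*) [CommRing A] [CommRing B] [Algebra A B] : Ideal B where
  carrier := {x | ∀ y : B, x * y ∈ (algebraMap A B).range}
  zero_mem' := fun y => by simp
  add_mem' := fun ha hb y => by
    rw [add_mul]
    exact add_mem (ha y) (hb y)
  smul_mem' := fun c x hx y => by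
    have h := hx (c * y)
    rwa [smul_eq_mul, mul_comm c x, mul_assoc]

/-- The quotient of the integral closure of `O_C` by the conductor. -/
abbrev ConductorQuotient (f : PS K) : Type _ :=
  Normalization f ⧸ conductorIdeal (LocRing f) (Normalization f)

/-- The degree of the conductor `c(C)`: the dimension over `K` of the integral closure of `O_C`
modulo the conductor. -/
def conductorDegree (f : PS K) : ℕ := Module.finrank K (ConductorQuotient f)

/-- The Milnor number `μ(C) = c(C) - r(C) + 1`. -/
def milnor (f : PS K) : ℤ := (conductorDegree f : ℤ) - (numBranches f : ℤ) + 1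

/-- The semigroup `Γ(C)` of the branch `C : {p = 0}`: all the intersection numbers `(p,g)₀` with
`g` not divisible by `p`. -/
def semigroup (p : PS K) : Set ℕ :=
  {n | ∃ g : PS K, ¬ p ∣ g ∧ interNum p g = (n : ℕ∞)}

/-- `v 0, …, v g` is the minimal system of generators of `Γ`: `v 0` is the least non-zero element
of `Γ`, each further `v k` is the least element of `Γ` outside `ℕ v 0 + ⋯ + ℕ v (k-1)`, and
`Γ = ℕ v 0 + ⋯ + ℕ v g`. -/
structure IsMinGenSystem (Γ : Set ℕ) (g : ℕ) (v : Fin (g + 1) → ℕ) : Prop where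
  zero : IsLeast (Γ \ {0}) (v 0)
  step : ∀ k : Fin (g + 1), 0 < k →
    IsLeast (Γ \ (AddSubmonoid.closure (v '' Set.Iio k) : Set ℕ)) (v k)
  generates : Γ = (AddSubmonoid.closure (Set.range v) : Set ℕ)

/-- `e k = gcd (v 0, …, v k)`. -/
def gcdSeq {g : ℕ} (v : Fin (g + 1) → ℕ) (k : Fin (g + 1)) : ℕ := (Finset.Iic k).gcd v

/-- `L` is the sequence of the Zariski pairs `(v k / e k, e (k-1) / e k)`, `1 ≤ k ≤ g`, of the
branch `{p = 0}`, where `v 0, …, v g` is the minimal system of generators of its semigroup. -/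
def IsZariskiPairs (p : PS K) (L : List (ℕ × ℕ)) : Prop :=
  ∃ (g : ℕ) (v : Fin (g + 1) → ℕ), IsMinGenSystem (semigroup p) g v ∧
    L = List.ofFn fun k : Fin g =>
      (v k.succ / gcdSeq v k.succ, gcdSeq v k.castSucc / gcdSeq v k.succ)

end PlaneCurve

end

set_option linter.unusedSectionVars false

/-! ### Lengths -/

section Length

variable {R N M P : Type*} [Ring R] [AddCommGroup N] [AddCommGroup M] [AddCommGroup P]
  [Module R N] [Module R M] [Module R P]

/-! Write `f` up to a unit as the product of pairwise non-associated irreducible `p i`, with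
multiplicities `m i`, and let `m` be their sum and `d = d(C)`. Two additivity formulas carry the
proof. The conductor degree is `c(C) = ∑ i, (c(C_i) + ∑ j ≠ i, (C_i, C_j)₀)`, so that `μ(C)` is this
sum minus `r` plus `1`. The bound splits in the same way: `(d m - 1)(m - 1) = ∑ i, ((d m_i - 1)(m_i
- 1) + ∑ j ≠ i, d m_i m_j) - r + 1`. It is therefore enough to compare summands, and equality in the
total means equality in every summand.

Pairs of branches: `d m_i m_j ≤ (C_i, C_j)₀` says that `d(C) ≤ d(C_i, C_j)`. It follows from the
strong triangle inequality `min (d(C_i, W)) (d(C_j, W)) ≤ d(C_i, C_j)` for smooth `W`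
(`min_branchContact_le`). This rests on `IsBranchRing.min_le_val`: a determinant equation of an
irreducible series shows that its Newton polygon has a single edge.

Single branches: for a singular branch with semigroup generators `n = v_0` and `v = v_1` one has
`d(C_i) = v / n`, and the conductor is at least `(n - 1)(v - 1)`, with equality exactly when `n` and
`v` are coprime, that is, when there is one Zariski pair (`IsBranchRing.condExp_of_two_le`). Here
`v` is the largest value of a parameter `w` complementing a transversal parameter `u`. If the
conductor were smaller, `w ^ (n - 1)` would lie in the ideal `(u, p)`, contradicting `(u, p)₀ = n`.
A smooth branch contributes zero on both sides.

All of this is computed with values in the normalization of a branch, which is a discrete valuation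
ring finite over `K[[x,y]]` with residue field `K`. Intersection numbers with the branch are values
there (`IsBranchRing.interNum_eq_val`). The characteristic is arbitrary, so parametrizations by
roots are avoided; everything is done with lengths, Nakayama's lemma and cancellation of leading
coefficients. -/

theorem Module.length_quotient_range_comp (f : N →ₗ[R] M) (g : M →ₗ[R] P)
    (hg : Function.Injective g) :
    Module.length R (P ⧸ LinearMap.range (g ∘ₗ f)) =
      Module.length R (M ⧸ LinearMap.range f) + Module.length R (P ⧸ LinearMap.range g) := by
  have h1 : LinearMap.range f ≤ (LinearMap.range (g ∘ₗ f)).comap g := by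
    rintro _ ⟨x, rfl⟩
    exact ⟨x, rfl⟩
  have h2 : LinearMap.range (g ∘ₗ f) ≤ LinearMap.range g := LinearMap.range_comp_le_range f g
  refine Module.length_eq_add_of_exact (Submodule.mapQ _ _ g h1) (Submodule.factor h2) ?_ ?_ ?_
  · rw [← LinearMap.ker_eq_bot, LinearMap.ker_eq_bot']
    intro x
    induction x using Submodule.Quotient.induction_on with
    | _ x =>
      intro hx
      rw [Submodule.mapQ_apply, Submodule.Quotient.mk_eq_zero] at hx
      obtain ⟨y, hy⟩ := hx
      rw [Submodule.Quotient.mk_eq_zero]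
      exact ⟨y, hg hy⟩
  · exact Submodule.factor_surjective h2
  · intro x
    induction x using Submodule.Quotient.induction_on with
    | _ x =>
      constructor
      · intro hx
        have hx' : x ∈ LinearMap.range g := by
          simpa [Submodule.factor, Submodule.mapQ_apply] using hx
        obtain ⟨y, rfl⟩ := hx'
        exact ⟨Submodule.Quotient.mk y, by simp⟩
      · rintro ⟨y, hy⟩
        induction y using Submodule.Quotient.induction_on with
        | _ y =>
          rw [← hy]
          simp [Submodule.factor, Submodule.mapQ_apply]

/-- Two commuting injective endomorphisms of a module and of a submodule of finite colength have
cokernels of the same length. -/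
theorem Module.length_coker_eq (i : N →ₗ[R] M) (hi : Function.Injective i)
    (a : N →ₗ[R] N) (b : M →ₗ[R] M) (hb : Function.Injective b) (hab : b ∘ₗ i = i ∘ₗ a)
    (hfin : Module.length R (M ⧸ LinearMap.range i) ≠ ⊤) :
    Module.length R (M ⧸ LinearMap.range b) = Module.length R (N ⧸ LinearMap.range a) := by
  -- The cokernel of `b ∘ i = i ∘ a` is measured along both factorizations. The cokernel of `i`
  -- occurs in each of them and, being of finite length, cancels.
  have h1 := Module.length_quotient_range_comp i b hb
  have h2 := Module.length_quotient_range_comp a i hi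
  rw [hab, h2, add_comm] at h1
  exact (ENat.add_right_injective_of_ne_top hfin h1).symm

/-- A finitely generated submodule of maximal length is everything, since adjoining one more element
would raise the length. Maximality is expressed by minimizing `D` minus the length. -/
theorem Module.finite_of_length_le (D : ℕ)
    (h : ∀ Q : Submodule R M, Q.FG → Module.length R Q ≤ D) : Module.Finite R M := by
  have hex : ∃ n : ℕ, ∃ Q : Submodule R M, Q.FG ∧ D - (Module.length R Q).toNat = n :=
    ⟨_, ⊥, Submodule.fg_bot, rfl⟩
  classical
  obtain ⟨Q, hQ, hQn⟩ := Nat.find_spec hex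
  refine ⟨?_⟩
  convert hQ
  by_contra hne
  obtain ⟨x, -, hx⟩ := SetLike.exists_of_lt (lt_of_le_of_ne le_top (Ne.symm hne))
  have hlt : Q < Q ⊔ Submodule.span R {x} := by
    refine lt_of_le_of_ne le_sup_left fun he => hx ?_
    rw [he]
    exact Submodule.mem_sup_right (Submodule.mem_span_singleton_self x)
  have hfg : (Q ⊔ Submodule.span R {x}).FG := hQ.sup (Submodule.fg_span_singleton x)
  have h1 := h Q hQ
  have h2 := h _ hfg
  have h3 : Module.length R Q < Module.length R ↥(Q ⊔ Submodule.span R {x}) := by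
    rw [Module.length_submodule, Module.length_submodule]
    refine Order.height_strictMono hlt ?_
    rw [← Module.length_submodule]
    exact lt_of_le_of_lt h1 (ENat.natCast_lt_top D)
  have hm := Nat.find_min' hex ⟨_, hfg, rfl⟩
  rw [← hQn] at hm
  obtain ⟨a, ha⟩ := ENat.ne_top_iff_exists.mp (ne_top_of_le_ne_top (ENat.natCast_ne_top D) h1)
  obtain ⟨b, hb⟩ := ENat.ne_top_iff_exists.mp (ne_top_of_le_ne_top (ENat.natCast_ne_top D) h2)
  rw [← ha] at h1 h3 hm
  rw [← hb] at h2 h3 hm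
  simp only [Nat.cast_le, Nat.cast_lt, ENat.toNat_natCast] at *
  omega

end Length

/-- The module is finitely generated over `O/(d)`, which is Artinian because `d` is regular and the
dimension is at most one. -/
theorem Module.length_ne_top_of_isTorsionBy {O M : Type*} [CommRing O] [IsNoetherianRing O]
    [Ring.KrullDimLE 1 O] [AddCommGroup M] [Module O M] [Module.Finite O M] {d : O}
    (hd : d ∈ nonZeroDivisors O) (h : Module.IsTorsionBy O M d) : Module.length O M ≠ ⊤ := by
  let := h.module
  have hfl := isFiniteLength_quotient_span_singleton O hd
  rw [isFiniteLength_iff_isNoetherian_isArtinian] at hfl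
  have h1 : IsArtinian O (O ⧸ Ideal.span {d}) := hfl.2
  have h2 : IsArtinianRing (O ⧸ Ideal.span {d}) := isArtinian_of_tower O h1
  have h3 : Module.Finite (O ⧸ Ideal.span {d}) M := Module.Finite.of_restrictScalars_finite O _ _
  have h4 : IsArtinian (O ⧸ Ideal.span {d}) M := inferInstance
  have h5 : IsArtinian O M :=
    isArtinian_of_surjective_algebraMap (Ideal.Quotient.mk_surjective (I := .span {d}))
  exact Module.length_ne_top

/-! ### The integral closure of a one-dimensional complete local domain -/

section IntegralClosure

open IsLocalRing

variable {O B : Type*} [CommRing O] [IsDomain O] [IsNoetherianRing O] [Ring.KrullDimLE 1 O]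
  [CommRing B] [IsDomain B] [Algebra O B] [FaithfulSMul O B]

theorem Submodule.FG.exists_common_denominator
    (hfrac : ∀ b : B, ∃ d : O, d ≠ 0 ∧ ∃ a : O, d • b = algebraMap O B a)
    {M : Submodule O B} (hM : M.FG) :
    ∃ d : O, d ≠ 0 ∧ ∀ m ∈ M, ∃ a : O, d • m = algebraMap O B a := by
  induction M, hM using Submodule.fg_induction with
  | singleton b =>
    obtain ⟨d, hd, a, ha⟩ := hfrac b
    refine ⟨d, hd, fun m hm => ?_⟩
    obtain ⟨c, rfl⟩ := Submodule.mem_span_singleton.mp hm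
    exact ⟨c * a, by rw [smul_comm, ha, map_mul, Algebra.smul_def]⟩
  | sup M₁ M₂ _ _ h₁ h₂ =>
    obtain ⟨d, hd, h₁⟩ := h₁
    obtain ⟨e, he, h₂⟩ := h₂
    refine ⟨d * e, mul_ne_zero hd he, fun m hm => ?_⟩
    obtain ⟨x, hx, y, hy, rfl⟩ := Submodule.mem_sup.mp hm
    obtain ⟨a, ha⟩ := h₁ x hx
    obtain ⟨b, hb⟩ := h₂ y hy
    refine ⟨e * a + d * b, ?_⟩
    rw [smul_add, mul_comm d e, mul_smul, ha, mul_comm e d, mul_smul, hb, map_add, map_mul, map_mul,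
      Algebra.smul_def, Algebra.smul_def]

/-- `M` contains a copy of `O`, and a common denominator kills the cokernel, which thus has finite
length. Hence multiplication by `g` has the same colength on `M` as on `O`, whatever `M` is. -/
theorem Submodule.length_quotient_smul_eq_ord
    (hfrac : ∀ b : B, ∃ d : O, d ≠ 0 ∧ ∃ a : O, d • b = algebraMap O B a)
    {M : Submodule O B} (hM : M.FG) (h1 : (1 : B) ∈ M) {g : O} (hg : g ≠ 0) :
    Module.length O (M ⧸ LinearMap.range (LinearMap.lsmul O M g)) = Ring.ord O g := by
  obtain ⟨d, hd, hdM⟩ := hM.exists_common_denominator hfrac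
  let i : O →ₗ[O] M := LinearMap.toSpanSingleton O M ⟨1, h1⟩
  have hi : Function.Injective i := by
    intro a b hab
    have := congrArg Subtype.val hab
    simp only [i, LinearMap.toSpanSingleton_apply, SetLike.val_smul, Algebra.smul_def, mul_one]
      at this
    exact FaithfulSMul.algebraMap_injective O B this
  have : Module.Finite O M := Module.Finite.iff_fg.mpr hM
  have htors : Module.IsTorsionBy O (M ⧸ LinearMap.range i) d := by
    intro x
    induction x using Submodule.Quotient.induction_on with
    | _ x =>
      rw [← Submodule.Quotient.mk_smul, Submodule.Quotient.mk_eq_zero]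
      obtain ⟨a, ha⟩ := hdM x x.2
      refine ⟨a, Subtype.ext ?_⟩
      simp only [i, LinearMap.toSpanSingleton_apply, SetLike.val_smul, ha]
      rw [Algebra.smul_def, mul_one]
  have hlen := Module.length_coker_eq i hi (LinearMap.lsmul O O g) (LinearMap.lsmul O M g)
    (by
      intro x y hxy
      have := congrArg Subtype.val hxy
      simp only [LinearMap.lsmul_apply, SetLike.val_smul, Algebra.smul_def] at this
      refine Subtype.ext (mul_left_cancel₀ ?_ this)
      rwa [Ne, FaithfulSMul.algebraMap_eq_zero_iff])
    (by ext; simp [i])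
    (Module.length_ne_top_of_isTorsionBy (mem_nonZeroDivisors_of_ne_zero hd) htors)
  rw [hlen, Ring.ord]
  have : LinearMap.range (LinearMap.lsmul O O g) = Ideal.span {g} := by
    ext x
    rw [Ideal.mem_span_singleton']
    constructor
    · rintro ⟨y, rfl⟩
      exact ⟨y, by simp [mul_comm]⟩
    · rintro ⟨y, rfl⟩
      exact ⟨y, by simp [mul_comm]⟩
  rw [this]

/-- Every finitely generated submodule of `B/uB` lies in the image of some `M/uM` with `M` finitely
generated and containing `1`, so its length is at most `ord u`. The bound is uniform, although `B`
is not yet known to be finite over `O`. -/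
theorem finite_quotient_smul_top
    (hfrac : ∀ b : B, ∃ d : O, d ≠ 0 ∧ ∃ a : O, d • b = algebraMap O B a) {u : O} (hu : u ≠ 0) :
    Module.Finite O (B ⧸ LinearMap.range (LinearMap.lsmul O B u)) := by
  have hne : Ring.ord O u ≠ ⊤ := Ring.ord_ne_top (mem_nonZeroDivisors_of_ne_zero hu)
  obtain ⟨D, hD⟩ := ENat.ne_top_iff_exists.mp hne
  refine Module.finite_of_length_le D fun Q hQ => ?_
  obtain ⟨N, hN, rfl⟩ : ∃ N : Submodule O B, N.FG ∧
      N.map (LinearMap.range (LinearMap.lsmul O B u)).mkQ = Q := by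
    obtain ⟨s, hs⟩ := hQ
    obtain ⟨t, ht⟩ := (s.finite_toSet).exists_finset_coe
    choose f hf using Submodule.mkQ_surjective (LinearMap.range (LinearMap.lsmul O B u))
    refine ⟨Submodule.span O (f '' s), Submodule.fg_span (s.finite_toSet.image f), ?_⟩
    rw [Submodule.map_span, ← hs, Set.image_image]
    simp [hf]
  set M := N ⊔ Submodule.span O {(1 : B)} with hMdef
  have hM : M.FG := hN.sup (Submodule.fg_span_singleton 1)
  have h1 : (1 : B) ∈ M := Submodule.mem_sup_right (Submodule.mem_span_singleton_self 1)
  have hlen := Submodule.length_quotient_smul_eq_ord hfrac hM h1 hu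
  rw [hD, ← hlen]
  have hle : LinearMap.range (LinearMap.lsmul O M u) ≤
      (LinearMap.range (LinearMap.lsmul O B u)).comap M.subtype := by
    rintro _ ⟨x, rfl⟩
    exact ⟨x, rfl⟩
  let f := Submodule.mapQ _ _ M.subtype hle
  calc Module.length O (N.map (LinearMap.range (LinearMap.lsmul O B u)).mkQ)
      ≤ Module.length O (LinearMap.range f) := by
        refine Module.length_le_of_injective (Submodule.inclusion ?_)
          (Submodule.inclusion_injective _)
        rintro _ ⟨x, hx, rfl⟩
        exact ⟨Submodule.Quotient.mk ⟨x, Submodule.mem_sup_left hx⟩, rfl⟩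
    _ ≤ _ := Module.length_le_of_surjective f.rangeRestrict f.surjective_rangeRestrict

theorem exists_algebraMap_eq_mul_of_isIntegral {b : B} (hb : IsIntegral O b) (hb0 : b ≠ 0) :
    ∃ o : O, o ≠ 0 ∧ ∃ c : B, algebraMap O B o = b * c := by
  exact hb.isAlgebraic.exists_nonzero_dvd (mem_nonZeroDivisors_of_ne_zero hb0)

variable [IsLocalRing O]

theorem exists_pow_maximalIdeal_le_span {u : O} (hu : u ≠ 0) :
    ∃ k : ℕ, maximalIdeal O ^ k ≤ Ideal.span {u} := by
  have hfl := isFiniteLength_quotient_span_singleton O (mem_nonZeroDivisors_of_ne_zero hu)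
  rw [isFiniteLength_iff_isNoetherian_isArtinian] at hfl
  have h2 : IsArtinianRing (O ⧸ Ideal.span {u}) := isArtinian_of_tower O hfl.2
  by_cases hunit : IsUnit u
  · exact ⟨0, by simp [Ideal.span_singleton_eq_top.mpr hunit]⟩
  have : Nontrivial (O ⧸ Ideal.span {u}) :=
    Ideal.Quotient.nontrivial_iff.mpr (mt Ideal.span_singleton_eq_top.mp hunit)
  have hloc : IsLocalRing (O ⧸ Ideal.span {u}) :=
    .of_surjective' (Ideal.Quotient.mk (Ideal.span {u})) Ideal.Quotient.mk_surjective
  obtain ⟨k, hk⟩ := (isArtinianRing_iff_isNilpotent_maximalIdeal (O ⧸ Ideal.span {u})).mp h2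
  refine ⟨k, ?_⟩
  have hmap : (maximalIdeal O).map (Ideal.Quotient.mk (Ideal.span {u})) ≤
      maximalIdeal (O ⧸ Ideal.span {u}) := by
    rw [Ideal.map_le_iff_le_comap]
    intro x hx
    have := IsLocalRing.surjective_units_map_of_local_ringHom
      (Ideal.Quotient.mk (Ideal.span {u})) Ideal.Quotient.mk_surjective
      (IsLocalHom.of_surjective _ Ideal.Quotient.mk_surjective)
    have hl : IsLocalHom (Ideal.Quotient.mk (Ideal.span {u})) :=
      IsLocalHom.of_surjective _ Ideal.Quotient.mk_surjective
    exact map_nonunit _ _ hx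
  have h3 : ((maximalIdeal O) ^ k).map (Ideal.Quotient.mk (Ideal.span {u})) = ⊥ := by
    rw [Ideal.map_pow, eq_bot_iff]
    exact (Ideal.pow_right_mono hmap k).trans hk.le
  rw [Ideal.map_eq_bot_iff_le_ker, Ideal.mk_ker] at h3
  exact h3

/-- A non-zero `b` divides some non-zero `o` in `O`. If `b` were divisible by arbitrarily high
powers of a non-unit `u`, so would `o` be, while `ord o` is finite. -/
theorem IsHausdorff.maximalIdeal_of_isIntegral [Algebra.IsIntegral O B] (hO : ¬ IsField O)
    (hfrac : ∀ b : B, ∃ d : O, d ≠ 0 ∧ ∃ a : O, d • b = algebraMap O B a) :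
    IsHausdorff (maximalIdeal O) B := by
  refine ⟨fun b hb => ?_⟩
  by_contra hb0
  obtain ⟨u, hu, hu0⟩ := Submodule.exists_mem_ne_zero_of_ne_bot
    (mt isField_iff_maximalIdeal_eq.mpr hO)
  obtain ⟨o, ho, c, hoc⟩ := exists_algebraMap_eq_mul_of_isIntegral (Algebra.IsIntegral.isIntegral
    (R := O) b) hb0
  obtain ⟨D, hD⟩ := ENat.ne_top_iff_exists.mp (Ring.ord_ne_top (mem_nonZeroDivisors_of_ne_zero ho))
  obtain ⟨k, hk⟩ := exists_pow_maximalIdeal_le_span hu0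
  have hmem := hb (k * (D + 1))
  rw [SModEq.zero, pow_mul] at hmem
  have hmem2 := Submodule.smul_mono_left (N := (⊤ : Submodule O B))
    (Ideal.pow_right_mono hk (D + 1)) hmem
  rw [Ideal.span_singleton_pow, Submodule.ideal_span_singleton_smul] at hmem2
  obtain ⟨b', -, hb'⟩ := hmem2
  have hb' : u ^ (D + 1) • b' = b := hb'
  -- From `o = u ^ (D + 1) * (b' * c)` follows `o M ⊆ u ^ (D + 1) M` for the ring `M = O[b' c]`. It
  -- is finitely generated by integrality, so colengths give `(D + 1) ord u ≤ ord o = D`.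
  set M : Submodule O B := Subalgebra.toSubmodule (Algebra.adjoin O {b' * c}) with hMdef
  have hM : M.FG := (Algebra.IsIntegral.isIntegral (R := O) (b' * c)).fg_adjoin_singleton
  have h1 : (1 : B) ∈ M := one_mem (Algebra.adjoin O {b' * c})
  have e1 := Submodule.length_quotient_smul_eq_ord hfrac hM h1 ho
  have e2 := Submodule.length_quotient_smul_eq_ord hfrac hM h1 (pow_ne_zero (D + 1) hu0)
  have hle : LinearMap.range (LinearMap.lsmul O M o) ≤
      LinearMap.range (LinearMap.lsmul O M (u ^ (D + 1))) := by
    rintro _ ⟨x, rfl⟩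
    refine ⟨⟨(b' * c) * x, ?_⟩, Subtype.ext ?_⟩
    · exact mul_mem (S := Subalgebra O B) (Algebra.subset_adjoin rfl) x.2
    · simp only [LinearMap.lsmul_apply, SetLike.val_smul]
      rw [← smul_mul_assoc, ← smul_mul_assoc, hb', ← hoc, Algebra.smul_def]
  have h3 := Module.length_le_of_surjective (Submodule.factor hle) (Submodule.factor_surjective hle)
  rw [e1, e2, Ring.ord_pow (mem_nonZeroDivisors_of_ne_zero hu0), ← hD] at h3
  have h4 : 1 ≤ Ring.ord O u := by
    rw [Order.one_le_iff_ne_zero, Ring.ord, Ne, Module.length_eq_zero_iff,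
      Submodule.Quotient.subsingleton_iff, Ideal.span_singleton_eq_top]
    exact hu
  have h5 : ((D + 1 : ℕ) : ℕ∞) ≤ (D + 1) • Ring.ord O u := by
    rw [nsmul_eq_mul]
    exact le_mul_of_one_le_right' h4
  have h6 := h5.trans h3
  rw [Nat.cast_le] at h6
  omega

theorem IsPrecomplete.pi_of_fintype {R ι : Type*} [CommRing R] [Fintype ι] (I : Ideal R)
    [IsPrecomplete I R] : IsPrecomplete I (ι → R) := by
  classical
  refine ⟨fun f hf => ?_⟩
  have hcoord : ∀ (n : ℕ) (x : ι → R),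
      x ∈ (I ^ n • ⊤ : Submodule R (ι → R)) ↔ ∀ i, x i ∈ (I ^ n • ⊤ : Submodule R R) := by
    intro n x
    constructor
    · intro hx i
      have := Submodule.mem_map_of_mem (f := LinearMap.proj (R := R) (φ := fun _ : ι => R) i) hx
      rw [Submodule.map_smul''] at this
      exact Submodule.smul_mono le_rfl le_top this
    · intro hx
      rw [pi_eq_sum_univ x]
      refine Submodule.sum_mem _ fun i _ => Submodule.smul_mem_smul ?_ trivial
      simpa using hx i
  have h : ∀ i, ∃ L : R, ∀ n, f n i ≡ L [SMOD (I ^ n • ⊤ : Submodule R R)] := fun i =>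
    IsPrecomplete.prec ‹_› (f := fun n => f n i) fun {m n} hmn => by
      have := hf hmn
      rw [SModEq.sub_mem, hcoord] at this
      rw [SModEq.sub_mem]
      exact this i
  choose L hL using h
  refine ⟨L, fun n => ?_⟩
  rw [SModEq.sub_mem, hcoord]
  exact fun i => SModEq.sub_mem.mp (hL i n)

/-- The complete form of Nakayama's lemma: `B` is separated, `B/𝔪B` is finite and `O` is complete,
so lifts of generators of `B/𝔪B` generate `B`. -/
theorem Module.Finite.of_isIntegral_of_isAdicComplete [Algebra.IsIntegral O B]
    [IsPrecomplete (maximalIdeal O) O] (hO : ¬ IsField O)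
    (hfrac : ∀ b : B, ∃ d : O, d ≠ 0 ∧ ∃ a : O, d • b = algebraMap O B a) :
    Module.Finite O B := by
  have hH : IsHausdorff (maximalIdeal O) B := .maximalIdeal_of_isIntegral hO hfrac
  obtain ⟨u, hu, hu0⟩ := Submodule.exists_mem_ne_zero_of_ne_bot
    (mt isField_iff_maximalIdeal_eq.mpr hO)
  have hfin := finite_quotient_smul_top hfrac hu0
  have hle : LinearMap.range (LinearMap.lsmul O B u) ≤ maximalIdeal O • (⊤ : Submodule O B) := by
    rintro _ ⟨x, rfl⟩
    exact Submodule.smul_mem_smul hu trivial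
  have hfin2 : Module.Finite O (B ⧸ maximalIdeal O • (⊤ : Submodule O B)) :=
    Module.Finite.of_surjective (Submodule.factor hle) (Submodule.factor_surjective hle)
  obtain ⟨n, f, hf⟩ := Module.Finite.exists_fin' O (B ⧸ maximalIdeal O • (⊤ : Submodule O B))
  obtain ⟨g, hg⟩ := Module.projective_lifting_property
    (Submodule.mkQ (maximalIdeal O • (⊤ : Submodule O B))) f (Submodule.mkQ_surjective _)
  have : IsPrecomplete (maximalIdeal O) (Fin n → O) := .pi_of_fintype _
  exact Module.Finite.of_surjective g
    (surjective_of_mkQ_comp_surjective (I := maximalIdeal O) (f := g) (by rwa [hg]))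

theorem IsPrecomplete.of_surjective {R M N : Type*} [CommRing R] [AddCommGroup M] [AddCommGroup N]
    [Module R M] [Module R N] (I : Ideal R) [IsPrecomplete I M] (f : M →ₗ[R] N)
    (hf : Function.Surjective f) : IsPrecomplete I N := by
  rw [← AdicCompletion.of_surjective_iff]
  intro y
  obtain ⟨x, rfl⟩ := AdicCompletion.map_surjective I hf y
  obtain ⟨x, rfl⟩ := AdicCompletion.of_surjective I M x
  exact ⟨f x, (AdicCompletion.map_of I f x).symm⟩

/-- Two maximal ideals would be separated by an idempotent of the Artinian ring `B/𝔪B`. As `B` is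
complete, the idempotent lifts by Hensel's lemma, but a domain has only the idempotents `0` and `1`.
-/
theorem IsLocalRing.of_finite_of_isAdicComplete [Module.Finite O B] [Algebra.IsIntegral O B]
    [IsPrecomplete (maximalIdeal O) O] (hO : ¬ IsField O) : IsLocalRing B := by
  obtain ⟨u, hu, hu0⟩ := Submodule.exists_mem_ne_zero_of_ne_bot
    (mt isField_iff_maximalIdeal_eq.mpr hO)
  set I : Ideal B := (maximalIdeal O).map (algebraMap O B) with hI
  obtain ⟨n, f, hf⟩ := Module.Finite.exists_fin' O B
  have h1 : IsPrecomplete (maximalIdeal O) (Fin n → O) := .pi_of_fintype _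
  have h2 : IsPrecomplete (maximalIdeal O) B := .of_surjective _ f hf
  have h3 : IsHausdorff (maximalIdeal O) B := inferInstance
  have h4 : IsPrecomplete I B := IsPrecomplete.map_algebraMap_iff.mpr h2
  have h5 : IsHausdorff I B := IsHausdorff.map_algebraMap_iff.mpr h3
  have h6 : IsAdicComplete I B := {}
  have hens : HenselianRing B I := inferInstance
  have hImax : ∀ J : Ideal B, J.IsMaximal → I ≤ J := fun J hJ =>
    (IsAdicComplete.le_jacobson_bot I).trans (sInf_le ⟨bot_le, hJ⟩)
  have hart : IsArtinianRing (B ⧸ I) := by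
    have htors : Module.IsTorsionBy O (B ⧸ I) u := by
      intro x
      obtain ⟨x, rfl⟩ := Ideal.Quotient.mk_surjective x
      change Ideal.Quotient.mk I (u • x) = 0
      rw [Ideal.Quotient.eq_zero_iff_mem, Algebra.smul_def]
      exact Ideal.mul_mem_right _ _ (Ideal.mem_map_of_mem _ hu)
    have : Module.Finite O (B ⧸ I) :=
      Module.Finite.of_surjective (Ideal.Quotient.mkₐ O I).toLinearMap
        Ideal.Quotient.mk_surjective
    have hlen := Module.length_ne_top_of_isTorsionBy (mem_nonZeroDivisors_of_ne_zero hu0) htors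
    rw [Module.length_ne_top_iff, isFiniteLength_iff_isNoetherian_isArtinian] at hlen
    exact isArtinian_of_tower O hlen.2
  refine IsLocalRing.of_unique_max_ideal ?_
  obtain ⟨J, hJ⟩ := Ideal.exists_maximal B
  refine ⟨J, hJ, fun J' hJ' => ?_⟩
  by_contra hne
  obtain ⟨b, hbJ', hbJ⟩ := SetLike.not_le_iff_exists.mp
    (fun hle => hne (hJ'.eq_of_le hJ.ne_top hle))
  -- The powers of `b` stabilize modulo `I`: `b ^ k = b ^ (k + 1) * y`. Hence `(b * y) ^ (k + 1)` is
  -- idempotent modulo `I`; it lies in `J'` but not in `J`.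
  obtain ⟨k, y, hy⟩ := IsArtinian.exists_pow_succ_smul_dvd (M := B ⧸ I)
    (Ideal.Quotient.mk I b) 1
  obtain ⟨y, rfl⟩ := Ideal.Quotient.mk_surjective y
  simp only [smul_eq_mul, mul_one, Nat.succ_eq_add_one] at hy
  have hiter : ∀ j, Ideal.Quotient.mk I b ^ (k + 1 + j) * Ideal.Quotient.mk I y ^ j =
      Ideal.Quotient.mk I b ^ (k + 1) := by
    intro j
    induction j with
    | zero => simp
    | succ j ih =>
      rw [← ih, pow_succ (Ideal.Quotient.mk I y)]
      have : Ideal.Quotient.mk I b ^ (k + 1 + (j + 1)) =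
          Ideal.Quotient.mk I b ^ (k + 1) * Ideal.Quotient.mk I b ^ (j + 1) := by ring
      rw [this]
      have h9 : Ideal.Quotient.mk I b ^ (k + 1 + j) =
          Ideal.Quotient.mk I b ^ k * Ideal.Quotient.mk I b ^ (j + 1) := by ring
      rw [h9, ← hy]
      ring
  have hk := hiter (k + 1)
  set e := b ^ (k + 1) * y ^ (k + 1) with he
  have hee : e * e - e ∈ I := by
    rw [← Ideal.Quotient.eq_zero_iff_mem, map_sub, sub_eq_zero, he]
    simp only [map_mul, map_pow]
    calc _ = (Ideal.Quotient.mk I b ^ (k + 1 + (k + 1)) * Ideal.Quotient.mk I y ^ (k + 1)) *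
          Ideal.Quotient.mk I y ^ (k + 1) := by ring
      _ = _ := by rw [hk]
  have heJ' : e ∈ J' := Ideal.mul_mem_right _ _ (Ideal.pow_mem_of_mem _ hbJ' _ (Nat.succ_pos k))
  have heJ : e ∉ J := by
    intro heJ
    apply hbJ
    refine hJ.isPrime.mem_of_pow_mem (k + 1) ?_
    have h1 : b ^ (k + 1) * e - b ^ (k + 1) ∈ I := by
      rw [← Ideal.Quotient.eq_zero_iff_mem, map_sub, sub_eq_zero, he]
      simp only [map_mul, map_pow]
      rw [← mul_assoc, ← pow_add, hk]
    have h2 := J.sub_mem (J.mul_mem_left (b ^ (k + 1)) heJ) (hImax J hJ h1)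
    simpa using h2
  -- The derivative of `X ^ 2 - X` at `e` is `2 e - 1`, whose square is `1` modulo `I`. It is
  -- therefore a unit in every characteristic.
  obtain ⟨a, ha, hae⟩ := hens.is_henselian (Polynomial.X ^ 2 - Polynomial.X)
    (by monicity!) e (by simpa [pow_two] using hee) (by
      rw [isUnit_iff_exists_inv]
      refine ⟨Ideal.Quotient.mk I (2 * e - 1), ?_⟩
      rw [← map_mul, ← map_one (Ideal.Quotient.mk I), Ideal.Quotient.eq]
      simp only [Polynomial.derivative_sub, Polynomial.derivative_X_pow, Polynomial.derivative_X,
        Polynomial.eval_sub, Polynomial.eval_mul, Polynomial.eval_pow, Polynomial.eval_X,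
        Polynomial.eval_one, Polynomial.eval_C]
      have : (2 * e - 1) * (2 * e - 1) - 1 = 4 * (e * e - e) := by ring
      have h4 := I.mul_mem_left 4 hee
      rw [← this] at h4
      simpa using h4)
  have ha' : a * (a - 1) = 0 := by
    have : a ^ 2 - a = 0 := by simpa [Polynomial.IsRoot] using ha
    rw [← this]
    ring
  rcases mul_eq_zero.mp ha' with h0 | h0
  · apply heJ
    have := J.neg_mem (hImax J hJ hae)
    simpa [h0] using this
  · apply hJ'.ne_top
    rw [Ideal.eq_top_iff_one, ← sub_eq_zero.mp h0]
    have := J'.add_mem (hImax J' hJ' hae) heJ'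
    simpa using this

theorem isDiscreteValuationRing_of_isIntegral_of_isAdicComplete [Ring.DimensionLEOne O]
    [Algebra.IsIntegral O B] [IsIntegrallyClosed B] [IsPrecomplete (maximalIdeal O) O]
    (hO : ¬ IsField O)
    (hfrac : ∀ b : B, ∃ d : O, d ≠ 0 ∧ ∃ a : O, d • b = algebraMap O B a) :
    IsDiscreteValuationRing B := by
  have h1 : Module.Finite O B := .of_isIntegral_of_isAdicComplete hO hfrac
  have h2 : IsLocalRing B := .of_finite_of_isAdicComplete hO
  have h3 : IsNoetherianRing B := IsNoetherianRing.of_finite O B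
  have hB1 : Ring.DimensionLEOne B := .of_isIntegral O B
  have hB : ¬ IsField B := fun h => hO (isField_of_isIntegral_of_isField
    (FaithfulSMul.algebraMap_injective O B) h)
  have h6 : IsDedekindDomain B := { }
  exact ((IsDiscreteValuationRing.TFAE B hB).out 0 2).mpr h6

end IntegralClosure

/-! ### The ring `K[[x,y]]` -/

namespace PlaneCurve

open IsLocalRing MvPowerSeries

variable {K : Type*} [Field K]

instance : IsDomain (PS K) := NoZeroDivisors.to_isDomain _

/-- Power series in one variable over the principal ideal domain `K[[x]]` form a unique
factorization domain, and `K[[x,y]]` is isomorphic to such a ring. -/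
instance : UniqueFactorizationMonoid (PS K) := by
  have : IsDomain (MvPowerSeries (Fin 1) K) := NoZeroDivisors.to_isDomain _
  let e : PowerSeries K ≃+* MvPowerSeries (Fin 1) K :=
    (MvPowerSeries.renameEquiv K (Equiv.ofUnique Unit (Fin 1))).toRingEquiv
  have h1 : IsPrincipalIdealRing (MvPowerSeries (Fin 1) K) :=
    IsPrincipalIdealRing.of_surjective e.toRingHom e.surjective
  exact (MvPowerSeries.finSuccEquiv (R := K) 1).symm.toMulEquiv.uniqueFactorizationMonoid
    inferInstance

theorem mem_maximalIdeal_iff {f : PS K} : f ∈ maximalIdeal (PS K) ↔ constantCoeff f = 0 := by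
  rw [mem_maximalIdeal, mem_nonunits_iff, MvPowerSeries.isUnit_iff_constantCoeff, isUnit_iff_ne_zero,
    not_not]

theorem sub_C_mem_maximalIdeal (f : PS K) :
    f - C (constantCoeff f) ∈ maximalIdeal (PS K) := by
  rw [mem_maximalIdeal_iff]
  simp

theorem X_mem_maximalIdeal (i : Fin 2) : (X i : PS K) ∈ maximalIdeal (PS K) := by
  rw [mem_maximalIdeal_iff]
  simp

theorem exists_eq_X_mul_add {n : ℕ} {f : PS K} (hf : ((n + 1 : ℕ) : ℕ∞) ≤ order f) :
    ∃ g h : PS K, f = X 0 * g + X 1 * h ∧ n ≤ order g ∧ n ≤ order h := by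
  classical
  have key : ∀ (i : Fin 2) (a : PS K), (∀ d, Finsupp.degree d < n + 1 → coeff d (X i * a) = 0) →
      n ≤ order a := by
    intro i a h
    have h1 : ((n + 1 : ℕ) : ℕ∞) ≤ order (X i * a) := nat_le_order h
    rw [order_mul, add_comm n, Nat.cast_add] at h1
    have h2 : order (X i : PS K) = 1 := by
      rw [X, order_monomial_of_ne_zero one_ne_zero]
      simp
    rw [h2] at h1
    exact (ENat.add_le_add_iff_left (by simp)).mp h1
  -- `b` collects the monomials of `f` free of `X 0`. Then `X 0` divides `f - b`, and `X 1` divides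
  -- `b` since `f` has no constant term.
  let b : PS K := fun d => if d 0 = 0 then coeff d f else 0
  have hb : ∀ d, coeff d b = if d 0 = 0 then coeff d f else 0 := fun d => rfl
  have hlow : ∀ d, Finsupp.degree d < n + 1 → coeff d f = 0 := fun d hd =>
    coeff_of_lt_order (lt_of_lt_of_le (by exact_mod_cast hd) hf)
  have h0 : (X 0 : PS K) ∣ f - b := by
    rw [X_dvd_iff]
    intro d hd
    simp [hb, hd]
  have h1 : (X 1 : PS K) ∣ b := by
    rw [X_dvd_iff]
    intro d hd
    rw [hb]
    split_ifs with hd0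
    · refine hlow d ?_
      have : d = 0 := by
        ext i
        fin_cases i <;> simp [hd, hd0]
      simp [this]
    · rfl
  obtain ⟨g, hg⟩ := h0
  obtain ⟨h, hh⟩ := h1
  refine ⟨g, h, by rw [← hg, ← hh]; ring, key 0 g ?_, key 1 h ?_⟩
  · intro d hd
    rw [← hg, map_sub, hb, hlow d hd]
    simp
  · intro d hd
    rw [← hh, hb, hlow d hd]
    simp

theorem maximalIdeal_eq_span : maximalIdeal (PS K) = Ideal.span {X 0, X 1} := by
  apply le_antisymm
  · intro f hf
    rw [mem_maximalIdeal_iff, ← one_le_order_iff_constCoeff_eq_zero] at hf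
    obtain ⟨g, h, rfl, -⟩ := exists_eq_X_mul_add (n := 0) (f := f) (by simpa using hf)
    rw [Ideal.mem_span_pair]
    exact ⟨g, h, by ring⟩
  · rw [Ideal.span_le]
    rintro _ (rfl | rfl)
    · exact X_mem_maximalIdeal 0
    · exact X_mem_maximalIdeal 1

theorem mem_maximalIdeal_pow_iff {n : ℕ} {f : PS K} :
    f ∈ maximalIdeal (PS K) ^ n ↔ n ≤ order f := by
  constructor
  · intro hf
    induction n generalizing f with
    | zero => simp
    | succ n ih =>
      rw [pow_succ] at hf
      induction hf using Submodule.mul_induction_on' with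
      | mem_mul_mem a ha b hb =>
        rw [mem_maximalIdeal_iff, ← one_le_order_iff_constCoeff_eq_zero] at hb
        rw [order_mul, Nat.cast_add]
        exact add_le_add (ih ha) (by simpa using hb)
      | add a _ b _ ha hb => exact (le_min ha hb).trans min_order_le_add
  · intro hf
    induction n generalizing f with
    | zero => simp
    | succ n ih =>
      obtain ⟨g, h, rfl, hg, hh⟩ := exists_eq_X_mul_add hf
      rw [pow_succ']
      exact add_mem (Ideal.mul_mem_mul (X_mem_maximalIdeal 0) (ih hg))
        (Ideal.mul_mem_mul (X_mem_maximalIdeal 1) (ih hh))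

instance : IsPrecomplete (maximalIdeal (PS K)) (PS K) := by
  refine ⟨fun f hf => ?_⟩
  have hf' : ∀ {m n}, m ≤ n → ∀ d : Fin 2 →₀ ℕ, d.degree < m → coeff d (f m) = coeff d (f n) := by
    intro m n hmn d hd
    have := hf hmn
    rw [SModEq.sub_mem, smul_eq_mul, Ideal.mul_top, mem_maximalIdeal_pow_iff] at this
    have h0 := coeff_of_lt_order (lt_of_lt_of_le (by exact_mod_cast hd) this)
    rwa [map_sub, sub_eq_zero] at h0
  let L : PS K := fun d => coeff d (f (d.degree + 1))
  have hL : ∀ d, coeff d L = coeff d (f (d.degree + 1)) := fun d => rfl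
  refine ⟨L, fun n => ?_⟩
  rw [SModEq.sub_mem, smul_eq_mul, Ideal.mul_top, mem_maximalIdeal_pow_iff]
  refine nat_le_order fun d hd => ?_
  rw [map_sub, hL, sub_eq_zero]
  exact (hf' hd d (Nat.lt_succ_self _)).symm

/-! ### Intersection numbers as lengths, and multiplicities -/

theorem length_residueField :
    Module.length (ResidueField K) (ResidueField (PS K)) = 1 := by
  have hsurj : Function.Surjective (algebraMap (ResidueField K) (ResidueField (PS K))) := by
    intro r
    obtain ⟨f, rfl⟩ := residue_surjective r
    refine ⟨residue K (constantCoeff f), ?_⟩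
    change residue (PS K) (C (constantCoeff f)) = _
    rw [← sub_eq_zero, ← map_sub, residue_eq_zero_iff, ← neg_sub]
    exact neg_mem (sub_C_mem_maximalIdeal f)
  rw [Module.length_eq_of_surjective hsurj, Module.length_eq_one]

/-- The residue field of `K[[x,y]]` is `K`, so dimension over `K` may be replaced by length over
`K[[x,y]]`. -/
theorem length_eq_length_restrictScalars (M : Type*) [AddCommGroup M] [Module K M]
    [Module (PS K) M] [IsScalarTower K (PS K) M] :
    Module.length K M = Module.length (PS K) M := by
  have : IsLocalHom (algebraMap K (PS K)) := inferInstance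
  rw [IsLocalRing.length_restrictScalars K (PS K) M, length_residueField, mul_one]

theorem interNum_eq_length (f g : PS K) :
    interNum f g = Module.length (PS K) (PS K ⧸ (Ideal.span {f, g} : Ideal (PS K))) := by
  rw [interNum, ← Module.length_eq_rank, length_eq_length_restrictScalars]

theorem interNum_comm (f g : PS K) : interNum f g = interNum g f := by
  rw [interNum, interNum, Set.pair_comm]

theorem mult_eq {f : PS K} (hf : f ≠ 0) : (mult f : ℕ∞) = order f :=
  (ne_zero_iff_order_finite.mp hf)

theorem mem_maximalIdeal_pow_mult {f : PS K} (hf : f ≠ 0) : f ∈ maximalIdeal (PS K) ^ mult f := by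
  rw [mem_maximalIdeal_pow_iff, mult_eq hf]

theorem mult_mul {f g : PS K} (hf : f ≠ 0) (hg : g ≠ 0) : mult (f * g) = mult f + mult g := by
  have h := order_mul f g
  rw [← mult_eq hf, ← mult_eq hg, ← mult_eq (mul_ne_zero hf hg)] at h
  exact_mod_cast h

theorem mult_eq_zero_iff {f : PS K} (hf : f ≠ 0) : mult f = 0 ↔ IsUnit f := by
  rw [MvPowerSeries.isUnit_iff_constantCoeff, isUnit_iff_ne_zero, Ne,
    ← order_ne_zero_iff_constCoeff_eq_zero, not_not, ← mult_eq hf, Nat.cast_eq_zero]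

theorem mult_eq_of_associated {f g : PS K} (h : Associated f g) : mult f = mult g := by
  obtain ⟨u, rfl⟩ := h
  by_cases hf : f = 0
  · simp [hf]
  · rw [mult_mul hf u.ne_zero, (mult_eq_zero_iff u.ne_zero).mpr u.isUnit, add_zero]

theorem ne_zero_of_mult_pos {f : PS K} (h : 0 < mult f) : f ≠ 0 := by
  rintro rfl
  simp [mult] at h

theorem irreducible_of_mult_eq_one {f : PS K} (h : mult f = 1) : Irreducible f := by
  have hf : f ≠ 0 := ne_zero_of_mult_pos (by omega)
  refine ⟨fun hu => ?_, fun a b hab => ?_⟩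
  · rw [(mult_eq_zero_iff hf).mpr hu] at h
    omega
  · subst hab
    have ha := left_ne_zero_of_mul hf
    have hb := right_ne_zero_of_mul hf
    rw [mult_mul ha hb] at h
    rw [← mult_eq_zero_iff ha, ← mult_eq_zero_iff hb]
    omega

theorem mult_X (i : Fin 2) : mult (X i : PS K) = 1 := by
  rw [mult, X, order_monomial_of_ne_zero one_ne_zero]
  simp

/-! ### Regular parameters and prime ideals of `K[[x,y]]` -/

theorem not_isPrincipal_maximalIdeal (u : PS K) : maximalIdeal (PS K) ≠ Ideal.span {u} := by
  intro h
  have hX : ∀ i : Fin 2, u ∣ X i := fun i => by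
    rw [← Ideal.mem_span_singleton, ← h]
    exact X_mem_maximalIdeal i
  have hu : ¬ IsUnit u := by
    have : u ∈ maximalIdeal (PS K) := h ▸ Ideal.mem_span_singleton_self u
    exact this
  have hass : ∀ i : Fin 2, Associated u (X i) := fun i =>
    ((irreducible_of_mult_eq_one (mult_X i)).dvd_iff.mp (hX i)).resolve_left hu |>.symm
  have h01 : (X 0 : PS K) ∣ X 1 := ((hass 0).symm.trans (hass 1)).dvd
  rw [X_dvd_iff] at h01
  have := h01 (Finsupp.single 1 1) (by simp)
  simp at this

/-- Modulo `w` the ring behaves like a discrete valuation ring with uniformizer `u`. By Krull's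
intersection theorem `h` is non-zero modulo `w` and some power of the maximal ideal, and dividing by
`u` lowers that power. -/
theorem exists_eq_unit_mul_pow_add {u w : PS K} (huw : maximalIdeal (PS K) = Ideal.span {u, w})
    {h : PS K} (hh : h ∉ Ideal.span {w}) :
    ∃ (k : ℕ) (e b : PS K), IsUnit e ∧ h = e * u ^ k + w * b := by
  have hN : ∃ N : ℕ, h ∉ Ideal.span {w} ⊔ maximalIdeal (PS K) ^ N := by
    by_contra hcon
    push Not at hcon
    apply hh
    have hH : IsHausdorff (maximalIdeal (PS K)) (PS K ⧸ (Ideal.span {w} : Ideal (PS K))) :=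
      inferInstance
    rw [← Ideal.Quotient.eq_zero_iff_mem]
    refine hH.haus _ fun n => ?_
    rw [SModEq.zero]
    obtain ⟨a, ha, b, hb, hab⟩ := Submodule.mem_sup.mp (hcon n)
    have : Ideal.Quotient.mk (Ideal.span {w}) h = b • 1 := by
      rw [← hab, map_add, Ideal.Quotient.eq_zero_iff_mem.mpr ha, zero_add]
      change _ = Ideal.Quotient.mk _ (b • 1)
      rw [smul_eq_mul, mul_one]
    rw [this]
    exact Submodule.smul_mem_smul hb trivial
  obtain ⟨N, hN⟩ := hN
  induction N generalizing h with
  | zero => simp at hN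
  | succ N ih =>
    by_cases hu : IsUnit h
    · exact ⟨0, h, 0, hu, by simp⟩
    · have hm : h ∈ maximalIdeal (PS K) := hu
      rw [huw, Ideal.mem_span_pair] at hm
      obtain ⟨a, b, rfl⟩ := hm
      have ha : a ∉ Ideal.span {w} ⊔ maximalIdeal (PS K) ^ N := by
        intro ha
        apply hN
        obtain ⟨c, hc, d, hd, rfl⟩ := Submodule.mem_sup.mp ha
        rw [add_mul, add_right_comm]
        refine Submodule.add_mem_sup (add_mem (Ideal.mul_mem_right _ _ hc)
          (Ideal.mul_mem_left _ _ (Ideal.mem_span_singleton_self w))) ?_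
        rw [pow_succ]
        refine Ideal.mul_mem_mul hd ?_
        rw [huw]
        exact Ideal.subset_span (by simp)
      obtain ⟨k, e, c, he, rfl⟩ := ih (fun h => ha (Submodule.mem_sup_left h)) ha
      exact ⟨k + 1, e, b + c * u, he, by ring⟩

/-- An element `g` of `P` with least `u`-order modulo `w` divides every other element of `P` modulo
`w`. Since `w` is not in the prime `P`, this gives `P = (g) + w P`, and Nakayama's lemma yields `P =
(g)`. -/
theorem isPrincipal_of_isPrime_of_notMem {u w : PS K}
    (huw : maximalIdeal (PS K) = Ideal.span {u, w}) {P : Ideal (PS K)} (hP : P.IsPrime)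
    (hwP : w ∉ P) : ∃ g, P = Ideal.span {g} := by
  by_cases hbot : P = ⊥
  · exact ⟨0, by simpa using hbot⟩
  have hex : ∃ k : ℕ, ∃ g ∈ P, ∃ e b : PS K, IsUnit e ∧ g = e * u ^ k + w * b := by
    by_contra hcon
    push Not at hcon
    -- If no element of `P` has finite `u`-order modulo `w`, then `P ⊆ (w)`, so `P = w P` and `P`
    -- vanishes.
    have h1 : P ≤ Ideal.span {w} := by
      intro g hg
      by_contra hgw
      obtain ⟨k, e, b, he, h⟩ := exists_eq_unit_mul_pow_add huw hgw
      exact hcon k g hg e b he h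
    have hle : P ≤ Ideal.span {w} • P := by
      intro g hg
      obtain ⟨a, rfl⟩ := Ideal.mem_span_singleton.mp (h1 hg)
      exact Submodule.smul_mem_smul (Ideal.mem_span_singleton_self w)
        ((hP.mem_or_mem hg).resolve_left hwP)
    refine hbot (Submodule.eq_bot_of_le_smul_of_le_jacobson_bot (Ideal.span {w}) P
      (IsNoetherian.noetherian P) hle ?_)
    rw [IsLocalRing.jacobson_eq_maximalIdeal ⊥ bot_ne_top, huw]
    exact Ideal.span_mono (by simp)
  classical
  obtain ⟨g, hg, e, b, he, hgeq⟩ := Nat.find_spec hex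
  refine ⟨g, le_antisymm ?_ ((Ideal.span_singleton_le_iff_mem P).mpr hg)⟩
  refine Submodule.le_of_le_smul_of_le_jacobson_bot (I := Ideal.span {w})
    (IsNoetherian.noetherian P) ?_ ?_
  · rw [IsLocalRing.jacobson_eq_maximalIdeal ⊥ bot_ne_top, huw]
    exact Ideal.span_mono (by simp)
  · intro h hh
    have hdiv : ∃ a b', h = a * g + w * b' := by
      by_cases hw : h ∈ Ideal.span {w}
      · obtain ⟨b', rfl⟩ := Ideal.mem_span_singleton.mp hw
        exact ⟨0, b', by ring⟩
      · obtain ⟨k, e', b', he', h1⟩ := exists_eq_unit_mul_pow_add huw hw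
        have hk := Nat.find_min' hex ⟨h, hh, e', b', he', h1⟩
        obtain ⟨c, hc⟩ := he.exists_left_inv
        obtain ⟨j, hj⟩ := Nat.exists_eq_add_of_le hk
        refine ⟨e' * c * u ^ j, b' - e' * c * u ^ j * b, ?_⟩
        rw [h1, hgeq, hj, pow_add]
        linear_combination (- e' * u ^ Nat.find hex * u ^ j) * hc
    obtain ⟨a, b', rfl⟩ := hdiv
    refine Submodule.add_mem_sup (Ideal.mul_mem_left _ _ (Ideal.mem_span_singleton_self g)) ?_
    have : w * b' ∈ P := by
      have := P.sub_mem hh (P.mul_mem_left a hg)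
      simpa using this
    exact Submodule.smul_mem_smul (Ideal.mem_span_singleton_self w)
      ((hP.mem_or_mem this).resolve_left hwP)

/-- A prime missing one of the coordinates is principal. A generator would divide the irreducible
`p` and `d`, hence be associated to `p`, against `p ∤ d`. So both coordinates lie in `P`. -/
theorem eq_maximalIdeal_of_isPrime {p : PS K} (hp : Irreducible p) {P : Ideal (PS K)}
    (hP : P.IsPrime) (hpP : p ∈ P) {d : PS K} (hdP : d ∈ P) (hd : ¬ p ∣ d) :
    P = maximalIdeal (PS K) := by
  have key : ∀ u w : PS K, maximalIdeal (PS K) = Ideal.span {u, w} → w ∈ P := by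
    intro u w huw
    by_contra hw
    obtain ⟨g, rfl⟩ := isPrincipal_of_isPrime_of_notMem huw hP hw
    rw [Ideal.mem_span_singleton] at hpP hdP
    rcases hp.dvd_iff.mp hpP with h | h
    · exact hP.ne_top (Ideal.span_singleton_eq_top.mpr h)
    · exact hd (h.dvd.trans hdP)
  refine le_antisymm (le_maximalIdeal hP.ne_top) ?_
  rw [maximalIdeal_eq_span, Ideal.span_le]
  rintro _ (rfl | rfl)
  · exact key (X 1) (X 0) (by rw [maximalIdeal_eq_span, Set.pair_comm])
  · exact key (X 0) (X 1) maximalIdeal_eq_span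

theorem span_ne_of_maximalIdeal_eq {u w : PS K} (huw : maximalIdeal (PS K) = Ideal.span {u, w}) :
    w ∉ Ideal.span {u} := by
  intro hw
  refine not_isPrincipal_maximalIdeal u (huw.trans ?_)
  rw [Ideal.span_insert, sup_eq_left, Ideal.span_singleton_le_iff_mem]
  exact hw

/-- If `u` had order at least two, Nakayama's lemma would give `𝔪 = (w)`, but `𝔪` is not principal.
-/
theorem mult_eq_one_of_maximalIdeal_eq {u w : PS K}
    (huw : maximalIdeal (PS K) = Ideal.span {u, w}) : mult u = 1 := by
  have hu : u ≠ 0 := by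
    rintro rfl
    refine not_isPrincipal_maximalIdeal w (huw.trans ?_)
    rw [Ideal.span_insert_zero]
  have hm : u ∈ maximalIdeal (PS K) := huw ▸ Ideal.subset_span (by simp)
  have h0 : mult u ≠ 0 := fun h => hm ((mult_eq_zero_iff hu).mp h)
  by_contra h1
  have h2 : u ∈ maximalIdeal (PS K) ^ 2 :=
    Ideal.pow_le_pow_right (by omega) (mem_maximalIdeal_pow_mult hu)
  refine not_isPrincipal_maximalIdeal w (le_antisymm ?_ ?_)
  · refine Submodule.le_of_le_smul_of_le_jacobson_bot (I := maximalIdeal (PS K))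
      (IsNoetherian.noetherian _) (IsLocalRing.maximalIdeal_le_jacobson _) ?_
    conv_lhs => rw [huw]
    rw [Ideal.span_le]
    rintro _ (rfl | rfl)
    · refine Submodule.mem_sup_right ?_
      rwa [smul_eq_mul, ← pow_two]
    · exact Submodule.mem_sup_left (Ideal.mem_span_singleton_self _)
  · rw [Ideal.span_singleton_le_iff_mem, huw]
    exact Ideal.subset_span (by simp)

theorem ord_quotient_mk (u w : PS K) :
    Ring.ord (LocRing u) (Ideal.Quotient.mk _ w) =
      Module.length (PS K) (PS K ⧸ (Ideal.span {u, w} : Ideal (PS K))) := by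
  rw [Ring.ord, ← Module.length_eq_of_surjective (S := PS K) (R := LocRing u)
    Ideal.Quotient.mk_surjective]
  refine LinearEquiv.length_eq ?_
  have h1 : Ideal.span {Ideal.Quotient.mk (Ideal.span {u}) w} =
      (Ideal.span {w}).map (Ideal.Quotient.mk (Ideal.span {u})) := by
    rw [Ideal.map_span, Set.image_singleton]
  have h2 : (Ideal.span {u, w} : Ideal (PS K)) = Ideal.span {u} ⊔ Ideal.span {w} :=
    Ideal.span_insert u {w}
  exact ((Ideal.quotientEquivAlgOfEq (PS K) h1).trans
    ((DoubleQuot.quotQuotEquivQuotSupₐ (PS K) (Ideal.span {u}) (Ideal.span {w})).trans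
      (Ideal.quotientEquivAlgOfEq (PS K) h2.symm))).toLinearEquiv

theorem isPrime_span_of_irreducible {p : PS K} (hp : Irreducible p) :
    (Ideal.span {p}).IsPrime :=
  (Ideal.span_singleton_prime hp.ne_zero).mpr hp.prime

/-- `Ring.ord` on `K[[x,y]]/(u)` is additive on products, and `w` has order one there because `(u,
w)` is the maximal ideal. -/
theorem interNum_pow {u w : PS K} (huw : maximalIdeal (PS K) = Ideal.span {u, w}) (m : ℕ) :
    interNum u (w ^ m) = m := by
  have := isPrime_span_of_irreducible (irreducible_of_mult_eq_one (mult_eq_one_of_maximalIdeal_eq huw))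
  have hw : Ideal.Quotient.mk (Ideal.span {u}) w ∈ nonZeroDivisors (LocRing u) := by
    refine mem_nonZeroDivisors_of_ne_zero ?_
    rw [Ne, Ideal.Quotient.eq_zero_iff_mem]
    exact span_ne_of_maximalIdeal_eq huw
  rw [interNum_eq_length, ← ord_quotient_mk, map_pow, Ring.ord_pow hw, ord_quotient_mk, ← huw]
  have : IsSimpleModule (PS K) (PS K ⧸ maximalIdeal (PS K)) :=
    isSimpleModule_iff_isCoatom.mpr (maximalIdeal.isMaximal _).out
  rw [Module.length_eq_one]
  simp

theorem interNum_le_of_mem {u w p : PS K} (huw : maximalIdeal (PS K) = Ideal.span {u, w}) {j : ℕ}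
    (h : w ^ j ∈ Ideal.span {u, p}) : interNum u p ≤ j := by
  rw [← interNum_pow huw j, interNum_eq_length, interNum_eq_length]
  have hle : (Ideal.span {u, w ^ j} : Ideal (PS K)) ≤ Ideal.span {u, p} := by
    rw [Ideal.span_le]
    rintro _ (rfl | rfl)
    · exact Ideal.subset_span (by simp)
    · exact h
  exact Module.length_le_of_surjective (Submodule.factor hle) (Submodule.factor_surjective hle)

theorem maximalIdeal_eq_of_interNum_eq_one {u w : PS K} (h : interNum u w = 1) :
    maximalIdeal (PS K) = Ideal.span {u, w} := by
  rw [interNum_eq_length, Module.length_eq_one_iff, isSimpleModule_iff_isCoatom] at h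
  exact (eq_maximalIdeal ⟨h⟩).symm

/-- The line `x = c y`. -/
noncomputable def line (c : K) : PS K := X 0 - C c * X 1

theorem maximalIdeal_eq_span_line (c : K) : maximalIdeal (PS K) = Ideal.span {line c, X 1} := by
  rw [maximalIdeal_eq_span]
  apply le_antisymm
  · rw [Ideal.span_le]
    rintro _ (rfl | rfl)
    · rw [SetLike.mem_coe, Ideal.mem_span_pair]
      exact ⟨1, C c, by simp [line]⟩
    · exact Ideal.subset_span (by simp)
  · rw [Ideal.span_le]
    rintro _ (rfl | rfl)
    · rw [SetLike.mem_coe, Ideal.mem_span_pair]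
      exact ⟨1, -C c, by simp [line, sub_eq_add_neg]⟩
    · exact Ideal.subset_span (by simp)

/-! ### Lines in general position -/

theorem sub_initialForm_mem {g : PS K} {m : ℕ} (hg : g ∈ maximalIdeal (PS K) ^ m) :
    g - ∑ i ∈ Finset.range (m + 1),
      C (coeff (Finsupp.single 0 i + Finsupp.single 1 (m - i)) g) * (X 0 ^ i * X 1 ^ (m - i)) ∈
      maximalIdeal (PS K) ^ (m + 1) := by
  classical
  rw [mem_maximalIdeal_pow_iff] at hg ⊢
  refine nat_le_order fun d hd => ?_
  have hmon : ∀ i, (X 0 ^ i * X 1 ^ (m - i) : PS K) =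
      monomial (Finsupp.single 0 i + Finsupp.single 1 (m - i)) 1 := by
    intro i
    rw [X_pow_eq, X_pow_eq, monomial_mul_monomial, one_mul]
  simp only [map_sub, map_sum, hmon, coeff_C_mul, coeff_monomial, mul_ite, mul_one, mul_zero]
  have hdeg : ∀ d : Fin 2 →₀ ℕ, d.degree = d 0 + d 1 := fun d => by
    rw [Finsupp.degree_eq_sum, Fin.sum_univ_two]
  by_cases hdm : d.degree < m
  · rw [coeff_of_lt_order (lt_of_lt_of_le (by exact_mod_cast hdm) hg), zero_sub, neg_eq_zero]
    refine Finset.sum_eq_zero fun i hi => ?_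
    rw [if_neg]
    rintro rfl
    rw [hdeg] at hdm
    simp at hdm hi
    omega
  · have hdm' : d 0 + d 1 = m := by
      rw [← hdeg]
      omega
    have hd' : d = Finsupp.single 0 (d 0) + Finsupp.single 1 (m - d 0) := by
      ext i
      fin_cases i
      · simp
      · simp
        omega
    rw [Finset.sum_eq_single (d 0)]
    · rw [if_pos hd', ← hd', sub_self]
    · intro i _ hi
      rw [if_neg]
      intro h
      apply hi
      rw [h]
      simp
    · intro h
      simp at h
      omega

/-- On the line `x = c y` the series `g` restricts to `Q(c) y ^ m` plus terms of higher degree,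
where `Q` is the dehomogenized initial form. Only the finitely many roots of `Q` are exceptional. -/
theorem finite_setOf_interNum_line_ne {g : PS K} (hg : g ≠ 0) :
    {c : K | interNum (line c) g ≠ mult g}.Finite := by
  classical
  set m := mult g with hm
  set a : ℕ → K := fun i => coeff (Finsupp.single 0 i + Finsupp.single 1 (m - i)) g with ha
  set Q : Polynomial K := ∑ i ∈ Finset.range (m + 1), Polynomial.C (a i) * Polynomial.X ^ i with hQ
  have hgm := mem_maximalIdeal_pow_mult hg
  rw [← hm] at hgm
  have hQ0 : Q ≠ 0 := by
    intro h0
    have h1 : ∀ i ∈ Finset.range (m + 1), a i = 0 := by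
      intro i hi
      have h2 : Q.coeff i = a i := by
        rw [hQ, Polynomial.finsetSum_coeff]
        simp only [Polynomial.coeff_C_mul, Polynomial.coeff_X_pow, mul_ite, mul_one, mul_zero]
        rw [Finset.sum_ite_eq, if_pos hi]
      rw [← h2, h0, Polynomial.coeff_zero]
    have h3 := sub_initialForm_mem hgm
    rw [Finset.sum_eq_zero, sub_zero, mem_maximalIdeal_pow_iff, ← mult_eq hg, Nat.cast_le] at h3
    · omega
    · intro i hi
      have := h1 i hi
      simp only [ha] at this
      rw [this, map_zero, zero_mul]
  refine (Q.roots.toFinset.finite_toSet).subset fun c hc => ?_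
  rw [Finset.mem_coe, Multiset.mem_toFinset, Polynomial.mem_roots hQ0, Polynomial.IsRoot.def]
  by_contra hev
  apply hc
  have huw := maximalIdeal_eq_span_line c
  have hmk : Ideal.Quotient.mk (Ideal.span {line c}) (X 0 : PS K) =
      Ideal.Quotient.mk (Ideal.span {line c}) (C c * X 1) := by
    rw [Ideal.Quotient.eq]
    exact Ideal.mem_span_singleton_self _
  have hP : Ideal.Quotient.mk (Ideal.span {line c}) (∑ i ∈ Finset.range (m + 1),
      C (a i) * (X 0 ^ i * X 1 ^ (m - i))) =
      Ideal.Quotient.mk (Ideal.span {line c}) (C (Q.eval c) * X 1 ^ m) := by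
    rw [hQ, Polynomial.eval_finsetSum, map_sum, map_sum, Finset.sum_mul, map_sum]
    refine Finset.sum_congr rfl fun i hi => ?_
    have hi' : i ≤ m := by
      simp at hi
      omega
    rw [map_mul, map_mul, map_pow, hmk, ← map_pow, ← map_mul, ← map_mul]
    congr 1
    rw [Polynomial.eval_mul, Polynomial.eval_pow, Polynomial.eval_C, Polynomial.eval_X, map_mul,
      map_pow, mul_pow, mul_assoc, mul_assoc, ← pow_add (X 1), Nat.add_sub_cancel' hi']
  -- On the line the maximal ideal is generated by `X 1`, so the terms beyond the initial form
  -- become a multiple of `X 1 ^ (m + 1)`.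
  have hr : ∃ r : PS K, Ideal.Quotient.mk (Ideal.span {line c}) (g - ∑ i ∈ Finset.range (m + 1),
      C (a i) * (X 0 ^ i * X 1 ^ (m - i))) =
      Ideal.Quotient.mk (Ideal.span {line c}) (r * X 1 ^ (m + 1)) := by
    have h1 := sub_initialForm_mem hgm
    have h2 := Ideal.mem_map_of_mem (Ideal.Quotient.mk (Ideal.span {line c})) h1
    rw [Ideal.map_pow, huw, Ideal.map_span, Set.image_pair,
      Ideal.Quotient.eq_zero_iff_mem.mpr (Ideal.mem_span_singleton_self _), Ideal.span_insert_zero,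
      Ideal.span_singleton_pow, Ideal.mem_span_singleton'] at h2
    obtain ⟨r, hr⟩ := h2
    obtain ⟨r, rfl⟩ := Ideal.Quotient.mk_surjective r
    exact ⟨r, by rw [← hr, map_mul, map_pow]⟩
  obtain ⟨r, hr⟩ := hr
  rw [map_sub, sub_eq_iff_eq_add, hP, ← map_add] at hr
  have hunit : IsUnit (r * X 1 + C (Q.eval c) : PS K) := by
    rw [MvPowerSeries.isUnit_iff_constantCoeff]
    simpa [isUnit_iff_ne_zero] using hev
  rw [interNum_eq_length, ← ord_quotient_mk, hr]
  have : r * X 1 ^ (m + 1) + C (Q.eval c) * X 1 ^ m = (r * X 1 + C (Q.eval c)) * (X 1 : PS K) ^ m := by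
    ring
  rw [this, map_mul, Ring.ord_mul_of_isUnit_left (hunit.map _), ord_quotient_mk, ← interNum_eq_length,
    interNum_pow huw]

theorem exists_line_of_finite [Infinite K] (S : Set (PS K)) (hS : S.Finite) (h0 : ∀ g ∈ S, g ≠ 0) :
    ∃ c : K, ∀ g ∈ S, interNum (line c) g = mult g := by
  have hfin : (⋃ g ∈ S, {c : K | interNum (line c) g ≠ mult g}).Finite :=
    hS.biUnion fun g hg => finite_setOf_interNum_line_ne (h0 g hg)
  obtain ⟨c, hc⟩ := hfin.infinite_compl.nonempty
  refine ⟨c, fun g hg => ?_⟩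
  by_contra hne
  exact hc (Set.mem_biUnion hg hne)

/-! ### The local ring of a branch: a complete local domain of dimension one -/

section LocRing

variable {p : PS K} (hp : Irreducible p)
include hp

theorem isDomain_locRing : IsDomain (LocRing p) := by
  have := isPrime_span_of_irreducible hp
  infer_instance

theorem isLocalRing_locRing : IsLocalRing (LocRing p) := by
  have := isDomain_locRing hp
  exact .of_surjective' (Ideal.Quotient.mk (Ideal.span {p})) Ideal.Quotient.mk_surjective

theorem dimensionLEOne_locRing : Ring.DimensionLEOne (LocRing p) := by
  refine ⟨fun {P} hP hprime => ?_⟩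
  have hcomap : (P.comap (Ideal.Quotient.mk (Ideal.span {p}))).IsPrime := inferInstance
  obtain ⟨d, hd, hd0⟩ := Submodule.exists_mem_ne_zero_of_ne_bot hP
  obtain ⟨d, rfl⟩ := Ideal.Quotient.mk_surjective d
  have h := eq_maximalIdeal_of_isPrime hp hcomap (d := d)
    (by
      rw [Ideal.mem_comap, Ideal.Quotient.eq_zero_iff_mem.mpr (Ideal.mem_span_singleton_self p)]
      exact P.zero_mem)
    hd (by rwa [Ne, Ideal.Quotient.eq_zero_iff_mem, Ideal.mem_span_singleton] at hd0)
  have h1 : (P.comap (Ideal.Quotient.mk (Ideal.span {p}))).IsMaximal := by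
    rw [h]
    infer_instance
  have h2 := Ideal.map_eq_top_or_isMaximal_of_surjective (Ideal.Quotient.mk (Ideal.span {p}))
    Ideal.Quotient.mk_surjective h1
  rw [Ideal.map_comap_of_surjective _ Ideal.Quotient.mk_surjective] at h2
  exact h2.resolve_left hprime.ne_top

theorem not_isField_locRing : ¬ IsField (LocRing p) := by
  intro h
  have h1 : (Ideal.span {p}).IsMaximal := Ideal.Quotient.maximal_of_isField _ h
  exact not_isPrincipal_maximalIdeal p (eq_maximalIdeal h1).symm

theorem isPrecomplete_locRing [IsLocalRing (LocRing p)] :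
    IsPrecomplete (maximalIdeal (LocRing p)) (LocRing p) := by
  have h1 := Ideal.map_eq_top_or_isMaximal_of_surjective (Ideal.Quotient.mk (Ideal.span {p}))
    Ideal.Quotient.mk_surjective (maximalIdeal.isMaximal (PS K))
  have h2 : (maximalIdeal (PS K)).map (Ideal.Quotient.mk (Ideal.span {p})) ≠ ⊤ := by
    intro htop
    have hle : Ideal.span {p} ≤ maximalIdeal (PS K) :=
      (Ideal.span_singleton_le_iff_mem _).mpr hp.not_isUnit
    have := Ideal.comap_map_of_surjective' (Ideal.Quotient.mk (Ideal.span {p}))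
      Ideal.Quotient.mk_surjective (maximalIdeal (PS K))
    rw [htop, Ideal.comap_top, Ideal.mk_ker, sup_eq_left.mpr hle] at this
    exact (maximalIdeal.isMaximal (PS K)).ne_top this.symm
  have h3 : maximalIdeal (LocRing p) =
      (maximalIdeal (PS K)).map (algebraMap (PS K) (LocRing p)) :=
    (eq_maximalIdeal (h1.resolve_left h2)).symm
  rw [h3, IsPrecomplete.map_algebraMap_iff]
  exact IsPrecomplete.of_surjective _ (Ideal.Quotient.mkₐ (PS K) (Ideal.span {p})).toLinearMap
    Ideal.Quotient.mk_surjective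

end LocRing

end PlaneCurve

/-! ### The ring of a branch -/

namespace PlaneCurve

open IsLocalRing MvPowerSeries IsDiscreteValuationRing

variable {K : Type*} [Field K]

/-- `B` is a discrete valuation ring birational to the local ring of the branch `{p = 0}`. -/
structure IsBranchRing (p : PS K) (B : Type*) [CommRing B] [IsDomain B]
    [IsDiscreteValuationRing B] [Algebra (PS K) B] : Prop where
  finite : Module.Finite (PS K) B
  algebraMap_eq_zero_iff : ∀ g : PS K, algebraMap (PS K) B g = 0 ↔ p ∣ g
  exists_sub_mem : ∀ b : B, ∃ c : K,
    b - algebraMap (PS K) B (C c) ∈ IsLocalRing.maximalIdeal B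
  exists_conductor : ∃ c : ℕ, ∀ b : B, (c : ℕ∞) ≤ addVal B b → b ∈ (algebraMap (PS K) B).range

/-- A non-unit `g` that becomes invertible in `B` would give `𝔪 B = B`, which Nakayama's lemma
excludes. -/
theorem isLocalHom_algebraMap_of_finite (B : Type*) [CommRing B] [Nontrivial B]
    [Algebra (PS K) B] [Module.Finite (PS K) B] : IsLocalHom (algebraMap (PS K) B) := by
  refine ⟨fun g hg => ?_⟩
  by_contra hu
  have hle : (⊤ : Submodule (PS K) B) ≤ IsLocalRing.maximalIdeal (PS K) • ⊤ := by
    intro b _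
    obtain ⟨c, hc⟩ := hg.exists_right_inv
    have : b = g • (c * b) := by
      rw [Algebra.smul_def, ← mul_assoc, hc, one_mul]
    rw [this]
    exact Submodule.smul_mem_smul hu trivial
  have := Submodule.eq_bot_of_le_smul_of_le_jacobson_bot _ _ (Module.Finite.fg_top) hle
    (IsLocalRing.maximalIdeal_le_jacobson _)
  exact bot_ne_top this.symm

/-- The residue field of `B` is integral over `K`, because a power series acts on it through its
constant term. As `K` is algebraically closed, the two fields coincide. -/
theorem exists_sub_mem_maximalIdeal_of_finite [IsAlgClosed K] {B : Type*} [CommRing B]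
    [IsLocalRing B] [Algebra (PS K) B] [Module.Finite (PS K) B] (b : B) :
    ∃ c : K, b - algebraMap (PS K) B (C c) ∈ IsLocalRing.maximalIdeal B := by
  have hloc := isLocalHom_algebraMap_of_finite (K := K) B
  let φ : PS K →+* ResidueField B := (residue B).comp (algebraMap (PS K) B)
  have hφ : φ = (φ.comp C).comp constantCoeff := by
    ext g
    change residue B _ = residue B (algebraMap (PS K) B (C (constantCoeff g)))
    rw [← sub_eq_zero, ← map_sub, ← map_sub, residue_eq_zero_iff]
    exact map_nonunit _ _ (sub_C_mem_maximalIdeal g)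
  have hint : (φ.comp C).IsIntegral := by
    intro r
    obtain ⟨b, rfl⟩ := residue_surjective r
    obtain ⟨P, hP, hPb⟩ := Algebra.IsIntegral.isIntegral (R := PS K) b
    refine ⟨P.map constantCoeff, hP.map _, ?_⟩
    rw [Polynomial.eval₂_map, ← hφ]
    have := congrArg (residue B) hPb
    rwa [Polynomial.hom_eval₂, map_zero] at this
  obtain ⟨c, hc⟩ := IsAlgClosed.ringHom_bijective_of_isIntegral (φ.comp C) hint |>.2 (residue B b)
  refine ⟨c, ?_⟩
  rw [← residue_eq_zero_iff, map_sub, sub_eq_zero, ← hc]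
  rfl

/-! ### The normalization of a branch is a discrete valuation ring -/

section Normalization

variable {p : PS K} (hp : Irreducible p)
include hp

theorem isDomain_normalization : IsDomain (Normalization p) := by
  have := isDomain_locRing hp
  infer_instance

theorem exists_smul_eq_algebraMap (b : Normalization p) :
    ∃ d : LocRing p, d ≠ 0 ∧ ∃ a : LocRing p, d • b = algebraMap _ (Normalization p) a := by
  have := isDomain_locRing hp
  obtain ⟨⟨a, d⟩, had⟩ := IsLocalization.surj (nonZeroDivisors (LocRing p)) (b : FractionRing (LocRing p))
  refine ⟨d, nonZeroDivisors.ne_zero d.2, a, Subtype.ext ?_⟩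
  rw [Algebra.smul_def, mul_comm]
  exact had

theorem isDiscreteValuationRing_normalization :
    haveI := isDomain_normalization hp
    IsDiscreteValuationRing (Normalization p) := by
  have := isDomain_normalization hp
  have := isDomain_locRing hp
  have := isLocalRing_locRing hp
  have := dimensionLEOne_locRing hp
  have := isPrecomplete_locRing hp
  have : FaithfulSMul (LocRing p) (Normalization p) := inferInstance
  have : IsIntegrallyClosed (Normalization p) := integralClosure.isIntegrallyClosedOfFiniteExtension (FractionRing (LocRing p))
  exact isDiscreteValuationRing_of_isIntegral_of_isAdicComplete (O := LocRing p)
    (not_isField_locRing hp) (exists_smul_eq_algebraMap hp)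

theorem isBranchRing_normalization [IsAlgClosed K] :
    ∃ (_ : IsDomain (Normalization p)) (_ : IsDiscreteValuationRing (Normalization p)),
      IsBranchRing p (Normalization p) := by
  have hdom := isDomain_normalization hp
  have hdvr := isDiscreteValuationRing_normalization hp
  refine ⟨hdom, hdvr, ?_⟩
  have := isDomain_locRing hp
  have := isLocalRing_locRing hp
  have := dimensionLEOne_locRing hp
  have := isPrecomplete_locRing hp
  have hfin : Module.Finite (LocRing p) (Normalization p) :=
    .of_isIntegral_of_isAdicComplete (not_isField_locRing hp) (exists_smul_eq_algebraMap hp)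
  have hfin' : Module.Finite (PS K) (Normalization p) := .trans (LocRing p) _
  refine ⟨hfin', fun g => ?_, fun b => ?_, ?_⟩
  · rw [IsScalarTower.algebraMap_apply (PS K) (LocRing p), FaithfulSMul.algebraMap_eq_zero_iff,
      ← Ideal.mem_span_singleton]
    exact Ideal.Quotient.eq_zero_iff_mem
  · exact exists_sub_mem_maximalIdeal_of_finite b
  · obtain ⟨d, hd, h⟩ := (hfin.fg_top).exists_common_denominator (exists_smul_eq_algebraMap hp)
    have hd' : algebraMap (LocRing p) (Normalization p) d ≠ 0 := by
      rwa [Ne, FaithfulSMul.algebraMap_eq_zero_iff]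
    obtain ⟨c, hc⟩ := ENat.ne_top_iff_exists.mp (mt addVal_eq_top_iff.mp hd')
    refine ⟨c, fun b hb => ?_⟩
    rw [hc, addVal_le_iff_dvd] at hb
    obtain ⟨b', rfl⟩ := hb
    obtain ⟨a, ha⟩ := h b' trivial
    obtain ⟨a, rfl⟩ := Ideal.Quotient.mk_surjective a
    rw [← Algebra.smul_def, ha]
    exact ⟨a, rfl⟩

end Normalization

/-- The value of a power series along a branch. -/
noncomputable def val (B : Type*) [CommRing B] [IsDomain B] [IsDiscreteValuationRing B]
    [Algebra (PS K) B] (g : PS K) : ℕ∞ := addVal B (algebraMap (PS K) B g)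

section Val

variable {B : Type*} [CommRing B] [IsDomain B] [IsDiscreteValuationRing B] [Algebra (PS K) B]

theorem val_mul (g h : PS K) : val B (g * h) = val B g + val B h := by
  rw [val, map_mul, addVal_mul, val, val]

theorem val_pow (g : PS K) (n : ℕ) : val B (g ^ n) = n * val B g := by
  rw [val, map_pow, addVal_pow, val, nsmul_eq_mul]

theorem le_val_add {g h : PS K} {n : ℕ∞} (hg : n ≤ val B g) (hh : n ≤ val B h) :
    n ≤ val B (g + h) := by
  rw [val, map_add]
  exact (le_min hg hh).trans addVal_add

theorem val_add_eq_of_lt {g h : PS K} (hlt : val B g < val B h) : val B (g + h) = val B g := by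
  rw [val, map_add]
  exact AddValuation.map_add_eq_of_lt_left (addVal B) hlt

theorem val_unit_mul {e : PS K} (he : IsUnit e) (g : PS K) : val B (e * g) = val B g := by
  obtain ⟨u, hu⟩ := he.map (algebraMap (PS K) B)
  rw [val_mul, val, ← hu, addVal_eq_zero_of_unit, zero_add]

theorem val_eq_of_associated {g h : PS K} (hgh : Associated g h) : val B g = val B h := by
  obtain ⟨u, rfl⟩ := hgh
  rw [mul_comm, val_unit_mul u.isUnit]

end Val

/-! ### Intersection numbers as values along a branch -/

section BranchRing

variable {p : PS K} {B : Type*} [CommRing B] [IsDomain B] [IsDiscreteValuationRing B]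
  [Algebra (PS K) B]

namespace IsBranchRing

variable (hB : IsBranchRing p B)
include hB

theorem val_eq_top_iff {g : PS K} : val B g = ⊤ ↔ p ∣ g := by
  rw [val, addVal_eq_top_iff, hB.algebraMap_eq_zero_iff]

/-- The residue fields of `B` and `K[[x,y]]` agree, so the length over `K[[x,y]]` equals the length
over `B`, which is the value. -/
theorem length_quotient_span (b : B) :
    Module.length (PS K) (B ⧸ Ideal.span {b}) = addVal B b := by
  have := hB.finite
  have := isLocalHom_algebraMap_of_finite (K := K) B
  have hsurj : Function.Surjective (algebraMap (ResidueField (PS K)) (ResidueField B)) := by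
    intro r
    obtain ⟨b, rfl⟩ := residue_surjective r
    obtain ⟨c, hc⟩ := hB.exists_sub_mem b
    refine ⟨residue (PS K) (C c), ?_⟩
    change residue B (algebraMap (PS K) B (C c)) = _
    rw [← sub_eq_zero, ← map_sub, residue_eq_zero_iff, ← neg_sub]
    exact neg_mem hc
  rw [IsLocalRing.length_restrictScalars (PS K) B, Module.length_eq_of_surjective hsurj,
    Module.length_eq_one (ResidueField B) (ResidueField B), mul_one, ← Ring.ord_eq_addVal, Ring.ord]

/-- The local ring has finite colength in `B` by the conductor, so multiplication by `g` has the
same colength on both rings; on `B` this colength is the value of `g`. -/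
theorem interNum_eq_val (hp : Irreducible p) (g : PS K) : interNum p g = val B g := by
  have hdom := isDomain_locRing hp
  -- If `p` divides `g`, both sides are infinite: were the local ring of finite length, it would be
  -- an Artinian domain, hence a field.
  by_cases hg : p ∣ g
  · rw [hB.val_eq_top_iff.mpr hg, interNum_eq_length, ← ord_quotient_mk,
      Ideal.Quotient.eq_zero_iff_mem.mpr (Ideal.mem_span_singleton.mpr hg), Ring.ord_zero]
    by_contra hne
    rw [← Ne, Module.length_ne_top_iff, isFiniteLength_iff_isNoetherian_isArtinian] at hne
    have : IsArtinianRing (LocRing p) := hne.2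
    exact not_isField_locRing hp (IsArtinianRing.isField_of_isDomain (LocRing p))
  · have hker : ∀ x ∈ Ideal.span {p}, (Algebra.linearMap (PS K) B) x = 0 := fun x hx => by
      rw [Algebra.linearMap_apply, hB.algebraMap_eq_zero_iff, ← Ideal.mem_span_singleton]
      exact hx
    let i : LocRing p →ₗ[PS K] B := Submodule.liftQ (Ideal.span {p}) (Algebra.linearMap (PS K) B)
      (fun x hx => hker x hx)
    have hi_mk : ∀ x : PS K, i (Ideal.Quotient.mk _ x) = algebraMap (PS K) B x := fun x => rfl
    have hi : Function.Injective i := by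
      rw [injective_iff_map_eq_zero]
      intro x hx
      obtain ⟨x, rfl⟩ := Ideal.Quotient.mk_surjective x
      rw [hi_mk, hB.algebraMap_eq_zero_iff] at hx
      exact Ideal.Quotient.eq_zero_iff_mem.mpr (Ideal.mem_span_singleton.mpr hx)
    have hg0 : algebraMap (PS K) B g ≠ 0 := by rwa [Ne, hB.algebraMap_eq_zero_iff]
    have hb : Function.Injective (LinearMap.lsmul (PS K) B g) := by
      intro x y hxy
      simp only [LinearMap.lsmul_apply, Algebra.smul_def] at hxy
      exact mul_left_cancel₀ hg0 hxy
    have hcoker : Module.length (PS K) (B ⧸ LinearMap.range i) ≠ ⊤ := by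
      obtain ⟨c, hc⟩ := hB.exists_conductor
      obtain ⟨t, ht⟩ := exists_irreducible B
      have hle : (Ideal.span {t ^ c}).restrictScalars (PS K) ≤ LinearMap.range i := by
        intro b hb
        obtain ⟨b', rfl⟩ := Ideal.mem_span_singleton.mp hb
        obtain ⟨x, hx⟩ := hc (t ^ c * b') (by
          rw [addVal_mul, ht.addVal_pow]
          exact le_self_add)
        exact ⟨Ideal.Quotient.mk _ x, hx⟩
      have h1 := Module.length_le_of_surjective (Submodule.factor hle)
        (Submodule.factor_surjective hle)
      have h2 : Module.length (PS K) (B ⧸ (Ideal.span {t ^ c}).restrictScalars (PS K)) = c := by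
        rw [← ht.addVal_pow]
        exact hB.length_quotient_span _
      rw [h2] at h1
      exact ne_top_of_le_ne_top (ENat.natCast_ne_top c) h1
    have hlen := Module.length_coker_eq i hi (LinearMap.lsmul (PS K) (LocRing p) g)
      (LinearMap.lsmul (PS K) B g) hb (by ext; simp) hcoker
    have h1 : LinearMap.range (LinearMap.lsmul (PS K) B g) =
        (Ideal.span {algebraMap (PS K) B g}).restrictScalars (PS K) := by
      ext x
      rw [Submodule.restrictScalars_mem, Ideal.mem_span_singleton]
      constructor
      · rintro ⟨y, rfl⟩
        exact ⟨y, by simp [Algebra.smul_def]⟩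
      · rintro ⟨y, rfl⟩
        exact ⟨y, by simp [Algebra.smul_def]⟩
    have hmk : ∀ y : LocRing p, g • y = Ideal.Quotient.mk (Ideal.span {p}) g * y :=
      fun y => Algebra.smul_def g y
    have h2 : LinearMap.range (LinearMap.lsmul (PS K) (LocRing p) g) =
        (Ideal.span {Ideal.Quotient.mk (Ideal.span {p}) g}).restrictScalars (PS K) := by
      ext x
      rw [Submodule.restrictScalars_mem, Ideal.mem_span_singleton]
      constructor
      · rintro ⟨y, rfl⟩
        exact ⟨y, hmk y⟩
      · rintro ⟨y, rfl⟩
        exact ⟨y, hmk y⟩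
    rw [h1, h2] at hlen
    rw [interNum_eq_length, ← ord_quotient_mk, val, ← hB.length_quotient_span]
    refine Eq.trans ?_ hlen.symm
    rw [Ring.ord, ← Module.length_eq_of_surjective (S := PS K) (R := LocRing p)
      Ideal.Quotient.mk_surjective]
    rfl

theorem val_eq_zero_iff {g : PS K} : val B g = 0 ↔ IsUnit g := by
  have := hB.finite
  have := isLocalHom_algebraMap_of_finite (K := K) B
  rw [val, addVal_eq_zero_iff, isUnit_map_iff]

/-- Two distinct general lines generate the maximal ideal, and both have value `mult p` along the
branch. -/
theorem mult_le_val [Infinite K] (hp : Irreducible p) {g : PS K}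
    (hg : g ∈ IsLocalRing.maximalIdeal (PS K)) : (mult p : ℕ∞) ≤ val B g := by
  have hfin := finite_setOf_interNum_line_ne hp.ne_zero
  obtain ⟨c, hc⟩ := hfin.infinite_compl.nonempty
  obtain ⟨d, hd, hdc⟩ : ∃ d, interNum (line d) p = mult p ∧ d ≠ c := by
    obtain ⟨d, hd⟩ := (hfin.union (Set.finite_singleton c)).infinite_compl.nonempty
    simp only [Set.mem_compl_iff, Set.mem_union, Set.mem_ofPred_eq, Set.mem_singleton_iff, not_or,
      not_not] at hd
    exact ⟨d, hd⟩
  simp only [Set.mem_compl_iff, Set.mem_ofPred_eq, not_not] at hc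
  rw [interNum_comm, hB.interNum_eq_val hp] at hc hd
  have hdc' : c - d ≠ 0 := sub_ne_zero.mpr (Ne.symm hdc)
  have hX1 : (X 1 : PS K) = C (c - d)⁻¹ * (line d + C (-1) * line c) := by
    simp only [line, map_neg, map_one]
    have h1 : (X 0 - C d * X 1 + -1 * (X 0 - C c * X 1) : PS K) = C (c - d) * X 1 := by
      rw [map_sub]
      ring
    rw [h1, ← mul_assoc, ← map_mul, inv_mul_cancel₀ hdc', map_one, one_mul]
  have h1 : (mult p : ℕ∞) ≤ val B (X 1 : PS K) := by
    rw [hX1, val_mul]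
    refine le_add_left (le_val_add hd.ge ?_)
    rw [val_mul]
    exact le_add_left hc.ge
  rw [maximalIdeal_eq_span_line c, Ideal.mem_span_pair] at hg
  obtain ⟨a, b, rfl⟩ := hg
  refine le_val_add ?_ ?_
  · rw [val_mul]
    exact le_add_left hc.ge
  · rw [val_mul]
    exact le_add_left h1

end IsBranchRing

end BranchRing

end PlaneCurve

/-! ### Values and conductor of a branch -/

namespace PlaneCurve

open IsLocalRing MvPowerSeries IsDiscreteValuationRing

variable {K : Type*} [Field K]

theorem interNum_le_of_span_le {f g f' g' : PS K}
    (h : (Ideal.span {f, g} : Ideal (PS K)) ≤ Ideal.span {f', g'}) :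
    interNum f' g' ≤ interNum f g := by
  rw [interNum_eq_length, interNum_eq_length]
  exact Module.length_le_of_surjective (Submodule.factor h) (Submodule.factor_surjective h)

/-- The exponent of the conductor of the branch in its normalization `B`. -/
noncomputable def condExp (K B : Type*) [Field K] [CommRing B] [IsDomain B]
    [IsDiscreteValuationRing B] [Algebra (PS K) B] : ℕ :=
  sInf {c : ℕ | ∀ b : B, (c : ℕ∞) ≤ addVal B b → b ∈ (algebraMap (PS K) B).range}

namespace IsBranchRing

variable {p : PS K} {B : Type*} [CommRing B] [IsDomain B] [IsDiscreteValuationRing B]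
  [Algebra (PS K) B] (hB : IsBranchRing p B)
include hB

theorem mem_range_of_condExp_le {b : B} (hb : (condExp K B : ℕ∞) ≤ addVal B b) :
    b ∈ (algebraMap (PS K) B).range :=
  Nat.sInf_mem (s := {c : ℕ | ∀ b : B, (c : ℕ∞) ≤ addVal B b → b ∈ (algebraMap (PS K) B).range})
    hB.exists_conductor b hb

/-- Leading coefficients lie in `K`, so they can be cancelled. -/
theorem exists_lt_addVal_sub {a b : B} (hab : addVal B a = addVal B b) (ha : addVal B a ≠ ⊤) :
    ∃ c : K, addVal B a < addVal B (a - algebraMap (PS K) B (C c) * b) := by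
  have hb0 : b ≠ 0 := by
    rintro rfl
    rw [hab, addVal_zero] at ha
    exact ha rfl
  obtain ⟨e, he⟩ := addVal_le_iff_dvd.mp hab.ge
  obtain ⟨c, hc⟩ := hB.exists_sub_mem e
  refine ⟨c, ?_⟩
  have : a - algebraMap (PS K) B (C c) * b = b * (e - algebraMap (PS K) B (C c)) := by
    rw [he]
    ring
  rw [this, addVal_mul, hab]
  have h1 : 1 ≤ addVal B (e - algebraMap (PS K) B (C c)) := by
    rw [Order.one_le_iff_ne_zero, Ne, addVal_eq_zero_iff]
    exact hc
  exact lt_of_lt_of_le ((ENat.lt_add_one_iff (hab ▸ ha)).mpr le_rfl) (add_le_add_right h1 _)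

theorem exists_lt_val_sub {g h : PS K} (hgh : val B g = val B h) (hg : val B g ≠ ⊤) :
    ∃ c : K, val B g < val B (g - C c * h) := by
  obtain ⟨c, hc⟩ := hB.exists_lt_addVal_sub hgh hg
  refine ⟨c, ?_⟩
  rw [val, val, map_sub, map_mul]
  exact hc

theorem val_congr {g h : PS K} (hgh : p ∣ g - h) : val B g = val B h := by
  rw [← hB.algebraMap_eq_zero_iff, map_sub, sub_eq_zero] at hgh
  rw [val, hgh, val]

theorem mem_span_of_le_val {u g : PS K} {n : ℕ} (hu : val B u = n)
    (hg : ((condExp K B + n : ℕ) : ℕ∞) ≤ val B g) : g ∈ Ideal.span {u, p} := by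
  have hug : val B u ≤ val B g := by
    rw [hu]
    exact le_trans (by exact_mod_cast Nat.le_add_left _ _) hg
  obtain ⟨b, hb⟩ := addVal_le_iff_dvd.mp hug
  have h1 : (condExp K B : ℕ∞) ≤ addVal B b := by
    have h2 : val B g = n + addVal B b := by rw [val, hb, addVal_mul, ← hu, val]
    rw [h2, Nat.cast_add, add_comm] at hg
    exact (ENat.add_le_add_iff_left (ENat.natCast_ne_top n)).mp hg
  obtain ⟨h, rfl⟩ := hB.mem_range_of_condExp_le h1
  rw [← map_mul, ← sub_eq_zero, ← map_sub, hB.algebraMap_eq_zero_iff] at hb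
  obtain ⟨a, ha⟩ := hb
  rw [Ideal.mem_span_pair]
  exact ⟨h, a, by linear_combination -ha⟩

/-- Subtracting power series of the same value raises the value of `b` step by step, until it passes
the true conductor. -/
theorem condExp_le {c : ℕ} (hc : ∀ m, c ≤ m → ∃ g : PS K, val B g = m) : condExp K B ≤ c := by
  refine Nat.sInf_le fun b hb => ?_
  by_cases hbc : (condExp K B : ℕ∞) ≤ addVal B b
  · exact hB.mem_range_of_condExp_le hbc
  · rw [not_le] at hbc
    obtain ⟨m, hm⟩ := ENat.ne_top_iff_exists.mp hbc.ne_top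
    obtain ⟨d, hd⟩ : ∃ d, condExp K B - m = d := ⟨_, rfl⟩
    induction d using Nat.strong_induction_on generalizing b m with
    | _ d ih =>
      rw [← hm, Nat.cast_lt] at hbc
      rw [← hm, Nat.cast_le] at hb
      obtain ⟨g, hg⟩ := hc m hb
      obtain ⟨a, ha⟩ := hB.exists_lt_addVal_sub (a := b) (b := algebraMap (PS K) B g)
        (by rw [← hm, ← hg, val]) (by rw [← hm]; exact ENat.natCast_ne_top m)
      have hmem : b - algebraMap (PS K) B (C a) * algebraMap (PS K) B g ∈
          (algebraMap (PS K) B).range := by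
        by_cases h' : (condExp K B : ℕ∞) ≤
            addVal B (b - algebraMap (PS K) B (C a) * algebraMap (PS K) B g)
        · exact hB.mem_range_of_condExp_le h'
        · rw [not_le] at h'
          obtain ⟨m', hm'⟩ := ENat.ne_top_iff_exists.mp h'.ne_top
          rw [← hm, ← hm', Nat.cast_lt] at ha
          refine ih (condExp K B - m') (by omega) _ ?_ h' m' hm' rfl
          rw [← hm', Nat.cast_le]
          omega
      have := add_mem hmem (⟨C a * g, map_mul _ _ _⟩ :
        algebraMap (PS K) B (C a) * algebraMap (PS K) B g ∈ (algebraMap (PS K) B).range)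
      simpa using this

/-! ### Conductor estimates from a system of parameters -/

section Parameters

variable (hp : Irreducible p) {u w : PS K} (huw : maximalIdeal (PS K) = Ideal.span {u, w})
  {n : ℕ} (hu : val B u = n)
include hp huw hu

theorem le_of_pow_mem {j : ℕ} (h : w ^ j ∈ Ideal.span {u, p}) : n ≤ j := by
  have := interNum_le_of_mem huw h
  rw [interNum_comm, hB.interNum_eq_val hp, hu] at this
  exact_mod_cast this

theorem val_lt_of_two_le (hn : 2 ≤ n) : val B w < (condExp K B + n : ℕ) := by
  by_contra h
  have h1 := hB.mem_span_of_le_val hu (not_lt.mp h)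
  have := hB.le_of_pow_mem hp huw hu (j := 1) (by simpa using h1)
  omega

/-- Modulo `w` the series `h` is a unit times a power of `u`, and multiples of `w` are too high to
affect a value below that of `w`. -/
theorem exists_val_eq_mul {h : PS K} (hh : val B h < val B w) : ∃ k : ℕ, val B h = (k * n : ℕ) := by
  by_cases hw : h ∈ Ideal.span {w}
  · obtain ⟨b, rfl⟩ := Ideal.mem_span_singleton.mp hw
    rw [val_mul] at hh
    exact absurd hh (not_lt.mpr le_self_add)
  · obtain ⟨k, e, b, he, rfl⟩ := exists_eq_unit_mul_pow_add huw hw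
    refine ⟨k, ?_⟩
    have h1 : val B (e * u ^ k) = (k * n : ℕ) := by
      rw [val_unit_mul he, val_pow, hu, Nat.cast_mul]
    have h2 : val B w ≤ val B (w * b) := by
      rw [val_mul]
      exact le_self_add
    rcases lt_or_ge (val B (e * u ^ k)) (val B (w * b)) with h3 | h3
    · rw [val_add_eq_of_lt h3, h1]
    · exact absurd hh (not_lt.mpr (le_val_add (h2.trans h3) h2))

/-- Otherwise `w ^ (n - 1)` has value at least conductor plus `n`, hence lies in `(u, p)`, and `(u,
p)₀ ≤ n - 1`. -/
theorem sub_one_mul_lt (hn : 1 ≤ n) {v : ℕ} (hv : val B w = v) :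
    (n - 1) * v < condExp K B + n := by
  by_contra h
  have h1 : ((condExp K B + n : ℕ) : ℕ∞) ≤ val B (w ^ (n - 1)) := by
    rw [val_pow, hv]
    exact_mod_cast not_lt.mp h
  have := hB.le_of_pow_mem hp huw hu (hB.mem_span_of_le_val hu h1)
  omega

/-- With a common factor `e ≥ 2`, the powers `w ^ (n / e)` and `u ^ (v / e)` have equal value and `n
/ e ≤ n - 1`. Cancelling leading terms replaces `w ^ (n - 1)` by an element congruent to it modulo
`u` and of strictly larger value, which improves the previous estimate by one. -/
theorem sub_one_mul_add_one_lt (hn : 1 ≤ n) {v : ℕ} (hv1 : 1 ≤ v) (hv : val B w = v)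
    (hgcd : ¬ Nat.Coprime n v) : (n - 1) * v + 1 < condExp K B + n := by
  by_contra h
  set e := Nat.gcd n v with he
  have he0 : 0 < e := Nat.gcd_pos_of_pos_left _ (by omega)
  have he2 : 2 ≤ e := by
    have : e ≠ 1 := hgcd
    omega
  obtain ⟨n', hn'⟩ := Nat.gcd_dvd_left n v
  obtain ⟨v', hv'⟩ := Nat.gcd_dvd_right n v
  rw [← he] at hn' hv'
  have hn'0 : 0 < n' := Nat.pos_of_ne_zero (by rintro rfl; omega)
  have hv'0 : 0 < v' := Nat.pos_of_ne_zero (by rintro rfl; omega)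
  have hn'lt : n' ≤ n - 1 := by
    have : 2 * n' ≤ e * n' := Nat.mul_le_mul_right _ he2
    omega
  have hw1 : val B (w ^ n') = (n' * v : ℕ) := by rw [val_pow, hv, Nat.cast_mul]
  have hu1 : val B (u ^ v') = (n' * v : ℕ) := by
    rw [val_pow, hu, ← Nat.cast_mul]
    congr 1
    rw [hn', hv']
    ring
  obtain ⟨c, hc⟩ := hB.exists_lt_val_sub (hw1.trans hu1.symm)
    (by rw [hw1]; exact ENat.natCast_ne_top _)
  have h1 : ((condExp K B + n : ℕ) : ℕ∞) ≤ val B ((w ^ n' - C c * u ^ v') * w ^ (n - 1 - n')) := by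
    rw [val_mul, val_pow, hv]
    rw [hw1] at hc
    have h2 := Order.add_one_le_of_lt hc
    refine le_trans ?_ (add_le_add_left h2 _)
    have h3 : n' * v + (n - 1 - n') * v = (n - 1) * v := by
      rw [← add_mul, Nat.add_sub_cancel' hn'lt]
    norm_cast
    omega
  have h2 := hB.mem_span_of_le_val hu h1
  have h3 : w ^ (n - 1) ∈ Ideal.span {u, p} := by
    have h4 : w ^ (n - 1) = (w ^ n' - C c * u ^ v') * w ^ (n - 1 - n') +
        (C c * u ^ (v' - 1) * w ^ (n - 1 - n')) * u := by
      obtain ⟨j, hj⟩ := Nat.exists_eq_add_of_le hn'lt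
      obtain ⟨i, hi⟩ := Nat.exists_eq_add_of_le hv'0
      rw [hj, hi]
      simp only [Nat.add_sub_cancel_left]
      ring
    rw [h4]
    exact add_mem h2 (Ideal.mul_mem_left _ _ (Ideal.subset_span (by simp)))
  have := hB.le_of_pow_mem hp huw hu h3
  omega

/-- Since `(u, p)₀ = n`, the power `w ^ n` vanishes modulo `u` and `p`. Only unit multiples of `w ^
k` with `k < n` survive there. -/
theorem exists_eq_unit_mul_pow_add_mod (hn : 1 ≤ n) (h : PS K) : ∃ b : PS K, p ∣ h - u * b ∨
    ∃ k < n, ∃ e : PS K, IsUnit e ∧ p ∣ h - (e * w ^ k + u * b) := by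
  have hwu : maximalIdeal (PS K) = Ideal.span {w, u} := by rw [huw, Set.pair_comm]
  have hpow : w ^ n ∈ Ideal.span {u, p} := by
    have hpu : p ∉ Ideal.span {u} := by
      intro hpu
      have hass := (hp.dvd_iff.mp (Ideal.mem_span_singleton.mp hpu)).resolve_left (fun hunit => by
        rw [← hB.val_eq_zero_iff, hu] at hunit
        norm_cast at hunit
        omega)
      rw [hB.val_eq_top_iff.mpr hass.dvd] at hu
      exact ENat.top_ne_natCast n hu
    obtain ⟨k, e, b, he, hpe⟩ := exists_eq_unit_mul_pow_add hwu hpu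
    have hle : (Ideal.span {u, p} : Ideal (PS K)) ≤ Ideal.span {u, w ^ k} := by
      rw [Ideal.span_le]
      rintro _ (rfl | rfl)
      · exact Ideal.subset_span (by simp)
      · rw [SetLike.mem_coe, Ideal.mem_span_pair, hpe]
        exact ⟨b, e, by ring⟩
    have hk := interNum_le_of_span_le hle
    rw [interNum_pow huw, interNum_comm, hB.interNum_eq_val hp, hu, Nat.cast_le] at hk
    obtain ⟨c, hc⟩ := he.exists_left_inv
    have hwk : w ^ k ∈ Ideal.span {u, p} := by
      rw [Ideal.mem_span_pair]
      exact ⟨-c * b, c, by rw [hpe]; linear_combination w ^ k * hc⟩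
    obtain ⟨j, rfl⟩ := Nat.exists_eq_add_of_le hk
    rw [pow_add]
    exact Ideal.mul_mem_right _ _ hwk
  by_cases hhu : h ∈ Ideal.span {u}
  · obtain ⟨b, rfl⟩ := Ideal.mem_span_singleton.mp hhu
    exact ⟨b, Or.inl (by simp)⟩
  · obtain ⟨k, e, b, he, rfl⟩ := exists_eq_unit_mul_pow_add hwu hhu
    by_cases hk : k < n
    · exact ⟨b, Or.inr ⟨k, hk, e, he, by simp⟩⟩
    · obtain ⟨j, rfl⟩ := Nat.exists_eq_add_of_le (not_lt.mp hk)
      obtain ⟨a, d, had⟩ := Ideal.mem_span_pair.mp hpow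
      refine ⟨e * w ^ j * a + b, Or.inl ⟨e * w ^ j * d, ?_⟩⟩
      rw [pow_add, ← had]
      ring

/-- Write `h` as `e * w ^ k + u * b` modulo `p` with `k < n` and apply induction to `b`. The
summands cannot have equal value: a relation `k v = (i + 1) n + j v` would force `n` to divide the
positive number `k - j < n`. -/
theorem exists_val_eq_add_of_coprime (hn : 1 ≤ n) {v : ℕ} (hv : val B w = v)
    (hco : Nat.Coprime n v) (m : ℕ) {h : PS K} (hh : val B h = m) :
    ∃ i j : ℕ, m = i * n + j * v := by
  induction m using Nat.strong_induction_on generalizing h with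
  | _ m ih =>
    obtain ⟨b, hb | ⟨k, hk, e, he, hb⟩⟩ := hB.exists_eq_unit_mul_pow_add_mod hp huw hu hn h
    · rw [hB.val_congr hb, val_mul, hu] at hh
      obtain ⟨m', hm'⟩ := ENat.ne_top_iff_exists.mp
        (ne_top_of_le_ne_top (ENat.natCast_ne_top m) (le_add_self.trans hh.le))
      rw [← hm'] at hh
      norm_cast at hh
      obtain ⟨i, j, hij⟩ := ih m' (by omega) hm'.symm
      exact ⟨i + 1, j, by rw [← hh, hij]; ring⟩
    · rw [hB.val_congr hb] at hh
      have hk1 : val B (e * w ^ k) = (k * v : ℕ) := by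
        rw [val_unit_mul he, val_pow, hv, Nat.cast_mul]
      rcases lt_trichotomy (val B (e * w ^ k)) (val B (u * b)) with hlt | heq | hlt
      · rw [val_add_eq_of_lt hlt, hk1] at hh
        exact ⟨0, k, by rw [zero_mul, zero_add]; exact_mod_cast hh.symm⟩
      · exfalso
        have hle : ((k * v : ℕ) : ℕ∞) ≤ m := by
          rw [← hh, ← hk1]
          exact le_val_add le_rfl heq.le
        rw [hk1, val_mul, hu] at heq
        obtain ⟨m', hm'⟩ := ENat.ne_top_iff_exists.mp
          (ne_top_of_le_ne_top (ENat.natCast_ne_top (k * v)) (le_add_self.trans heq.ge))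
        rw [← hm'] at heq
        norm_cast at heq hle
        obtain ⟨i, j, hij⟩ := ih m' (by omega) hm'.symm
        have h1 : k * v = (i + 1) * n + j * v := by rw [heq, hij]; ring
        have hjk : j < k := by
          by_contra hjk
          have : k * v ≤ j * v := Nat.mul_le_mul_right _ (not_lt.mp hjk)
          have : 0 < (i + 1) * n := by positivity
          omega
        obtain ⟨d, rfl⟩ := Nat.exists_eq_add_of_lt hjk
        have h2 : (d + 1) * v = (i + 1) * n := by nlinarith
        have h3 : n ∣ (d + 1) := hco.dvd_of_dvd_mul_right ⟨i + 1, by rw [h2]; ring⟩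
        have := Nat.le_of_dvd (Nat.succ_pos d) h3
        omega
      · rw [add_comm, val_add_eq_of_lt hlt, val_mul, hu] at hh
        obtain ⟨m', hm'⟩ := ENat.ne_top_iff_exists.mp
          (ne_top_of_le_ne_top (ENat.natCast_ne_top m) (le_add_self.trans hh.le))
        rw [← hm'] at hh
        norm_cast at hh
        obtain ⟨i, j, hij⟩ := ih m' (by omega) hm'.symm
        exact ⟨i + 1, j, by rw [← hh, hij]; ring⟩

/-- By the two-generator Frobenius formula every integer from `(n - 1)(v - 1)` on is the value of a
monomial in `u` and `w`. -/
theorem condExp_le_of_coprime (hn : 2 ≤ n) {v : ℕ} (hv2 : 2 ≤ v) (hv : val B w = v)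
    (hco : Nat.Coprime n v) : condExp K B + n + v ≤ n * v + 1 := by
  have hmul : n + v ≤ n * v := by nlinarith
  have h := frobeniusNumber_iff.mp (frobeniusNumber_pair hco (by omega) (by omega))
  have := hB.condExp_le (c := n * v - n - v + 1) (fun m hm => by
    have hmem := h.2 m (by omega)
    rw [AddSubmonoid.mem_closure_pair] at hmem
    obtain ⟨i, j, hij⟩ := hmem
    refine ⟨u ^ i * w ^ j, ?_⟩
    rw [val_mul, val_pow, val_pow, hu, hv]
    exact_mod_cast hij)
  omega

end Parameters

end IsBranchRing

end PlaneCurve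

/-! ### Maximal contact and Zariski pairs -/

namespace PlaneCurve

open IsLocalRing MvPowerSeries IsDiscreteValuationRing

variable {K : Type*} [Field K]

theorem isBranchOf_iff_associated {p q : PS K} (hp : Irreducible p) :
    IsBranchOf q p ↔ Associated q p := by
  constructor
  · rintro ⟨hq, hqp⟩
    exact (hp.dvd_iff.mp hqp).resolve_left hq.not_isUnit |>.symm
  · intro h
    exact ⟨h.symm.irreducible hp, h.dvd⟩

theorem interNum_congr {p p' q q' : PS K} (hp : Associated p p') (hq : Associated q q') :
    interNum p q = interNum p' q' := by
  have key : ∀ {p p' q q' : PS K}, p' ∣ p → q' ∣ q →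
      (Ideal.span {p, q} : Ideal (PS K)) ≤ Ideal.span {p', q'} := by
    intro p p' q q' h1 h2
    rw [Ideal.span_le]
    rintro _ (rfl | rfl)
    · exact Ideal.mem_of_dvd _ h1 (Ideal.subset_span (by simp))
    · exact Ideal.mem_of_dvd _ h2 (Ideal.subset_span (by simp))
  exact le_antisymm (interNum_le_of_span_le (key hp.dvd hq.dvd))
    (interNum_le_of_span_le (key hp.symm.dvd hq.symm.dvd))

theorem branchContact_congr {p p' q q' : PS K} (hp : Associated p p') (hq : Associated q q') :
    branchContact p q = branchContact p' q' := by
  rw [branchContact, branchContact, interNum_congr hp hq, mult_eq_of_associated hp,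
    mult_eq_of_associated hq]

theorem branchContact_comm (p q : PS K) : branchContact p q = branchContact q p := by
  rw [branchContact, branchContact, interNum_comm, mul_comm]

theorem contact_le_branchContact {f p w : PS K} (hp : IsBranchOf p f) (hw : Irreducible w) :
    contact f w ≤ branchContact p w :=
  (iInf₂_le p hp).trans (iInf₂_le w ⟨hw, dvd_rfl⟩)

theorem contact_eq_branchContact {p w : PS K} (hp : Irreducible p) (hw : Irreducible w) :
    contact p w = branchContact p w := by
  refine le_antisymm (contact_le_branchContact ⟨hp, dvd_rfl⟩ hw) ?_
  refine le_iInf₂ fun p' hp' => le_iInf₂ fun w' hw' => ?_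
  rw [branchContact_congr ((isBranchOf_iff_associated hp).mp hp')
    ((isBranchOf_iff_associated hw).mp hw')]

namespace IsBranchRing

variable {p : PS K} {B : Type*} [CommRing B] [IsDomain B] [IsDiscreteValuationRing B]
  [Algebra (PS K) B] (hB : IsBranchRing p B) (hp : Irreducible p)
include hB hp

theorem branchContact_eq {q : PS K} {m : ℕ} (hq : val B q = m) :
    branchContact p q = (m : ℝ≥0∞) / (mult p * mult q) := by
  rw [branchContact, hB.interNum_eq_val hp, hq]
  simp

theorem mem_semigroup_iff {m : ℕ} : m ∈ semigroup p ↔ ∃ g : PS K, val B g = m := by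
  constructor
  · rintro ⟨g, -, hg⟩
    exact ⟨g, by rw [← hB.interNum_eq_val hp, hg]⟩
  · rintro ⟨g, hg⟩
    refine ⟨g, ?_, by rw [hB.interNum_eq_val hp, hg]⟩
    rw [← hB.val_eq_top_iff, hg]
    exact ENat.natCast_ne_top m

/-- Fix a transversal line `u` and let `w` have the largest value among the parameters complementing
it; values are bounded by the conductor. If `mult p` divided this value, subtracting a multiple of a
power of `u` would give a better parameter. -/
theorem exists_maximal_contact [Infinite K] (hn : 2 ≤ mult p) :
    ∃ (u w : PS K) (v : ℕ), maximalIdeal (PS K) = Ideal.span {u, w} ∧ val B u = mult p ∧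
      val B w = v ∧ ¬ mult p ∣ v ∧ mult p < v := by
  obtain ⟨c, hc⟩ := (finite_setOf_interNum_line_ne hp.ne_zero).infinite_compl.nonempty
  simp only [Set.mem_compl_iff, Set.mem_ofPred_eq, not_not] at hc
  rw [interNum_comm, hB.interNum_eq_val hp] at hc
  set u : PS K := line c with hu
  let S : Set ℕ := {v | ∃ w, maximalIdeal (PS K) = Ideal.span {u, w} ∧ val B w = v}
  have hbdd : ∀ w, maximalIdeal (PS K) = Ideal.span {u, w} →
      ∃ v : ℕ, val B w = v ∧ v < condExp K B + mult p := fun w hw => by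
    have h := hB.val_lt_of_two_le hp hw hc hn
    obtain ⟨v, hv⟩ := ENat.ne_top_iff_exists.mp h.ne_top
    rw [← hv] at h
    exact ⟨v, hv.symm, by exact_mod_cast h⟩
  have hSne : S.Nonempty := by
    obtain ⟨v, hv, -⟩ := hbdd _ (maximalIdeal_eq_span_line c)
    exact ⟨v, X 1, maximalIdeal_eq_span_line c, hv⟩
  have hSb : BddAbove S := by
    refine ⟨condExp K B + mult p, ?_⟩
    rintro v ⟨w, hw, hv⟩
    obtain ⟨v', hv', hlt⟩ := hbdd w hw
    rw [hv] at hv'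
    have : v = v' := by exact_mod_cast hv'
    omega
  obtain ⟨w, hw, hv⟩ := Nat.sSup_mem hSne hSb
  set v := sSup S with hvdef
  have hle : mult p ≤ v := by
    have h := hB.mult_le_val hp (g := w) (by rw [hw]; exact Ideal.subset_span (by simp))
    rw [hv] at h
    exact_mod_cast h
  have hndvd : ¬ mult p ∣ v := by
    rintro ⟨k, hk⟩
    have hk0 : k ≠ 0 := by
      rintro rfl
      omega
    have huk : val B (u ^ k) = v := by
      rw [val_pow, hc, hk, mul_comm]
      norm_cast
    obtain ⟨a, ha⟩ := hB.exists_lt_val_sub (hv.trans huk.symm)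
      (by rw [hv]; exact ENat.natCast_ne_top v)
    obtain ⟨j, rfl⟩ := Nat.exists_eq_succ_of_ne_zero hk0
    have hw' : maximalIdeal (PS K) = Ideal.span {u, w - C a * u ^ (j + 1)} := by
      rw [hw]
      apply le_antisymm <;> rw [Ideal.span_le] <;> rintro _ (rfl | rfl)
      · exact Ideal.subset_span (by simp)
      · rw [SetLike.mem_coe, Ideal.mem_span_pair]
        exact ⟨C a * u ^ j, 1, by ring⟩
      · exact Ideal.subset_span (by simp)
      · rw [SetLike.mem_coe, Ideal.mem_span_pair]
        exact ⟨-C a * u ^ j, 1, by ring⟩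
    obtain ⟨v', hv', -⟩ := hbdd _ hw'
    have h1 : v' ≤ v := le_csSup hSb ⟨_, hw', hv'⟩
    rw [hv, hv', Nat.cast_lt] at ha
    omega
  refine ⟨u, w, v, hw, hc, hv, hndvd, lt_of_le_of_ne hle ?_⟩
  intro h
  exact hndvd (by rw [← h])

section Parameters

variable {u w : PS K} (huw : maximalIdeal (PS K) = Ideal.span {u, w}) (hu : val B u = mult p)
  {v : ℕ} (hv : val B w = v) (hndvd : ¬ mult p ∣ v) (hlt : mult p < v)
include huw hu hv hndvd hlt

/-- Write `z = a u + b w`. If `a` is a unit, the value is only `mult p`; if both coefficients are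
non-units, the order is at least two. If only `b` is a unit and `z` had value above `v`, then `a u`
would have value `v`, so `a` would have value `v - mult p`, below that of `w`. This is a multiple of
`mult p`, and so would `v` be. -/
theorem val_le_of_mult_eq_one {z : PS K} (hz : mult z = 1) : val B z ≤ v := by
  have hz0 : z ≠ 0 := ne_zero_of_mult_pos (by omega)
  have hzm : z ∈ maximalIdeal (PS K) := by
    have := mem_maximalIdeal_pow_mult hz0
    rwa [hz, pow_one] at this
  have hum : u ∈ maximalIdeal (PS K) := by rw [huw]; exact Ideal.subset_span (by simp)
  have hwm : w ∈ maximalIdeal (PS K) := by rw [huw]; exact Ideal.subset_span (by simp)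
  rw [huw, Ideal.mem_span_pair] at hzm
  obtain ⟨a, b, rfl⟩ := hzm
  have hbw : val B w ≤ val B (b * w) := by
    rw [val_mul]
    exact le_add_self
  by_cases ha : IsUnit a
  · have h1 : val B (a * u) = mult p := by rw [val_unit_mul ha, hu]
    rw [val_add_eq_of_lt, h1]
    · exact_mod_cast hlt.le
    · refine lt_of_lt_of_le ?_ hbw
      rw [h1, hv]
      exact_mod_cast hlt
  · by_cases hb : IsUnit b
    · by_contra hcon
      rw [not_le] at hcon
      have h1 : val B (-b * w) = v := by rw [val_unit_mul hb.neg, hv]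
      have h2 : val B (a * u) = v := by
        have : a * u = -b * w + (a * u + b * w) := by ring
        rw [this, val_add_eq_of_lt (by rwa [h1]), h1]
      rw [val_mul, hu] at h2
      obtain ⟨m, hm⟩ := ENat.ne_top_iff_exists.mp
        (ne_top_of_le_ne_top (ENat.natCast_ne_top v) (le_self_add.trans h2.le))
      have hn0 : 0 < mult p := Nat.pos_of_ne_zero fun h =>
        hp.not_isUnit ((mult_eq_zero_iff hp.ne_zero).mp h)
      rw [← hm] at h2
      have h2' : m + mult p = v := by exact_mod_cast h2
      obtain ⟨k, hk⟩ := hB.exists_val_eq_mul hp huw hu (h := a) (by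
        rw [← hm, hv]
        have : m < v := by omega
        exact_mod_cast this)
      rw [← hm] at hk
      have hk' : m = k * mult p := by exact_mod_cast hk
      exact hndvd ⟨k + 1, by rw [← h2', hk']; ring⟩
    · exfalso
      have : a * u + b * w ∈ maximalIdeal (PS K) ^ 2 := by
        rw [pow_two]
        exact add_mem (Ideal.mul_mem_mul ha hum) (Ideal.mul_mem_mul hb hwm)
      rw [mem_maximalIdeal_pow_iff, ← mult_eq hz0, hz] at this
      norm_num at this

theorem contactExp_eq : contactExp p = (v : ℝ≥0∞) / mult p := by
  have hw1 : mult w = 1 := mult_eq_one_of_maximalIdeal_eq (u := w) (w := u)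
    (by rw [huw, Set.pair_comm])
  apply le_antisymm
  · refine iSup₂_le fun z hz => ?_
    have h1 := hB.val_le_of_mult_eq_one hp huw hu hv hndvd hlt hz.2
    obtain ⟨m, hm⟩ := ENat.ne_top_iff_exists.mp (ne_top_of_le_ne_top (ENat.natCast_ne_top v) h1)
    rw [contact_eq_branchContact hp hz.1, hB.branchContact_eq hp hm.symm, hz.2, Nat.cast_one, mul_one]
    rw [← hm] at h1
    gcongr
    exact_mod_cast h1
  · have h : contact p w ≤ contactExp p :=
      le_iSup₂_of_le w ⟨irreducible_of_mult_eq_one hw1, hw1⟩ le_rfl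
    rwa [contact_eq_branchContact hp (irreducible_of_mult_eq_one hw1), hB.branchContact_eq hp hv,
      hw1, Nat.cast_one, mul_one] at h

theorem isLeast_semigroup_diff_zero [Infinite K] : IsLeast (semigroup p \ {0}) (mult p) := by
  have hn0 : mult p ≠ 0 := fun h => hp.not_isUnit ((mult_eq_zero_iff hp.ne_zero).mp h)
  refine ⟨⟨(hB.mem_semigroup_iff hp).mpr ⟨u, hu⟩, hn0⟩, ?_⟩
  rintro m ⟨hm, hm0⟩
  obtain ⟨g, hg⟩ := (hB.mem_semigroup_iff hp).mp hm
  have : g ∈ maximalIdeal (PS K) := by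
    intro hunit
    rw [hB.val_eq_zero_iff.mpr hunit] at hg
    exact hm0 (by exact_mod_cast hg.symm)
  have := hB.mult_le_val hp this
  rw [hg] at this
  exact_mod_cast this

theorem isLeast_semigroup_diff_closure :
    IsLeast (semigroup p \ (AddSubmonoid.closure {mult p} : Set ℕ)) v := by
  have hmem : ∀ m, m ∈ AddSubmonoid.closure {mult p} ↔ mult p ∣ m := fun m => by
    rw [AddSubmonoid.mem_closure_singleton]
    constructor
    · rintro ⟨k, rfl⟩
      exact ⟨k, by rw [smul_eq_mul, mul_comm]⟩
    · rintro ⟨k, rfl⟩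
      exact ⟨k, by rw [smul_eq_mul, mul_comm]⟩
  refine ⟨⟨(hB.mem_semigroup_iff hp).mpr ⟨w, hv⟩, fun h => hndvd ((hmem v).mp h)⟩, ?_⟩
  rintro m ⟨hm, hmn⟩
  by_contra hlt'
  obtain ⟨g, hg⟩ := (hB.mem_semigroup_iff hp).mp hm
  obtain ⟨k, hk⟩ := hB.exists_val_eq_mul hp huw hu (h := g) (by
    rw [hg, hv]
    exact_mod_cast not_le.mp hlt')
  rw [hg] at hk
  exact hmn ((hmem m).mpr ⟨k, by rw [mul_comm]; exact_mod_cast hk⟩)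

/-- One pair means that the semigroup is generated by `mult p` and `v`. It contains all large
integers, so the generators are coprime; conversely coprimality forces every value to be a
combination of the two. -/
theorem exists_isZariskiPairs_singleton_iff [Infinite K] :
    (∃ mn : ℕ × ℕ, IsZariskiPairs p [mn]) ↔ Nat.Coprime (mult p) v := by
  have hn0 : mult p ≠ 0 := fun h => hp.not_isUnit ((mult_eq_zero_iff hp.ne_zero).mp h)
  have hIio : (Set.Iio (1 : Fin 2)) = {0} := by
    ext i
    fin_cases i <;> simp
  have hleast0 := hB.isLeast_semigroup_diff_zero hp huw hu hv hndvd hlt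
  have hleast1 := hB.isLeast_semigroup_diff_closure hp huw hu hv hndvd hlt
  constructor
  · rintro ⟨mn, g, v', hgen, hL⟩
    have hg : g = 1 := by
      have := congrArg List.length hL
      simpa using this.symm
    subst hg
    have h0 : v' 0 = mult p := hgen.zero.unique hleast0
    have h1 : v' 1 = v := by
      have h := hgen.step 1 (by simp)
      rw [hIio, Set.image_singleton, h0] at h
      exact h.unique hleast1
    have hrange : Set.range v' = {mult p, v} := by
      ext m
      have h2 : (∃ i, v' i = m) ↔ v' 0 = m ∨ v' 1 = m := Fin.exists_fin_two
      rw [Set.mem_range, h2, h0, h1, Set.mem_insert_iff, Set.mem_singleton_iff, eq_comm,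
        eq_comm (a := v)]
    have hdvd : ∀ m ∈ semigroup p, Nat.gcd (mult p) v ∣ m := by
      intro m hm
      rw [hgen.generates, hrange, SetLike.mem_coe, AddSubmonoid.mem_closure_pair] at hm
      obtain ⟨a, b, rfl⟩ := hm
      exact dvd_add (Dvd.dvd.mul_left (Nat.gcd_dvd_left _ _) _)
        (Dvd.dvd.mul_left (Nat.gcd_dvd_right _ _) _)
    have hcond : ∀ m, condExp K B ≤ m → m ∈ semigroup p := by
      intro m hm
      obtain ⟨t, ht⟩ := exists_irreducible B
      obtain ⟨g, hg⟩ := hB.mem_range_of_condExp_le (b := t ^ m) (by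
        rw [ht.addVal_pow]
        exact_mod_cast hm)
      exact (hB.mem_semigroup_iff hp).mpr ⟨g, by rw [val, hg, ht.addVal_pow]⟩
    have h2 := hdvd _ (hcond _ le_rfl)
    have h3 := hdvd _ (hcond _ (Nat.le_succ _))
    exact Nat.dvd_one.mp ((Nat.dvd_add_right h2).mp h3)
  · intro hco
    let z : Fin (1 + 1) → ℕ := ![mult p, v]
    refine ⟨(z (Fin.succ 0) / gcdSeq z (Fin.succ 0),
      gcdSeq z (Fin.castSucc 0) / gcdSeq z (Fin.succ 0)), 1, z, ⟨hleast0, ?_, ?_⟩, ?_⟩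
    · intro k hk
      have : k = 1 := by
        fin_cases k
        · exact absurd hk (lt_irrefl _)
        · rfl
      subst this
      rw [hIio, Set.image_singleton]
      exact hleast1
    · have hrange : Set.range z = {mult p, v} := by
        rw [Set.pair_comm]
        simp [z]
      rw [hrange]
      ext m
      rw [hB.mem_semigroup_iff hp, SetLike.mem_coe, AddSubmonoid.mem_closure_pair]
      constructor
      · rintro ⟨g, hg⟩
        obtain ⟨i, j, h⟩ := hB.exists_val_eq_add_of_coprime hp huw hu
          (Nat.one_le_iff_ne_zero.mpr hn0) hv hco m hg
        exact ⟨i, j, h.symm⟩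
      · rintro ⟨i, j, rfl⟩
        refine ⟨u ^ i * w ^ j, ?_⟩
        rw [val_mul, val_pow, val_pow, hu, hv]
        norm_cast
    · rw [List.ofFn_succ, List.ofFn_zero]

end Parameters

/-- The conductor of a singular branch, compared with its contact exponent. -/
theorem condExp_of_two_le [Infinite K] (hn : 2 ≤ mult p) :
    ∃ v : ℕ, mult p < v ∧ contactExp p = (v : ℝ≥0∞) / mult p ∧
      (mult p - 1) * (v - 1) ≤ condExp K B ∧
      (condExp K B = (mult p - 1) * (v - 1) ↔ ∃ mn : ℕ × ℕ, IsZariskiPairs p [mn]) := by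
  obtain ⟨u, w, v, huw, hu, hv, hndvd, hlt⟩ := hB.exists_maximal_contact hp hn
  have hexp : (mult p - 1) * v = (mult p - 1) * (v - 1) + (mult p - 1) := by
    obtain ⟨j, rfl⟩ := Nat.exists_eq_add_of_lt hlt
    simp only [Nat.add_sub_cancel]
    ring
  have hexp2 : mult p * v + 1 = (mult p - 1) * (v - 1) + mult p + v := by
    obtain ⟨j, rfl⟩ := Nat.exists_eq_add_of_lt hlt
    obtain ⟨i, hi⟩ := Nat.exists_eq_add_of_le hn
    rw [hi]
    simp only [Nat.add_sub_cancel, show 2 + i - 1 = i + 1 by omega]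
    ring
  -- With `n = mult p`, the strict inequality `(n - 1) v < condExp + n` is exactly `(n - 1)(v - 1) ≤
  -- condExp`.
  have hle := hB.sub_one_mul_lt hp huw hu (by omega) hv
  refine ⟨v, hlt, hB.contactExp_eq hp huw hu hv hndvd hlt, by omega, ?_⟩
  rw [hB.exists_isZariskiPairs_singleton_iff hp huw hu hv hndvd hlt]
  constructor
  · intro h
    by_contra hco
    have := hB.sub_one_mul_add_one_lt hp huw hu (by omega) (by omega) hv hco
    omega
  · intro hco
    have := hB.condExp_le_of_coprime hp huw hu hn (by omega) hv hco
    omega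

theorem condExp_of_mult_eq_one [Infinite K] (hn : mult p = 1) : condExp K B = 0 := by
  obtain ⟨c, hc⟩ := (finite_setOf_interNum_line_ne hp.ne_zero).infinite_compl.nonempty
  simp only [Set.mem_compl_iff, Set.mem_ofPred_eq, not_not] at hc
  rw [interNum_comm, hB.interNum_eq_val hp, hn] at hc
  refine Nat.le_zero.mp (hB.condExp_le fun m _ => ⟨line c ^ m, ?_⟩)
  rw [val_pow, hc, Nat.cast_one, mul_one]

end IsBranchRing

end PlaneCurve

/-! ### The order of contact of two branches -/

namespace PlaneCurve

open IsLocalRing MvPowerSeries IsDiscreteValuationRing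

variable {K : Type*} [Field K]

namespace IsBranchRing

variable {p : PS K} {B : Type*} [CommRing B] [IsDomain B] [IsDiscreteValuationRing B]
  [Algebra (PS K) B] (hB : IsBranchRing p B)
include hB

/-- The exponent of `u` is `(d - j) / n` rounded up, so the terms `u ^ _ * t ^ j` have as values
precisely `d, …, d + n - 1`. Cancelling leading terms moves `b` into `u M`, where `M` is the module
of elements of value at least `d`, and Nakayama's lemma finishes. -/
theorem exists_sum_pow_of_le_addVal {u : PS K} {n : ℕ} (hn : 1 ≤ n) (hu : val B u = n) {t : B}
    (ht : Irreducible t) {d : ℕ} {b : B} (hb : d ≤ addVal B b) :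
    ∃ r : Fin n → PS K,
      b = ∑ j : Fin n, algebraMap (PS K) B (r j * u ^ ((d + (n - 1 - j)) / n)) * t ^ (j : ℕ) := by
  have hfin := hB.finite
  let g : Fin n → B := fun j => algebraMap (PS K) B (u ^ ((d + (n - 1 - j)) / n)) * t ^ (j : ℕ)
  let M : Submodule (PS K) B :=
    { carrier := {b | d ≤ addVal B b}
      zero_mem' := by simp
      add_mem' := fun hx hy => (le_min hx hy).trans addVal_add
      smul_mem' := fun c x hx => by
        rw [Set.mem_ofPred_eq, Algebra.smul_def, addVal_mul]
        exact le_add_left hx }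
  have hg : ∀ j, addVal B (g j) = (((d + (n - 1 - j)) / n * n + j : ℕ) : ℕ∞) := by
    intro j
    have h1 := val_pow (B := B) u ((d + (n - 1 - j)) / n)
    rw [val, hu] at h1
    rw [addVal_mul, h1, ht.addVal_pow]
    norm_cast
  have hle : M ≤ Submodule.span (PS K) (Set.range g) ⊔ Ideal.span {u} • M := by
    intro b hb
    by_cases hbig : ((d + n : ℕ) : ℕ∞) ≤ addVal B b
    · have h1 : addVal B (algebraMap (PS K) B u) ≤ addVal B b := by
        have : addVal B (algebraMap (PS K) B u) = n := hu
        rw [this]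
        exact le_trans (by exact_mod_cast Nat.le_add_left n d) hbig
      obtain ⟨b', rfl⟩ := addVal_le_iff_dvd.mp h1
      refine Submodule.mem_sup_right ?_
      rw [← Algebra.smul_def]
      refine Submodule.smul_mem_smul (Ideal.mem_span_singleton_self u) ?_
      have h2 : addVal B (algebraMap (PS K) B u) = n := hu
      rw [addVal_mul, h2, Nat.cast_add, add_comm] at hbig
      exact (ENat.add_le_add_iff_left (ENat.natCast_ne_top n)).mp hbig
    · rw [not_le] at hbig
      obtain ⟨m, hm⟩ := ENat.ne_top_iff_exists.mp hbig.ne_top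
      obtain ⟨e, he⟩ : ∃ e, d + n - m = e := ⟨_, rfl⟩
      induction e using Nat.strong_induction_on generalizing b m with
      | _ e ih =>
        have hdm : d ≤ m := by
          have : (d : ℕ∞) ≤ addVal B b := hb
          rw [← hm] at this
          exact_mod_cast this
        have hmd : m < d + n := by
          rw [← hm] at hbig
          exact_mod_cast hbig
        let j : Fin n := ⟨m % n, Nat.mod_lt _ hn⟩
        have hj : (d + (n - 1 - j)) / n * n + j = m := by
          have h1 : (d + (n - 1 - j)) / n = m / n := by
            have h2 : (j : ℕ) = m % n := rfl
            have h3 := Nat.div_add_mod m n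
            have h4 := Nat.mod_lt m hn
            rw [h2]
            refine Nat.div_eq_of_lt_le ?_ ?_
            · rw [mul_comm]
              omega
            · rw [Nat.succ_mul, mul_comm]
              omega
          rw [h1, mul_comm]
          exact Nat.div_add_mod m n
        obtain ⟨c, hc⟩ := hB.exists_lt_addVal_sub (a := b) (b := g j)
          (by rw [hg, hj, hm]) (by rw [← hm]; exact ENat.natCast_ne_top m)
        have hgj : algebraMap (PS K) B (C c) * g j ∈ Submodule.span (PS K) (Set.range g) := by
          rw [← Algebra.smul_def]
          exact Submodule.smul_mem _ _ (Submodule.subset_span ⟨j, rfl⟩)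
        have hM' : b - algebraMap (PS K) B (C c) * g j ∈ M := le_trans hb hc.le
        have hmem : b - algebraMap (PS K) B (C c) * g j ∈
            Submodule.span (PS K) (Set.range g) ⊔ Ideal.span {u} • M := by
          by_cases hbig' : ((d + n : ℕ) : ℕ∞) ≤
              addVal B (b - algebraMap (PS K) B (C c) * g j)
          · have h1 : addVal B (algebraMap (PS K) B u) ≤
                addVal B (b - algebraMap (PS K) B (C c) * g j) := by
              have : addVal B (algebraMap (PS K) B u) = n := hu
              rw [this]
              exact le_trans (by exact_mod_cast Nat.le_add_left n d) hbig'
            obtain ⟨b', hb'⟩ := addVal_le_iff_dvd.mp h1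
            refine Submodule.mem_sup_right ?_
            rw [hb'] at hbig' ⊢
            rw [← Algebra.smul_def]
            refine Submodule.smul_mem_smul (Ideal.mem_span_singleton_self u) ?_
            have h2 : addVal B (algebraMap (PS K) B u) = n := hu
            rw [addVal_mul, h2, Nat.cast_add, add_comm] at hbig'
            exact (ENat.add_le_add_iff_left (ENat.natCast_ne_top n)).mp hbig'
          · rw [not_le] at hbig'
            obtain ⟨m', hm'⟩ := ENat.ne_top_iff_exists.mp hbig'.ne_top
            have hmm : m < m' := by
              rw [← hm, ← hm'] at hc
              exact_mod_cast hc
            exact ih (d + n - m') (by omega) hM' hbig' m' hm' rfl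
        have := add_mem hmem (Submodule.mem_sup_left hgj)
        simpa using this
  have hn0 : (n : ℕ∞) ≠ 0 := by
    exact_mod_cast (by omega : n ≠ 0)
  have hum : Ideal.span {u} ≤ IsLocalRing.maximalIdeal (PS K) := by
    rw [Ideal.span_singleton_le_iff_mem]
    intro hunit
    rw [← hB.val_eq_zero_iff, hu] at hunit
    exact hn0 hunit
  have hMN := Submodule.le_of_le_smul_of_le_jacobson_bot (IsNoetherian.noetherian M)
    (hum.trans (IsLocalRing.maximalIdeal_le_jacobson _)) hle
  obtain ⟨r, hr⟩ := (Submodule.mem_span_range_iff_exists_fun (PS K)).mp (hMN hb)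
  refine ⟨r, ?_⟩
  rw [← hr]
  refine Finset.sum_congr rfl fun j _ => ?_
  rw [Algebra.smul_def, map_mul, mul_assoc]

/-- The Newton polygon of an irreducible power series has a single edge. -/
theorem min_le_val (hp : Irreducible p) {u w : PS K}
    (huw : IsLocalRing.maximalIdeal (PS K) = Ideal.span {u, w}) {n a : ℕ} (hn : 1 ≤ n)
    (hu : val B u = n) (hw : val B w = a) (hna : n ≤ a) {B' : Type*} [CommRing B'] [IsDomain B']
    [IsDiscreteValuationRing B'] [Algebra (PS K) B'] {n' : ℕ} (hu' : val B' u = n') :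
    min ((a * n' : ℕ) : ℕ∞) (n * val B' w) ≤ val B' p := by
  obtain ⟨t, ht⟩ := exists_irreducible B
  have hrow : ∀ i : Fin n, ∃ r : Fin n → PS K, algebraMap (PS K) B w * t ^ (i : ℕ) =
      ∑ j : Fin n, algebraMap (PS K) B (r j * u ^ ((a + i + (n - 1 - j)) / n)) * t ^ (j : ℕ) := by
    intro i
    refine hB.exists_sum_pow_of_le_addVal hn hu ht ?_
    have : addVal B (algebraMap (PS K) B w) = a := hw
    rw [addVal_mul, this, ht.addVal_pow]
    norm_cast
  choose r hr using hrow
  -- Multiplication by `w` on `B` is written in the generators `1, t, …, t ^ (n - 1)` by the matrix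
  -- `T`. The entry `(i, j)` is divisible by `u` to the power `(a + i - j) / n` rounded up.
  let e : Fin n → Fin n → ℕ := fun i j => (a + i + (n - 1 - j)) / n
  let T : Matrix (Fin n) (Fin n) (PS K) := Matrix.of fun i j => r i j * u ^ e i j
  let N : Matrix (Fin n) (Fin n) (PS K) := Matrix.scalar (Fin n) w - T
  have hN : ∀ i j, N i j = (if i = j then w else 0) - r i j * u ^ e i j := by
    intro i j
    simp [N, T, Matrix.diagonal_apply]
  have he : ∀ i j : Fin n, a + i ≤ n * e i j + j := by
    intro i j
    have h1 := Nat.div_add_mod (a + i + (n - 1 - j)) n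
    have h2 := Nat.mod_lt (a + i + (n - 1 - j)) hn
    have h3 := j.2
    change a + i ≤ n * ((a + i + (n - 1 - j)) / n) + j
    omega
  have he1 : ∀ i j : Fin n, 1 ≤ e i j := by
    intro i j
    by_contra h0
    have h1 := he i j
    have h3 := j.2
    rw [Nat.lt_one_iff.mp (not_le.mp h0)] at h1
    omega
  -- The vector of powers of `t` lies in the kernel of `w - T` over `B`, so `p` divides the
  -- determinant.
  have hdet0 : algebraMap (PS K) B N.det = 0 := by
    rw [RingHom.map_det, ← Matrix.exists_mulVec_eq_zero_iff]
    refine ⟨fun j => t ^ (j : ℕ), ?_, ?_⟩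
    · intro h
      have := congrFun h ⟨0, hn⟩
      simp at this
    · ext i
      simp only [Matrix.mulVec, dotProduct, RingHom.mapMatrix_apply, Matrix.map_apply, hN, map_sub,
        sub_mul, Finset.sum_sub_distrib, Pi.zero_apply]
      rw [← hr i, Finset.sum_eq_single i]
      · simp
      · intro j _ hj
        simp [Ne.symm hj]
      · simp
  obtain ⟨h, hh⟩ := (hB.algebraMap_eq_zero_iff _).mp hdet0
  have hmodu : ∃ c, N.det = w ^ n + u * c := by
    have h1 : Ideal.Quotient.mk (Ideal.span {u}) N.det =
        Ideal.Quotient.mk (Ideal.span {u}) (w ^ n) := by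
      rw [RingHom.map_det]
      have : (Ideal.Quotient.mk (Ideal.span {u})).mapMatrix N =
          Matrix.scalar (Fin n) (Ideal.Quotient.mk (Ideal.span {u}) w) := by
        ext i j
        rw [RingHom.mapMatrix_apply, Matrix.map_apply, hN, map_sub]
        have h2 : Ideal.Quotient.mk (Ideal.span {u}) (r i j * u ^ e i j) = 0 := by
          rw [Ideal.Quotient.eq_zero_iff_mem, Ideal.mem_span_singleton]
          exact Dvd.dvd.mul_left (dvd_pow_self u (by have := he1 i j; omega)) _
        rw [h2, sub_zero]
        by_cases hij : i = j
        · simp [hij]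
        · simp [hij]
      rw [this, Matrix.scalar_apply, Matrix.det_diagonal, Finset.prod_const, Finset.card_univ,
        Fintype.card_fin, map_pow]
    rw [Ideal.Quotient.eq, Ideal.mem_span_singleton] at h1
    obtain ⟨c, hc⟩ := h1
    exact ⟨c, by rw [← hc]; ring⟩
  obtain ⟨c, hc⟩ := hmodu
  -- The determinant is `w ^ n` modulo `u`. If the cofactor `h` were a non-unit, cancelling `w`
  -- modulo `u` would put `w ^ (n - 1)` into `(u, p)`, against `(u, p)₀ = n`. Thus `p` is the
  -- determinant up to a unit.
  have hunit : IsUnit h := by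
    by_contra hnu
    have hm : h ∈ IsLocalRing.maximalIdeal (PS K) := hnu
    rw [huw, Ideal.mem_span_pair] at hm
    obtain ⟨α, β, hαβ⟩ := hm
    have hu1 := irreducible_of_mult_eq_one (mult_eq_one_of_maximalIdeal_eq huw)
    have hwu : ¬ u ∣ w := by
      rw [← Ideal.mem_span_singleton]
      exact span_ne_of_maximalIdeal_eq huw
    have hdvd : u ∣ w * (w ^ (n - 1) - p * β) := by
      refine ⟨p * α - c, ?_⟩
      have h1 : w * w ^ (n - 1) = w ^ n := by rw [← pow_succ', Nat.sub_add_cancel hn]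
      rw [mul_sub, h1]
      rw [hc, ← hαβ] at hh
      linear_combination hh
    obtain ⟨d, hd⟩ := (hu1.prime.dvd_or_dvd hdvd).resolve_left hwu
    have := hB.le_of_pow_mem hp huw hu (j := n - 1) (by
      rw [Ideal.mem_span_pair]
      exact ⟨d, β, by linear_combination -hd⟩)
    omega
  have hval : val B' p = val B' N.det := by
    rw [hh, mul_comm, val_unit_mul hunit]
  rw [hval]
  set D : ℕ∞ := min ((a * n' : ℕ) : ℕ∞) (n * val B' w) with hD
  -- The weights `n' i` and `n' j` absorb the index shifts in the exponents of `u`, so that they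
  -- cancel in the sum over a permutation.
  have hentry : ∀ i j : Fin n, D + (n' * i : ℕ) ≤ n * val B' (N i j) + (n' * j : ℕ) := by
    intro i j
    have h1 : ((n' * e i j : ℕ) : ℕ∞) ≤ val B' (-(r i j * u ^ e i j)) := by
      have h2 : -(r i j * u ^ e i j) = -r i j * u ^ e i j := by ring
      rw [h2, val_mul, val_pow, hu', mul_comm n', Nat.cast_mul]
      exact le_add_self
    have h3 : D + (n' * i : ℕ) ≤ n * ((n' * e i j : ℕ) : ℕ∞) + (n' * j : ℕ) := by
      have h4 : a * n' + n' * i ≤ n * (n' * e i j) + n' * j := by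
        have := Nat.mul_le_mul_left n' (he i j)
        linarith
      refine (add_le_add_left (min_le_left _ _) _).trans ?_
      exact_mod_cast h4
    by_cases hij : i = j
    · subst hij
      rw [hN, if_pos rfl, sub_eq_add_neg]
      refine add_le_add_left ?_ _
      have h5 : D ≤ n * ((n' * e i i : ℕ) : ℕ∞) :=
        (ENat.add_le_add_iff_right (ENat.natCast_ne_top _)).mp h3
      have h6 : min ((n' * e i i : ℕ) : ℕ∞) (val B' w) ≤ val B' (w + -(r i i * u ^ e i i)) :=
        le_val_add (min_le_right _ _) ((min_le_left _ _).trans h1)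
      refine le_trans ?_ (mul_le_mul_right h6 _)
      rcases min_choice ((n' * e i i : ℕ) : ℕ∞) (val B' w) with h7 | h7 <;> rw [h7]
      · exact h5
      · exact min_le_right _ _
    · rw [hN, if_neg hij, zero_sub]
      exact h3.trans (add_le_add_left (mul_le_mul_right h1 _) _)
  have hprod : ∀ σ : Equiv.Perm (Fin n), D ≤ val B' (∏ i, N (σ i) i) := by
    intro σ
    have hsum : val B' (∏ i, N (σ i) i) = ∑ i, val B' (N (σ i) i) := by
      have : ∀ s : Finset (Fin n), val B' (∏ i ∈ s, N (σ i) i) = ∑ i ∈ s, val B' (N (σ i) i) := by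
        intro s
        induction s using Finset.induction_on with
        | empty => simp [val]
        | insert i s hi ih => rw [Finset.prod_insert hi, Finset.sum_insert hi, val_mul, ih]
      exact this _
    have h1 := Finset.sum_le_sum (s := Finset.univ) fun i _ => hentry (σ i) i
    rw [Finset.sum_add_distrib, Finset.sum_add_distrib, ← Finset.mul_sum, ← hsum,
      Finset.sum_const, Finset.card_univ, Fintype.card_fin,
      Equiv.sum_comp σ (fun i : Fin n => ((n' * i : ℕ) : ℕ∞)), nsmul_eq_mul, ← Nat.cast_sum] at h1
    have h2 := (ENat.add_le_add_iff_right (ENat.natCast_ne_top _)).mp h1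
    by_contra hlt
    rw [not_le] at hlt
    exact absurd h2 (not_le.mpr
      (lt_of_not_ge fun h => absurd hlt (not_lt.mpr ((ENat.mul_le_mul_left_iff
        (by exact_mod_cast (by omega : n ≠ 0)) (ENat.natCast_ne_top n)).mp h))))
  rw [Matrix.det_apply]
  refine Finset.sum_induction _ (fun x => D ≤ val B' x) (fun x y => le_val_add) (by simp [val]) ?_
  intro σ _
  rw [Units.smul_def, zsmul_eq_mul, val_mul]
  exact le_add_left (hprod σ)

end IsBranchRing

theorem mult_pos_of_irreducible {p : PS K} (hp : Irreducible p) : 0 < mult p :=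
  Nat.pos_of_ne_zero fun h => hp.not_isUnit ((mult_eq_zero_iff hp.ne_zero).mp h)

/-- A line transversal to `p`, `q` and `w` at once completes `w` to a system of parameters.
`IsBranchRing.min_le_val`, divided by `mult p * mult q`, is then the claim. Only the value of `w`
along `p` must be finite. -/
theorem min_branchContact_le_of_not_dvd [IsAlgClosed K] {p q w : PS K} (hp : Irreducible p)
    (hq : Irreducible q) (hw : mult w = 1) (hpw : ¬ p ∣ w) :
    min (branchContact p w) (branchContact q w) ≤ branchContact p q := by
  have : Infinite K := IsAlgClosed.instInfinite
  obtain ⟨_, _, hB⟩ := isBranchRing_normalization hp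
  obtain ⟨_, _, hB'⟩ := isBranchRing_normalization hq
  have hw0 : w ≠ 0 := ne_zero_of_mult_pos (by omega)
  obtain ⟨c, hc⟩ := exists_line_of_finite {p, q, w} (by simp) (by
    rintro g (rfl | rfl | rfl)
    exacts [hp.ne_zero, hq.ne_zero, hw0])
  have huw := maximalIdeal_eq_of_interNum_eq_one
    ((hc w (by simp)).trans (by rw [hw, Nat.cast_one]))
  have hu := hc p (by simp)
  have hu' := hc q (by simp)
  rw [interNum_comm, hB.interNum_eq_val hp] at hu
  rw [interNum_comm, hB'.interNum_eq_val hq] at hu'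
  obtain ⟨a, ha⟩ := ENat.ne_top_iff_exists.mp (mt hB.val_eq_top_iff.mp hpw)
  have hwm : w ∈ IsLocalRing.maximalIdeal (PS K) := by
    rw [huw]
    exact Ideal.subset_span (by simp)
  have hna := hB.mult_le_val hp hwm
  rw [← ha] at hna
  have hmin := hB.min_le_val hp huw (mult_pos_of_irreducible hp) hu ha.symm (by exact_mod_cast hna)
    hu'
  rw [← hB'.interNum_eq_val hq, ← hB'.interNum_eq_val hq, interNum_comm q p] at hmin
  have hn : (mult p : ℝ≥0∞) ≠ 0 := by exact_mod_cast (mult_pos_of_irreducible hp).ne'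
  have hn' : (mult q : ℝ≥0∞) ≠ 0 := by exact_mod_cast (mult_pos_of_irreducible hq).ne'
  have key : ∀ {x y z : ℝ≥0∞}, x ≠ 0 → x ≠ ⊤ → y / x * (x * z) = y * z := fun {x y z} h0 h1 => by
    rw [← mul_assoc, ENNReal.div_mul_cancel h0 h1]
  rw [branchContact_comm q w, branchContact, branchContact, branchContact, hw, Nat.cast_one,
    mul_one, one_mul, hB.interNum_eq_val hp w, ← ha, interNum_comm w q,
    ENNReal.le_div_iff_mul_le (Or.inl (mul_ne_zero hn hn')) (Or.inl (ENNReal.mul_ne_top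
      (ENNReal.natCast_ne_top _) (ENNReal.natCast_ne_top _)))]
  rcases min_le_iff.mp hmin with h | h
  · refine (mul_le_mul_left (min_le_left _ _) _).trans ?_
    rw [key hn (ENNReal.natCast_ne_top _)]
    have h1 := ENat.toENNReal_le.mpr h
    rwa [ENat.toENNReal_coe, Nat.cast_mul] at h1
  · refine (mul_le_mul_left (min_le_right _ _) _).trans ?_
    rw [mul_comm (mult p : ℝ≥0∞), key hn' (ENNReal.natCast_ne_top _), mul_comm]
    have h1 := ENat.toENNReal_le.mpr h
    rwa [ENat.toENNReal_mul, ENat.toENNReal_coe] at h1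

theorem min_branchContact_le [IsAlgClosed K] {p q w : PS K} (hp : Irreducible p)
    (hq : Irreducible q) (hw : mult w = 1) :
    min (branchContact p w) (branchContact q w) ≤ branchContact p q := by
  have hw' := irreducible_of_mult_eq_one hw
  by_cases hpw : p ∣ w
  -- If `w` is divisible by both branches, then `q` is `w` up to a unit and `d(p, w)` is `d(p, q)`.
  · by_cases hqw : q ∣ w
    · have h1 := (hw'.dvd_iff.mp hqw).resolve_left hq.not_isUnit
      rw [branchContact_congr (Associated.refl p) h1]
      exact min_le_left _ _
    · rw [min_comm, branchContact_comm p q]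
      exact min_branchContact_le_of_not_dvd hq hp hw hqw
  · exact min_branchContact_le_of_not_dvd hp hq hw hpw

theorem contactExp_le_branchContact [IsAlgClosed K] {f p q : PS K} (hp : IsBranchOf p f)
    (hq : IsBranchOf q f) : contactExp f ≤ branchContact p q :=
  iSup₂_le fun _ hw => (le_min (contact_le_branchContact hp hw.1)
    (contact_le_branchContact hq hw.1)).trans (min_branchContact_le hp.1 hq.1 hw.2)

theorem contactExp_le_of_isBranchOf {f p : PS K} (hp : IsBranchOf p f) :
    contactExp f ≤ contactExp p :=
  iSup₂_mono fun _ hw => (contact_le_branchContact hp hw.1).trans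
    (contact_eq_branchContact hp.1 hw.1).ge

end PlaneCurve

/-! ### The normalization of a reduced curve -/

/-- The elements `q i` vanish in all components but the `i`-th. They show that a regular element is
non-zero in every component, and they glue component fractions `a i / b i` into the single fraction
`∑ a i q i / ∑ b i q i`. -/
theorem isFractionRing_pi {A ι : Type*} [CommRing A] [Fintype ι] {L : ι → Type*}
    [∀ i, Field (L i)] [∀ i, Algebra A (L i)]
    (hinj : ∀ a : A, (∀ i, algebraMap A (L i) a = 0) → a = 0)
    (hfrac : ∀ i, ∀ x : L i, ∃ a b : A, algebraMap A (L i) b ≠ 0 ∧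
      x * algebraMap A (L i) b = algebraMap A (L i) a)
    {q : ι → A} (hq : ∀ i j, algebraMap A (L j) (q i) = 0 ↔ i ≠ j) :
    IsFractionRing A (∀ i, L i) := by
  have hunit : ∀ a : A, IsUnit (algebraMap A (∀ i, L i) a) ↔ ∀ i, algebraMap A (L i) a ≠ 0 := by
    intro a
    rw [Pi.isUnit_iff]
    exact forall_congr' fun i => isUnit_iff_ne_zero
  have hreg : ∀ a : A, (∀ i, algebraMap A (L i) a ≠ 0) → a ∈ nonZeroDivisors A := by
    intro a ha
    rw [mem_nonZeroDivisors_iff_right]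
    intro b hb
    refine hinj b fun i => ?_
    have h1 := congrArg (algebraMap A (L i)) hb
    rw [map_mul, map_zero] at h1
    exact (mul_eq_zero.mp h1).resolve_right (ha i)
  refine ⟨?_, ?_, ?_⟩
  · rintro ⟨a, ha⟩
    refine (hunit a).mpr fun i h0 => ?_
    have h1 : q i * a = 0 := by
      refine hinj _ fun j => ?_
      rw [map_mul]
      by_cases hij : i = j
      · subst hij
        rw [h0, mul_zero]
      · rw [(hq i j).mpr hij, zero_mul]
    have h2 := (mem_nonZeroDivisors_iff_right.mp ha) _ h1
    have h3 := (hq i i).not.mpr (not_not.mpr rfl)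
    rw [h2, map_zero] at h3
    exact h3 rfl
  · intro x
    choose a b hb hab using fun i => hfrac i (x i)
    have hsum : ∀ (c : ι → A) (j : ι), algebraMap A (L j) (∑ i, c i * q i) =
        algebraMap A (L j) (c j) * algebraMap A (L j) (q j) := by
      intro c j
      rw [map_sum, Finset.sum_eq_single j]
      · rw [map_mul]
      · intro i _ hij
        rw [map_mul, (hq i j).mpr hij, mul_zero]
      · exact fun h => absurd (Finset.mem_univ j) h
    refine ⟨⟨∑ i, a i * q i, ⟨∑ i, b i * q i, hreg _ fun j => ?_⟩⟩, ?_⟩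
    · rw [hsum]
      exact mul_ne_zero (hb j) ((hq j j).not.mpr (not_not.mpr rfl))
    · ext j
      change x j * algebraMap A (L j) (∑ i, b i * q i) = algebraMap A (L j) (∑ i, a i * q i)
      rw [hsum, hsum, ← mul_assoc, hab]
  · intro a b hab
    refine ⟨1, ?_⟩
    rw [OneMemClass.coe_one, one_mul, one_mul, ← sub_eq_zero]
    refine hinj _ fun i => ?_
    rw [map_sub, sub_eq_zero]
    exact congrFun hab i

/-- The product of the monic equations of the components annihilates `x`. -/
theorem IsIntegral.pi_of_forall {R ι : Type*} [CommRing R] [Fintype ι] {L : ι → Type*}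
    [∀ i, CommRing (L i)] [∀ i, Algebra R (L i)] {x : ∀ i, L i} (hx : ∀ i, IsIntegral R (x i)) :
    IsIntegral R x := by
  choose P hP hPx using hx
  refine ⟨∏ i, P i, Polynomial.monic_prod_of_monic _ _ fun i _ => hP i, ?_⟩
  rw [← Polynomial.aeval_def]
  ext i
  have h1 := Polynomial.aeval_algHom_apply (Pi.evalAlgHom R L i) x (∏ i, P i)
  change _ = Polynomial.aeval x (∏ i, P i) i at h1
  rw [← h1, map_prod]
  refine Finset.prod_eq_zero (Finset.mem_univ i) ?_
  rw [Polynomial.aeval_def]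
  exact hPx i

theorem isIntegral_iff_of_surjective {R A S : Type*} [CommRing R] [CommRing A] [CommRing S]
    [Algebra R A] [Algebra A S] [Algebra R S] [IsScalarTower R A S]
    (h : Function.Surjective (algebraMap R A)) {x : S} : IsIntegral R x ↔ IsIntegral A x := by
  refine ⟨IsIntegral.tower_top, fun hx => ?_⟩
  have : Algebra.IsIntegral R A := ⟨fun a => by
    obtain ⟨r, rfl⟩ := h a
    exact isIntegral_algebraMap⟩
  exact isIntegral_trans x hx

namespace PlaneCurve

open IsLocalRing MvPowerSeries IsDiscreteValuationRing

variable {K : Type*} [Field K]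

section Product

variable {ι : Type*} [Fintype ι] [DecidableEq ι] {p : ι → PS K} (hp : ∀ i, Irreducible (p i))
  (hne : Pairwise fun i j => ¬ p i ∣ p j)
include hp hne

theorem dvd_prod_erase_iff {i j : ι} : p j ∣ ∏ k ∈ Finset.univ.erase i, p k ↔ i ≠ j := by
  rw [(hp j).prime.dvd_finsetProd_iff]
  constructor
  · rintro ⟨k, hk, hjk⟩ rfl
    exact hne (Finset.ne_of_mem_erase hk).symm hjk
  · intro hij
    exact ⟨j, Finset.mem_erase.mpr ⟨hij.symm, Finset.mem_univ j⟩, dvd_rfl⟩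

theorem prod_dvd_of_forall_dvd {s : Finset ι} {g : PS K} (h : ∀ i ∈ s, p i ∣ g) :
    ∏ i ∈ s, p i ∣ g :=
  Finset.prod_dvd_of_isRelPrime
    (fun _ _ _ _ hij => (hp _).isRelPrime_iff_not_dvd.mpr (hne hij)) h

/-- The total ring of fractions of the curve is the product of the fraction fields of its branches.
Integrality may be tested over `K[[x,y]]`, and there it is componentwise. -/
theorem nonempty_normalization_algEquiv_pi {f : PS K} (hf : Associated f (∏ i, p i)) :
    Nonempty (Normalization f ≃ₐ[PS K] ∀ i, Normalization (p i)) := by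
  have hfp : ∀ i, p i ∣ f := fun i => (Finset.dvd_prod_of_mem p (Finset.mem_univ i)).trans hf.symm.dvd
  have hdom : ∀ i, IsDomain (LocRing (p i)) := fun i => isDomain_locRing (hp i)
  let L : ι → Type _ := fun i => FractionRing (LocRing (p i))
  let hfield : ∀ i, Field (L i) := fun i => inferInstanceAs (Field (FractionRing (LocRing (p i))))
  let halgK : ∀ i, Algebra (PS K) (L i) := fun i =>
    inferInstanceAs (Algebra (PS K) (FractionRing (LocRing (p i))))
  let halg : ∀ i, Algebra (LocRing f) (L i) := fun i =>
    ((algebraMap (LocRing (p i)) (FractionRing (LocRing (p i)))).comp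
      (Ideal.Quotient.factor (Ideal.span_singleton_le_span_singleton.mpr (hfp i)))).toAlgebra
  have hmk : ∀ i (g : PS K), algebraMap (LocRing f) (L i) (Ideal.Quotient.mk _ g) =
      algebraMap (LocRing (p i)) (FractionRing (LocRing (p i))) (Ideal.Quotient.mk _ g) :=
    fun _ _ => rfl
  have htow : ∀ i, IsScalarTower (PS K) (LocRing f) (L i) := fun i =>
    @IsScalarTower.of_algebraMap_eq (PS K) (LocRing f) (L i) _ _ _ _ _ (halgK i) fun g => rfl
  have hzero : ∀ i (g : PS K), algebraMap (LocRing f) (L i) (Ideal.Quotient.mk _ g) = 0 ↔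
      p i ∣ g := by
    intro i g
    rw [hmk, FaithfulSMul.algebraMap_eq_zero_iff, Ideal.Quotient.eq_zero_iff_mem,
      Ideal.mem_span_singleton]
  have hfr : IsFractionRing (LocRing f) (∀ i, L i) := by
    refine isFractionRing_pi (q := fun i => Ideal.Quotient.mk _ (∏ k ∈ Finset.univ.erase i, p k))
      ?_ ?_ ?_
    · intro a ha
      obtain ⟨g, rfl⟩ := Ideal.Quotient.mk_surjective a
      rw [Ideal.Quotient.eq_zero_iff_mem, Ideal.mem_span_singleton]
      exact hf.dvd.trans (prod_dvd_of_forall_dvd hp hne fun i _ => (hzero i g).mp (ha i))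
    · intro i x
      obtain ⟨⟨a, b⟩, hab⟩ := IsLocalization.surj (nonZeroDivisors (LocRing (p i))) (S := FractionRing (LocRing (p i))) x
      obtain ⟨a, rfl⟩ := Ideal.Quotient.mk_surjective a
      obtain ⟨b, hb⟩ := b
      obtain ⟨b, rfl⟩ := Ideal.Quotient.mk_surjective b
      refine ⟨Ideal.Quotient.mk _ a, Ideal.Quotient.mk _ b, ?_, hab⟩
      rw [hmk, Ne, FaithfulSMul.algebraMap_eq_zero_iff]
      exact nonZeroDivisors.ne_zero hb
    · intro i j
      rw [hzero, dvd_prod_erase_iff hp hne]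
  let e : FractionRing (LocRing f) ≃ₐ[LocRing f] (∀ i, L i) := FractionRing.algEquiv _ _
  have hint : ∀ x : FractionRing (LocRing f),
      IsIntegral (LocRing f) x ↔ ∀ i, IsIntegral (LocRing (p i)) (e x i : FractionRing (LocRing (p i))) := by
    intro x
    have hsurj : ∀ g : PS K, Function.Surjective (algebraMap (PS K) (LocRing g)) := fun g =>
      Ideal.Quotient.mk_surjective
    have h1 : ∀ i, IsIntegral (LocRing (p i)) (e x i : FractionRing (LocRing (p i))) ↔
        IsIntegral (PS K) (e x i) := fun i => (isIntegral_iff_of_surjective (hsurj (p i))).symm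
    rw [← isIntegral_algEquiv e]
    simp only [h1]
    rw [← isIntegral_iff_of_surjective (hsurj f)]
    exact ⟨fun h i => h.map (Pi.evalAlgHom (PS K) L i), IsIntegral.pi_of_forall⟩
  let φ : Normalization f →ₐ[PS K] ∀ i, Normalization (p i) :=
    { toFun := fun x i => ⟨e x i, (hint x).mp x.2 i⟩
      map_one' := by
        ext i
        exact congrFun (map_one e) i
      map_mul' := fun x y => by
        ext i
        exact congrFun (map_mul e x.1 y.1) i
      map_zero' := by
        ext i
        exact congrFun (map_zero e) i
      map_add' := fun x y => by
        ext i
        exact congrFun (map_add e x.1 y.1) i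
      commutes' := fun g => by
        ext i
        exact congrFun (e.commutes (Ideal.Quotient.mk _ g)) i }
  refine ⟨AlgEquiv.ofBijective φ ⟨fun x y hxy => ?_, fun y => ?_⟩⟩
  · refine Subtype.ext (e.injective ?_)
    funext i
    exact congrArg Subtype.val (congrFun hxy i)
  · let z : ∀ i, L i := fun i => (y i : FractionRing (LocRing (p i)))
    have hz : ∀ i, e (e.symm z) i = z i := fun i => congrFun (e.apply_symm_apply z) i
    refine ⟨⟨e.symm z, (hint _).mpr fun i => ?_⟩, ?_⟩
    · rw [hz]
      exact (y i).2
    · funext i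
      exact Subtype.ext (hz i)

end Product

end PlaneCurve

/-! ### The conductor of a reduced curve -/

namespace PlaneCurve

open IsLocalRing MvPowerSeries IsDiscreteValuationRing

variable {K : Type*} [Field K]

/-- The elements whose multiples all lie in `q` times the local ring of the branch form `q` times
the conductor. -/
theorem IsBranchRing.condExp_add_val_le_iff {p : PS K} {B : Type*} [CommRing B] [IsDomain B]
    [IsDiscreteValuationRing B] [Algebra (PS K) B] (hB : IsBranchRing p B) {q : PS K}
    (hq : ¬ p ∣ q) {x : B} :
    condExp K B + val B q ≤ addVal B x ↔
      ∀ b, ∃ g : PS K, x * b = algebraMap (PS K) B q * algebraMap (PS K) B g := by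
  have hq0 : algebraMap (PS K) B q ≠ 0 := mt (hB.algebraMap_eq_zero_iff q).mp hq
  have hqtop : addVal B (algebraMap (PS K) B q) ≠ ⊤ := mt addVal_eq_top_iff.mp hq0
  constructor
  · intro h b
    obtain ⟨z, rfl⟩ := addVal_le_iff_dvd.mp (le_add_self.trans h)
    rw [addVal_mul, val, add_comm, ENat.add_le_add_iff_left hqtop] at h
    obtain ⟨g, hg⟩ := hB.mem_range_of_condExp_le (b := z * b)
      (h.trans (by rw [addVal_mul]; exact le_self_add))
    exact ⟨g, by rw [hg, mul_assoc]⟩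
  · intro h
    obtain ⟨g, hg⟩ := h 1
    rw [mul_one] at hg
    subst hg
    set z := algebraMap (PS K) B g with hz
    by_cases hz0 : z = 0
    · rw [hz0, mul_zero, addVal_zero]
      exact le_top
    · obtain ⟨m, hm⟩ := ENat.ne_top_iff_exists.mp (mt addVal_eq_top_iff.mp hz0)
      have hle : condExp K B ≤ m := Nat.sInf_le fun b hb => by
        rw [hm, addVal_le_iff_dvd] at hb
        obtain ⟨b', rfl⟩ := hb
        obtain ⟨g', hg'⟩ := h b'
        rw [mul_assoc] at hg'
        exact ⟨g', (mul_left_cancel₀ hq0 hg').symm⟩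
      rw [addVal_mul, val, add_comm, ← hm]
      gcongr

section Product

variable {ι : Type*} [Fintype ι] [DecidableEq ι] {p : ι → PS K} (hp : ∀ i, Irreducible (p i))
  (hne : Pairwise fun i j => ¬ p i ∣ p j)
  {B : ι → Type*} [∀ i, CommRing (B i)] [∀ i, IsDomain (B i)]
  [∀ i, IsDiscreteValuationRing (B i)] [∀ i, Algebra (PS K) (B i)]
  (hB : ∀ i, IsBranchRing (p i) (B i))
include hp hne hB

/-- A function on the curve vanishing on every branch but the `i`-th is divisible by the product of
the other equations. Testing on vectors supported in one component therefore turns the conductor of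
the curve into a product of branch conductors, each shifted by the value of that product. -/
theorem forall_mul_mem_range_iff (x : ∀ i, B i) :
    (∀ y, x * y ∈ (algebraMap (PS K) (∀ i, B i)).range) ↔
      ∀ i, condExp K (B i) + val (B i) (∏ k ∈ Finset.univ.erase i, p k) ≤ addVal (B i) (x i) := by
  have hdvd : ∀ i, ¬ p i ∣ ∏ k ∈ Finset.univ.erase i, p k := fun i h =>
    (dvd_prod_erase_iff hp hne).mp h rfl
  constructor
  · intro h i
    rw [(hB i).condExp_add_val_le_iff (hdvd i)]
    intro b
    obtain ⟨g, hg⟩ := h (Pi.single i b)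
    obtain ⟨g', rfl⟩ : ∏ k ∈ Finset.univ.erase i, p k ∣ g := by
      refine prod_dvd_of_forall_dvd hp hne fun j hj => ?_
      rw [← (hB j).algebraMap_eq_zero_iff]
      refine (congrFun hg j).trans ?_
      rw [Pi.mul_apply, Pi.single_eq_of_ne (Finset.ne_of_mem_erase hj), mul_zero]
    refine ⟨g', ?_⟩
    have h1 := congrFun hg i
    rw [Pi.mul_apply, Pi.single_eq_same] at h1
    rw [← h1, ← map_mul]
    rfl
  · intro h y
    choose g hg using fun i => ((hB i).condExp_add_val_le_iff (hdvd i)).mp (h i) (y i)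
    refine ⟨∑ i, (∏ k ∈ Finset.univ.erase i, p k) * g i, ?_⟩
    ext j
    rw [Pi.mul_apply, hg j]
    change algebraMap (PS K) (B j) _ = _
    rw [map_sum, Finset.sum_eq_single j]
    · rw [map_mul]
    · intro i _ hij
      rw [map_mul, ((hB j).algebraMap_eq_zero_iff _).mpr ((dvd_prod_erase_iff hp hne).mpr hij),
        zero_mul]
    · exact fun h => absurd (Finset.mem_univ j) h

theorem length_quotient_conductorIdeal {A D : Type*} [CommRing A] [CommRing D] [Algebra A D]
    [Algebra (PS K) A] [Algebra (PS K) D] [IsScalarTower (PS K) A D]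
    (hA : Function.Surjective (algebraMap (PS K) A)) (e : D ≃ₐ[PS K] ∀ i, B i) :
    Module.length (PS K) (D ⧸ conductorIdeal A D) =
      ∑ i, (condExp K (B i) + val (B i) (∏ k ∈ Finset.univ.erase i, p k)) := by
  choose t ht using fun i => exists_irreducible (B i)
  let b : ∀ i, B i := fun i =>
    t i ^ condExp K (B i) * algebraMap (PS K) (B i) (∏ k ∈ Finset.univ.erase i, p k)
  have hb : ∀ i, addVal (B i) (b i) =
      condExp K (B i) + val (B i) (∏ k ∈ Finset.univ.erase i, p k) := fun i => by
    rw [addVal_mul, (ht i).addVal_pow, val]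
  let φ : D →ₐ[PS K] ∀ i, B i ⧸ Ideal.span {b i} :=
    AlgHom.pi fun i => (Ideal.Quotient.mkₐ (PS K) (Ideal.span {b i})).comp
      ((Pi.evalAlgHom (PS K) B i).comp e.toAlgHom)
  have hφ : Function.Surjective φ := by
    intro y
    choose x hx using fun i => Ideal.Quotient.mk_surjective (y i)
    refine ⟨e.symm x, ?_⟩
    ext i
    rw [← hx i]
    change Ideal.Quotient.mk _ (e (e.symm x) i) = _
    rw [e.apply_symm_apply]
  have hker : conductorIdeal A D = RingHom.ker φ := by
    ext x
    have h1 : x ∈ RingHom.ker φ ↔ ∀ i, addVal (B i) (b i) ≤ addVal (B i) (e x i) := by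
      rw [RingHom.mem_ker, funext_iff]
      refine forall_congr' fun i => ?_
      rw [addVal_le_iff_dvd, ← Ideal.mem_span_singleton, ← Ideal.Quotient.eq_zero_iff_mem]
      rfl
    rw [h1]
    simp only [hb]
    rw [← forall_mul_mem_range_iff hp hne hB]
    constructor
    · intro h y
      obtain ⟨a, ha⟩ := h (e.symm y)
      obtain ⟨g, rfl⟩ := hA a
      refine ⟨g, ?_⟩
      rw [← IsScalarTower.algebraMap_apply] at ha
      rw [← e.commutes g, ha, map_mul, e.apply_symm_apply]
    · intro h y
      obtain ⟨g, hg⟩ := h (e y)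
      refine ⟨algebraMap (PS K) A g, e.injective ?_⟩
      rw [← IsScalarTower.algebraMap_apply, e.commutes, hg, map_mul]
  rw [((Ideal.quotientEquivAlgOfEq (PS K) hker).trans
    (Ideal.quotientKerAlgEquivOfSurjective hφ)).toLinearEquiv.length_eq,
    Module.length_pi_of_fintype]
  refine Finset.sum_congr rfl fun i _ => ?_
  rw [(hB i).length_quotient_span, hb]

end Product

/-- The shift of the `i`-th conductor is the sum of the intersection numbers with the other
branches, finite because the branches are distinct. -/
theorem exists_conductorDegree_eq [IsAlgClosed K] {ι : Type*} [Fintype ι] [DecidableEq ι]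
    {p : ι → PS K} (hp : ∀ i, Irreducible (p i)) (hne : Pairwise fun i j => ¬ p i ∣ p j)
    {f : PS K} (hf : Associated f (∏ i, p i)) :
    ∃ (_ : ∀ i, IsDomain (Normalization (p i)))
      (_ : ∀ i, IsDiscreteValuationRing (Normalization (p i))),
      (∀ i, IsBranchRing (p i) (Normalization (p i))) ∧
      Module.Finite K (ConductorQuotient f) ∧
      (conductorDegree f : ℕ∞) = ∑ i, ((condExp K (Normalization (p i)) : ℕ∞) +
        ∑ j ∈ Finset.univ.erase i, interNum (p i) (p j)) := by
  choose hdom hdvr hB using fun i => isBranchRing_normalization (hp i)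
  refine ⟨hdom, hdvr, hB, ?_⟩
  obtain ⟨e⟩ := nonempty_normalization_algEquiv_pi hp hne hf
  have hlen := length_quotient_conductorIdeal hp hne hB (A := LocRing f)
    Ideal.Quotient.mk_surjective e
  have hval : ∀ i, val (Normalization (p i)) (∏ k ∈ Finset.univ.erase i, p k) =
      ∑ j ∈ Finset.univ.erase i, interNum (p i) (p j) := by
    intro i
    simp only [fun j => (hB i).interNum_eq_val (hp i) (p j)]
    induction Finset.univ.erase i using Finset.induction_on with
    | empty => simp [val]
    | insert k s hk ih => rw [Finset.prod_insert hk, Finset.sum_insert hk, val_mul, ih]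
  simp only [hval] at hlen
  rw [← length_eq_length_restrictScalars] at hlen
  have hne_top : Module.length K (ConductorQuotient f) ≠ ⊤ := by
    rw [hlen]
    refine WithTop.sum_ne_top.mpr fun i _ => WithTop.add_ne_top.mpr ⟨ENat.natCast_ne_top _, ?_⟩
    refine WithTop.sum_ne_top.mpr fun j hj => ?_
    rw [(hB i).interNum_eq_val (hp i)]
    exact mt (hB i).val_eq_top_iff.mp (hne (Finset.ne_of_mem_erase hj).symm)
  have hfin : Module.Finite K (ConductorQuotient f) := by
    rw [Module.length_ne_top_iff, isFiniteLength_iff_isNoetherian_isArtinian] at hne_top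
    exact @Module.IsNoetherian.finite _ _ _ _ _ hne_top.1
  exact ⟨hfin, by rw [conductorDegree, ← Module.length_eq_finrank, hlen]⟩

end PlaneCurve

/-! ### The Milnor number and the contact exponent -/

namespace PlaneCurve

open IsLocalRing MvPowerSeries IsDiscreteValuationRing

variable {K : Type*} [Field K]

theorem IsReducedCurve.exists_factorization {f : PS K} (hf : IsReducedCurve f) :
    ∃ (n : ℕ) (p : Fin n → PS K), (∀ i, Irreducible (p i)) ∧
      (Pairwise fun i j => ¬ p i ∣ p j) ∧ Associated f (∏ i, p i) := by
  obtain ⟨s, hs, hprod⟩ := WfDvdMonoid.exists_factors f hf.1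
  obtain ⟨l, rfl⟩ := Quot.exists_rep s
  have hl : ∏ i : Fin l.length, l.get i = l.prod := by
    rw [← List.prod_ofFn, List.ofFn_get]
  have hirr : ∀ i, Irreducible (l.get i) := fun i => hs _ (List.get_mem l i)
  have hass : Associated f (∏ i : Fin l.length, l.get i) := by
    rw [hl]
    exact hprod.symm
  refine ⟨l.length, l.get, hirr, fun i j hij hdvd => ?_, hass⟩
  refine (hirr i).not_isUnit (hf.2.2 _ ?_)
  refine dvd_trans ?_ hass.symm.dvd
  rw [← Finset.mul_prod_erase _ _ (Finset.mem_univ i)]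
  exact mul_dvd_mul_left _ (hdvd.trans
    (Finset.dvd_prod_of_mem l.get (Finset.mem_erase.mpr ⟨hij.symm, Finset.mem_univ j⟩)))

section Factorization

variable {n : ℕ} {p : Fin n → PS K} (hp : ∀ i, Irreducible (p i))
  (hne : Pairwise fun i j => ¬ p i ∣ p j) {f : PS K} (hf : Associated f (∏ i, p i))
include hp hf

theorem isBranchOf_iff_exists_associated {q : PS K} :
    IsBranchOf q f ↔ ∃ i, Associated q (p i) := by
  constructor
  · rintro ⟨hq, hqf⟩
    obtain ⟨i, -, hi⟩ := (hq.prime.dvd_finsetProd_iff _).mp (hqf.trans hf.dvd)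
    exact ⟨i, hq.associated_of_dvd (hp i) hi⟩
  · rintro ⟨i, hi⟩
    exact ⟨hi.symm.irreducible (hp i), hi.dvd.trans
      ((Finset.dvd_prod_of_mem p (Finset.mem_univ i)).trans hf.symm.dvd)⟩

theorem isBranchOf_factor (i : Fin n) : IsBranchOf (p i) f :=
  (isBranchOf_iff_exists_associated hp hf).mpr ⟨i, .refl _⟩

theorem branches_eq_range : branches f = Set.range fun i => Ideal.span {p i} := by
  ext I
  constructor
  · rintro ⟨q, hq, rfl⟩
    obtain ⟨i, hi⟩ := (isBranchOf_iff_exists_associated hp hf).mp hq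
    exact ⟨i, (Ideal.span_singleton_eq_span_singleton.mpr hi).symm⟩
  · rintro ⟨i, rfl⟩
    exact ⟨p i, isBranchOf_factor hp hf i, rfl⟩

theorem mult_eq_sum : mult f = ∑ i, mult (p i) := by
  have h : ∀ s : Finset (Fin n), mult (∏ i ∈ s, p i) = ∑ i ∈ s, mult (p i) := fun s => by
    induction s using Finset.induction_on with
    | empty =>
      rw [Finset.prod_empty, Finset.sum_empty, mult_eq_zero_iff one_ne_zero]
      exact isUnit_one
    | insert i s hi ih =>
      rw [Finset.prod_insert hi, Finset.sum_insert hi,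
        mult_mul (hp i).ne_zero (Finset.prod_ne_zero_iff.mpr fun j _ => (hp j).ne_zero), ih]
  rw [mult_eq_of_associated hf, h]

include hne

theorem numBranches_eq : numBranches f = n := by
  have hinj : Function.Injective fun i => Ideal.span {p i} := by
    intro i j hij
    by_contra h
    exact hne h (Ideal.span_singleton_eq_span_singleton.mp hij).dvd
  rw [numBranches, branches_eq_range hp hf, ← Set.image_univ, Set.ncard_image_of_injective _ hinj,
    Set.ncard_univ, Nat.card_fin]

end Factorization

/-- The infinite case is set apart because `toReal` and `toNat` send `⊤` to zero. -/
theorem toReal_branchContact_mul {p q : PS K} (hp : Irreducible p) (hq : Irreducible q) :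
    (branchContact p q).toReal * mult p * mult q = ((interNum p q).toNat : ℝ) ∨
      interNum p q = ⊤ := by
  by_cases h : interNum p q = ⊤
  · exact Or.inr h
  · left
    obtain ⟨m, hm⟩ := ENat.ne_top_iff_exists.mp h
    have h1 : (mult p : ℝ) ≠ 0 := by exact_mod_cast (mult_pos_of_irreducible hp).ne'
    have h2 : (mult q : ℝ) ≠ 0 := by exact_mod_cast (mult_pos_of_irreducible hq).ne'
    rw [branchContact, ← hm, ENNReal.toReal_div, ENNReal.toReal_mul]
    simp only [ENat.toENNReal_coe, ENNReal.toReal_natCast, ENat.toNat_natCast]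
    field_simp

theorem branchContact_ne_top {p q : PS K} (hp : Irreducible p) (hq : Irreducible q)
    (h : interNum p q ≠ ⊤) : branchContact p q ≠ ⊤ := by
  refine ENNReal.div_ne_top (ENat.toENNReal_ne_top.mpr h) (mul_ne_zero ?_ ?_)
  · exact_mod_cast (mult_pos_of_irreducible hp).ne'
  · exact_mod_cast (mult_pos_of_irreducible hq).ne'

theorem semigroup_congr {p q : PS K} (h : Associated p q) : semigroup p = semigroup q := by
  ext m
  refine exists_congr fun g => ?_
  rw [h.dvd_iff_dvd_left, interNum_congr h (Associated.refl g)]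

theorem isZariskiPairs_congr {p q : PS K} (h : Associated p q) {L : List (ℕ × ℕ)} :
    IsZariskiPairs p L ↔ IsZariskiPairs q L := by
  rw [IsZariskiPairs, semigroup_congr h, IsZariskiPairs]

theorem contactExp_congr {f g : PS K} (h : Associated f g) : contactExp f = contactExp g := by
  simp only [contactExp, contact, IsBranchOf, h.dvd_iff_dvd_right]

/-- The contribution of a single branch to the bound for the Milnor number. -/
theorem IsBranchRing.mul_sub_one_le_condExp [Infinite K] {p : PS K} {B : Type*} [CommRing B]
    [IsDomain B] [IsDiscreteValuationRing B] [Algebra (PS K) B] (hB : IsBranchRing p B)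
    (hp : Irreducible p) {d : ℝ≥0∞} (hd : d ≤ contactExp p) (hdtop : d ≠ ⊤) :
    (d.toReal * mult p - 1) * ((mult p : ℝ) - 1) ≤ condExp K B ∧
      ((d.toReal * mult p - 1) * ((mult p : ℝ) - 1) = condExp K B ↔
        (2 ≤ mult p → (∃ mn : ℕ × ℕ, IsZariskiPairs p [mn]) ∧ contactExp p = d)) := by
  have hpos := mult_pos_of_irreducible hp
  rcases Nat.lt_or_ge 1 (mult p) with h2 | h1
  · obtain ⟨v, hv, hexp, hle, heq⟩ := hB.condExp_of_two_le hp h2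
    have hm0 : (mult p : ℝ) ≠ 0 := by exact_mod_cast hpos.ne'
    have hm1 : (0 : ℝ) < (mult p : ℝ) - 1 := by
      rw [sub_pos]
      exact_mod_cast h2
    have hvtop : contactExp p ≠ ⊤ := by
      rw [hexp]
      exact ENNReal.div_ne_top (ENNReal.natCast_ne_top _) (by exact_mod_cast hpos.ne')
    have hvm : (contactExp p).toReal * mult p = v := by
      rw [hexp, ENNReal.toReal_div, ENNReal.toReal_natCast, ENNReal.toReal_natCast,
        div_mul_cancel₀ _ hm0]
    have hcast : (((mult p - 1) * (v - 1) : ℕ) : ℝ) = (v - 1) * ((mult p : ℝ) - 1) := by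
      rw [Nat.cast_mul, Nat.cast_sub hpos, Nat.cast_sub (by omega), Nat.cast_one, mul_comm]
    have hle' : ((v : ℝ) - 1) * ((mult p : ℝ) - 1) ≤ condExp K B := by
      rw [← hcast]
      exact_mod_cast hle
    have heq' : ((v : ℝ) - 1) * ((mult p : ℝ) - 1) = condExp K B ↔
        ∃ mn : ℕ × ℕ, IsZariskiPairs p [mn] := by
      rw [← heq, ← hcast, eq_comm]
      exact Nat.cast_inj
    have hdr : d.toReal * mult p ≤ v := by
      rw [← hvm]
      exact mul_le_mul_of_nonneg_right (ENNReal.toReal_mono hvtop hd) (by positivity)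
    have hdeq : d.toReal * mult p = v ↔ contactExp p = d := by
      rw [← hvm, mul_left_inj' hm0, ENNReal.toReal_eq_toReal_iff' hdtop hvtop, eq_comm]
    have hle1 : (d.toReal * mult p - 1) * ((mult p : ℝ) - 1) ≤ (v - 1) * ((mult p : ℝ) - 1) :=
      mul_le_mul_of_nonneg_right (by linarith) hm1.le
    refine ⟨hle1.trans hle', fun h _ => ⟨heq'.mp (le_antisymm hle' (h ▸ hle1)), ?_⟩, fun h => ?_⟩
    · have h3 := mul_right_cancel₀ hm1.ne' (le_antisymm hle1 (h ▸ hle'))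
      exact hdeq.mp (by linarith)
    · obtain ⟨h3, h4⟩ := h h2
      rw [hdeq.mpr h4, heq'.mpr h3]
  -- A smooth branch has conductor zero and a vanishing factor `mult p - 1`, and the equality
  -- condition is vacuous.
  · have hm : mult p = 1 := by omega
    rw [hB.condExp_of_mult_eq_one hp hm, hm]
    simp

end PlaneCurve

open PlaneCurve

theorem mainTheorem5 {K : Type*} [Field K] [IsAlgClosed K] (f : PlaneCurve.PS K)
    (hf : PlaneCurve.IsReducedCurve f) (hsing : 2 ≤ PlaneCurve.mult f) :
    -- the invariants of the curve are finite
    (PlaneCurve.branches f).Finite ∧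
    Module.Finite K (PlaneCurve.ConductorQuotient f) ∧
    PlaneCurve.contactExp f ≠ ⊤ ∧
    -- the bound for the Milnor number
    ((PlaneCurve.contactExp f).toReal * (PlaneCurve.mult f : ℝ) - 1) *
        ((PlaneCurve.mult f : ℝ) - 1) ≤ (PlaneCurve.milnor f : ℝ) ∧
    -- the case of equality
    ((PlaneCurve.milnor f : ℝ) =
        ((PlaneCurve.contactExp f).toReal * (PlaneCurve.mult f : ℝ) - 1) *
          ((PlaneCurve.mult f : ℝ) - 1) ↔
      (∀ p q : PlaneCurve.PS K, PlaneCurve.IsBranchOf p f → PlaneCurve.IsBranchOf q f →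
        ¬ Associated p q → PlaneCurve.branchContact p q = PlaneCurve.contactExp f) ∧
      (∀ p : PlaneCurve.PS K, PlaneCurve.IsBranchOf p f → 2 ≤ PlaneCurve.mult p →
        (∃ mn : ℕ × ℕ, PlaneCurve.IsZariskiPairs p [mn]) ∧
          PlaneCurve.contactExp p = PlaneCurve.contactExp f)) := by

  have : Infinite K := IsAlgClosed.instInfinite
  obtain ⟨n, p, hp, hne, hfp⟩ := hf.exists_factorization
  obtain ⟨hdom, hdvr, hB, hfin, hc⟩ := exists_conductorDegree_eq hp hne hfp
  have hbr := isBranchOf_factor hp hfp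
  have hmult := mult_eq_sum hp hfp
  have hitop : ∀ i j, i ≠ j → interNum (p i) (p j) ≠ ⊤ := by
    intro i j hij
    rw [(hB i).interNum_eq_val (hp i)]
    exact mt (hB i).val_eq_top_iff.mp (hne hij)
  -- A singular branch bounds `d(C)` by its own finite contact exponent. If all branches are smooth,
  -- multiplicity at least two provides two of them, and their order of contact bounds `d(C)`.
  have htop : contactExp f ≠ ⊤ := by
    by_cases h : ∃ i, 2 ≤ mult (p i)
    · obtain ⟨i, hi⟩ := h
      obtain ⟨v, -, hv, -⟩ := (hB i).condExp_of_two_le (hp i) hi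
      refine ne_top_of_le_ne_top ?_ (contactExp_le_of_isBranchOf (hbr i))
      rw [hv]
      exact ENNReal.div_ne_top (ENNReal.natCast_ne_top _) (by
        exact_mod_cast (mult_pos_of_irreducible (hp i)).ne')
    · have h1 : mult f ≤ n := by
        rw [hmult]
        refine (Finset.sum_le_card_nsmul Finset.univ _ 1 fun i _ => ?_).trans (by simp)
        exact Nat.le_of_lt_succ (not_le.mp fun hi => h ⟨i, hi⟩)
      have h2 : 2 ≤ n := hsing.trans h1
      have h01 : (⟨0, by omega⟩ : Fin n) ≠ ⟨1, by omega⟩ := by simp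
      exact ne_top_of_le_ne_top (branchContact_ne_top (hp _) (hp _) (hitop _ _ h01))
        (contactExp_le_branchContact (hbr _) (hbr _))
  set d := (contactExp f).toReal with hd
  let I : Fin n → Fin n → ℝ := fun i j => ((interNum (p i) (p j)).toNat : ℝ)
  let m : Fin n → ℝ := fun i => mult (p i)
  let c : Fin n → ℝ := fun i => condExp K (Normalization (p i))
  have hm0 : ∀ i, 0 < m i := fun i =>
    Nat.cast_pos.mpr (mult_pos_of_irreducible (hp i))
  have hI : ∀ i j, i ≠ j → d * m i * m j ≤ I i j ∧
      (d * m i * m j = I i j ↔ branchContact (p i) (p j) = contactExp f) := by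
    intro i j hij
    have h1 := (toReal_branchContact_mul (hp i) (hp j)).resolve_right (hitop i j hij)
    have h2 := branchContact_ne_top (hp i) (hp j) (hitop i j hij)
    have h3 : d ≤ (branchContact (p i) (p j)).toReal :=
      ENNReal.toReal_mono h2 (contactExp_le_branchContact (hbr i) (hbr j))
    change d * m i * m j ≤ I i j ∧ _
    have h4 : I i j = (branchContact (p i) (p j)).toReal * m i * m j := h1.symm
    rw [h4]
    refine ⟨mul_le_mul_of_nonneg_right (mul_le_mul_of_nonneg_right h3 (hm0 i).le) (hm0 j).le, ?_⟩
    rw [mul_left_inj' (hm0 j).ne', mul_left_inj' (hm0 i).ne', hd,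
      ENNReal.toReal_eq_toReal_iff' htop h2, eq_comm]
  have hC := fun i => (hB i).mul_sub_one_le_condExp (hp i) (contactExp_le_of_isBranchOf (hbr i)) htop
  have hcond : (conductorDegree f : ℝ) = ∑ i, (c i + ∑ j ∈ Finset.univ.erase i, I i j) := by
    have h1 : (conductorDegree f : ℕ∞) = ((∑ i, (condExp K (Normalization (p i)) +
        ∑ j ∈ Finset.univ.erase i, (interNum (p i) (p j)).toNat) : ℕ) : ℕ∞) := by
      rw [hc, Nat.cast_sum]
      refine Finset.sum_congr rfl fun i _ => ?_
      rw [Nat.cast_add, Nat.cast_sum]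
      congr 1
      refine Finset.sum_congr rfl fun j hj => ?_
      rw [ENat.natCast_toNat (hitop i j (Finset.ne_of_mem_erase hj).symm)]
    rw [Nat.cast_inj.mp h1]
    push_cast
    rfl
  have hmil : (milnor f : ℝ) = ∑ i, (c i + ∑ j ∈ Finset.univ.erase i, I i j) - n + 1 := by
    rw [milnor, numBranches_eq hp hne hfp, ← hcond]
    push_cast
    rfl
  -- Expanding with `m = ∑ m i`, both sides equal `d m ^ 2 - (d + 1) m + 1`: the constants `1` of
  -- the `n` summands cancel against `- n`.
  have hbound : (d * (mult f : ℝ) - 1) * ((mult f : ℝ) - 1) =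
      ∑ i, ((d * m i - 1) * (m i - 1) + ∑ j ∈ Finset.univ.erase i, d * m i * m j) - n + 1 := by
    have h1 : (mult f : ℝ) = ∑ i, m i := by
      rw [hmult]
      push_cast
      rfl
    have h2 : ∀ i, (d * m i - 1) * (m i - 1) + ∑ j ∈ Finset.univ.erase i, d * m i * m j =
        (d * ∑ j, m j) * m i - (d + 1) * m i + 1 := by
      intro i
      rw [← Finset.mul_sum, ← Finset.add_sum_erase _ m (Finset.mem_univ i)]
      ring
    simp only [h2]
    rw [Finset.sum_add_distrib, Finset.sum_sub_distrib, ← Finset.mul_sum, ← Finset.mul_sum, ← h1]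
    simp only [Finset.sum_const, Finset.card_univ, Fintype.card_fin, nsmul_eq_mul, mul_one]
    ring
  have hIsum : ∀ i, ∑ j ∈ Finset.univ.erase i, d * m i * m j ≤ ∑ j ∈ Finset.univ.erase i, I i j :=
    fun i => Finset.sum_le_sum fun j hj => (hI i j (Finset.ne_of_mem_erase hj).symm).1
  have hterm : ∀ i ∈ Finset.univ, (d * m i - 1) * (m i - 1) +
      ∑ j ∈ Finset.univ.erase i, d * m i * m j ≤ c i + ∑ j ∈ Finset.univ.erase i, I i j :=
    fun i _ => add_le_add (hC i).1 (hIsum i)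
  refine ⟨?_, hfin, htop, ?_, ?_⟩
  · rw [branches_eq_range hp hfp]
    exact Set.finite_range _
  · rw [hmil, hbound]
    have := Finset.sum_le_sum hterm
    linarith
  -- Both sums run over the same indices with termwise inequalities, so they agree only if every
  -- summand does.
  · rw [hmil, hbound, add_left_inj, sub_left_inj, eq_comm, Finset.sum_eq_sum_iff_of_le hterm]
    have hiff : ∀ i, (d * m i - 1) * (m i - 1) + ∑ j ∈ Finset.univ.erase i, d * m i * m j =
        c i + ∑ j ∈ Finset.univ.erase i, I i j ↔
        (2 ≤ mult (p i) → (∃ mn : ℕ × ℕ, IsZariskiPairs (p i) [mn]) ∧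
          contactExp (p i) = contactExp f) ∧
        ∀ j, i ≠ j → branchContact (p i) (p j) = contactExp f := by
      intro i
      rw [add_eq_add_iff_eq_and_eq (hC i).1 (hIsum i), Finset.sum_eq_sum_iff_of_le
        fun j hj => (hI i j (Finset.ne_of_mem_erase hj).symm).1, ← (hC i).2]
      refine and_congr Iff.rfl (forall_congr' fun j => ?_)
      simp only [Finset.mem_erase, Finset.mem_univ, and_true]
      exact ⟨fun h hij => (hI i j hij).2.mp (h hij.symm), fun h hij => (hI i j hij.symm).2.mpr
        (h hij.symm)⟩
    simp only [Finset.mem_univ, true_imp_iff, hiff]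
    constructor
    · intro h
      refine ⟨fun q q' hq hq' hqq' => ?_, fun q hq hq2 => ?_⟩
      · obtain ⟨i, hi⟩ := (isBranchOf_iff_exists_associated hp hfp).mp hq
        obtain ⟨j, hj⟩ := (isBranchOf_iff_exists_associated hp hfp).mp hq'
        rw [branchContact_congr hi hj]
        refine (h i).2 j ?_
        rintro rfl
        exact hqq' (hi.trans hj.symm)
      · obtain ⟨i, hi⟩ := (isBranchOf_iff_exists_associated hp hfp).mp hq
        rw [mult_eq_of_associated hi] at hq2
        rw [contactExp_congr hi]
        simp only [isZariskiPairs_congr hi]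
        exact (h i).1 hq2
    · rintro ⟨h1, h2⟩ i
      exact ⟨h2 _ (hbr i), fun j hij => h1 _ _ (hbr i) (hbr j) fun h => hne hij h.dvd⟩
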